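/- **Setting.** Let $P(x)=\frac1n\sum_{\tau=1}^n f^{(\tau)}(x)+\psi(x)$ on $\mathbb R^d$, $f^{(\tau)}=\frac1m\sum_{i=1}^m f_i^{(\tau)}$, where all $f_i^{(\tau)}$ are convex, $\frac1n\sum_\tau f^{(\tau)}$ is $L_f$-smooth, each $f^{(\tau)}$ is $\bar L$-smooth, each $f_i^{(\tau)}$ is $L$-smooth, and $\psi$ is $\lambda$-strongly convex ($\lambda>0$) and $L_\psi$-smooth. Let $Q,Q_1$ be randomized maps of $\mathbb R^d$ with $\mathbb E\|x-Q(x)\|^2\le(1-\delta)\|x\|^2$, $\mathbb E\|x-Q_1(x)\|^2\le(1-\delta_1)\|x\|^2$, $\mathbb E[Q(x)]=\delta x$, $\mathbb E[Q_1(x)]=\delta_1x$ for all $x$, where $\delta,\delta_1\in(0,1]$. **Catalyst.** Let $\kappa\ge0$, $q=\lambda/(\lambda+\kappa)$, $0\le\rho_0<\sqrt q$, $y^{-1}=y^0=x^0$ with $P(x^0)>P^*=\min P$, $\alpha_0=\sqrt q$, and $\epsilon_k=\frac29(P(x^0)-P^*)(1-\rho_0)^k$. For $k=1,2,\dots$ an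 inner solver is run on $G_k(x)=P(x)+\frac\kappa2\|x-y^{k-1}\|^2$ and outputs $x^k$; then $y^k=x^k+\beta_k(x^k-x^{k-1})$, where $\alpha_k>0$ solves $\alpha_k^2=(1-\alpha_k)\alpha_{k-1}^2+q\alpha_k$ and $\beta_k=\frac{\alpha_{k-1}(1-\alpha_{k-1})}{\alpha_{k-1}^2+\alpha_k}$. Put $G_k^*=\min G_k$, $x_{(k)}^*=\arg\min G_k$. **Inner solver (EC-LSVRG).** Put $F_i^{(\tau)}=f_i^{(\tau)}+\psi+\frac\kappa2\|\cdot-y^{k-1}\|^2$ and $F^{(\tau)}=\frac1m\sum_iF_i^{(\tau)}$. Given $x^0_{(k)}=w^0$, $e_\tau^0$, $h_\tau^0$ and $h^0=\frac1n\sum_\tau h_\tau^0$, iteration $K=0,1,\dots$ draws, independently of everything else, indices $i^\tau$ uniform on $\{1,\dots,m\}$, a coin $u\in\{0,1\}$ with $\mathbb P(u=1)=p\in(0,1]$, and fresh copies of $Q$ and $Q_1$ for every node $\tau$, and sets $g_\tau=\nabla F_{i^\tau}^{(\tau)}(x^K)-\nabla F_{i^\tau}^{(\tau)}(w^K)+\nabla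 F^{(\tau)}(w^K)-h_\tau^K$, $y_\tau=Q(\eta g_\tau+e_\tau^K)$, $e_\tau^{K+1}=e_\tau^K+\eta g_\tau-y_\tau$, $z_\tau=Q_1(\nabla F^{(\tau)}(w^K)-h_\tau^K)$, $h_\tau^{K+1}=h_\tau^K+z_\tau$, $x^{K+1}=x^K-\frac1n\sum_\tau y_\tau-\eta h^K$, $h^{K+1}=h^K+\frac1n\sum_\tau z_\tau$, and $w^{K+1}=x^K$ if $u=1$, $w^{K+1}=w^K$ otherwise. **Warm start.** $x^0_{(k)}=x^{k-1}$; $e^0_{\tau,(k)}=0$ or $e^{T_{k-1}}_{\tau,(k-1)}$; $h^0_{\tau,(k)}=h^{T_{k-1}}_{\tau,(k-1)}$ or $h^{T_{k-1}}_{\tau,(k-1)}+\kappa(y^{k-2}-y^{k-1})$ (either choice may be made in each outer iteration). At the very start $e_\tau=0$ and $h_\tau=h^{\mathrm{init}}_\tau\in\mathbb R^d$ is arbitrary. **Stopping rule and output.** $T_k=\inf\{K\ge1:\Phi_{4,(k)}^K+G_k(x_{(k)}^K)-G_k^*\le\epsilon_k\}$ and $x^k=x_{(k)}^{T_k}$.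 Here, with $e=\frac1n\sum_\tau e_\tau$, $\ell_f=L_f+L_\psi+\kappa$, $\ell=L+L_\psi+\kappa$, $$\Phi_4=\|x-e-x^*_{(k)}\|^2+a_0\|e\|^2+\tfrac{a_1}{n^2}\sum_\tau\|e_\tau\|^2+a_2\|h-\nabla G_k(w)\|^2+\tfrac{a_3}{n^2}\sum_\tau\|h_\tau-\nabla F^{(\tau)}(w)\|^2+a_4(G_k(w)-G_k^*),$$ whose coefficients agree, up to factors in $[B^{-1},B]$, with $\frac{\ell_f\eta}{\delta}$, $\frac{(1-\delta)\ell_f\eta}{\delta}$, $\frac{(1-\delta)\ell_f\eta^3}{\delta^2\delta_1}$, $\frac{(1-\delta)\ell_f\eta^3}{\delta^2\delta_1}$, $\frac1p\Big(\frac{(1-\delta)\ell_f\eta^3}{\delta^2}\big(\ell_f+\frac{\delta\ell}{n}\big)+\frac{\ell\eta^2}{n}\Big)$, respectively. **Statement.** For every $B\ge1$ there is $c_0>0$ such that for every $c\in(0,c_0]$ there is $C>0$ ($c_0$ depends only on $B$, and $C$ only on $B$ and $c$) with the following property. In every setting as above with $\delta_1/B\le p\le B\delta_1$ and stepsize $c/D\le\eta\le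 c_0/D$, $D=\ell_f+\frac{\ell}{n}+\frac{\sqrt{1-\delta}\,\ell_f}{\delta}$, one has for all $k\ge1$ $$\mathbb E[T_k]\le C\left(\frac1\delta+\frac1{\delta_1}+\frac{L_f+L_\psi}{\lambda+\kappa}+\frac{L}{n(\lambda+\kappa)}+\frac{\sqrt{1-\delta}\,(L_f+L_\psi+\lambda+\kappa)}{\delta(\lambda+\kappa)}\right)\log\Lambda,$$ $$\Lambda=2+nm+\tfrac1\delta+\tfrac1{\delta_1}+\lambda+\tfrac1\lambda+\kappa+L_f+L_\psi+L+\tfrac1{\sqrt q-\rho_0}+\frac{\frac1n\sum_\tau\|h^{\mathrm{init}}_\tau-\nabla f^{(\tau)}(x^0)-\nabla\psi(x^0)\|^2}{P(x^0)-P^*}.$$ When $L_\psi=O(\lambda)$ (for instance $\psi=\frac\lambda2\|x\|^2$), this is $\tilde O\big(\frac1\delta+\frac1{\delta_1}+\frac{L_f}{\lambda+\kappa}+\frac{L}{n(\lambda+\kappa)}+\frac{\sqrt{1-\delta}(L_f+\lambda+\kappa)}{\delta(\lambda+\kappa)}\big)$. -/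

import Mathlib

open MeasureTheory ProbabilityTheory
open scoped ENNReal

noncomputable section

namespace ECCatalyst

/-- The space `ℝ^d` with its Euclidean norm. -/
abbrev Vec (d : ℕ) := EuclideanSpace ℝ (Fin d)

/-! ### Smooth functions and finite sums -/

/-- `f` is `L`-smooth: differentiable with `L`-Lipschitz gradient. -/
def IsSmooth {d : ℕ} (L : ℝ) (f : Vec d → ℝ) : Prop :=
  Differentiable ℝ f ∧ ∀ x y, ‖gradient f x - gradient f y‖ ≤ L * ‖x - y‖

/-- The arithmetic mean of `n` vectors. -/
def avg {n d : ℕ} (v : Fin n → Vec d) : Vec d := (1 / (n : ℝ)) • ∑ τ, v τ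

/-- The local loss of node `τ`: the average of `f τ i` over `i`. -/
def nodeAvg {n m d : ℕ} (f : Fin n → Fin m → Vec d → ℝ) (τ : Fin n) (x : Vec d) : ℝ :=
  (1 / (m : ℝ)) * ∑ i, f τ i x

/-- The average of the local losses over the nodes. -/
def globalAvg {n m d : ℕ} (f : Fin n → Fin m → Vec d → ℝ) (x : Vec d) : ℝ :=
  (1 / (n : ℝ)) * ∑ τ, nodeAvg f τ x

/-- A minimizer of `F` (an arbitrary point if there is none). -/
def argmin {d : ℕ} (F : Vec d → ℝ) : Vec d := Classical.epsilon fun x => ∀ y, F x ≤ F y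

/-! ### Randomized compressors -/

/-- The randomized map `x ↦ Q s x`, with `s` drawn from `ν`, is a contraction compressor with
parameter `δ ∈ (0, 1]`: `E ‖x - Q(x)‖² ≤ (1 - δ) ‖x‖²` for all `x`. -/
structure IsContractionCompressor {S : Type*} [MeasurableSpace S] {d : ℕ} (ν : Measure S)
    (Q : S → Vec d → Vec d) (δ : ℝ) : Prop where
  measurable : Measurable (Function.uncurry Q)
  pos : 0 < δ
  le_one : δ ≤ 1
  contraction : ∀ x, ∫⁻ s, ENNReal.ofReal (‖x - Q s x‖ ^ 2) ∂ν
    ≤ ENNReal.ofReal ((1 - δ) * ‖x‖ ^ 2)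

/-! ### EC-LSVRG (without regularizer) -/

/-- The state of EC-LSVRG: the iterate `x`, the checkpoint `w`, the compression errors `e τ`, the
vectors `h τ` and the vector `hbar` (the running average of the `h τ`). -/
structure State (n d : ℕ) where
  x : Vec d
  w : Vec d
  e : Fin n → Vec d
  h : Fin n → Vec d
  hbar : Vec d

/-- The randomness of one iteration: for each node, the sampled index and the seeds of the two
compressors; and the coin that decides whether the checkpoint is updated. -/
abbrev Noise (n m : ℕ) (S S₁ : Type*) := (Fin n → Fin m × S × S₁) × Bool

/-- The law of the randomness of one iteration: all components are independent, indices are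
uniform on `[m]`, seeds have laws `ν` and `ν₁`, and the coin is `true` with probability `p`. -/
def noiseLaw (n m : ℕ) [NeZero m] {S S₁ : Type*} [MeasurableSpace S] [MeasurableSpace S₁]
    (ν : Measure S) (ν₁ : Measure S₁) (p : ℝ) : Measure (Noise n m S S₁) :=
  (Measure.pi fun _ : Fin n =>
      (PMF.uniformOfFintype (Fin m)).toMeasure.prod (ν.prod ν₁)).prod
    (ENNReal.ofReal p • Measure.dirac true + ENNReal.ofReal (1 - p) • Measure.dirac false)

/-- One iteration of EC-LSVRG on the finite sum with components `F τ i`, with stepsize `η`. -/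
def ecStep {n m d : ℕ} {S S₁ : Type*} (Q : S → Vec d → Vec d) (Q₁ : S₁ → Vec d → Vec d)
    (F : Fin n → Fin m → Vec d → ℝ) (η : ℝ) (ζ : Noise n m S S₁) (s : State n d) : State n d :=
  let g : Fin n → Vec d := fun τ =>
    gradient (F τ (ζ.1 τ).1) s.x - gradient (F τ (ζ.1 τ).1) s.w
      + gradient (nodeAvg F τ) s.w - s.h τ
  let y : Fin n → Vec d := fun τ => Q (ζ.1 τ).2.1 (η • g τ + s.e τ)
  let z : Fin n → Vec d := fun τ => Q₁ (ζ.1 τ).2.2 (gradient (nodeAvg F τ) s.w - s.h τ)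
  { x := s.x - (avg y + η • s.hbar)
    w := if ζ.2 = true then s.x else s.w
    e := fun τ => s.e τ + η • g τ - y τ
    h := fun τ => s.h τ + z τ
    hbar := s.hbar + avg z }

/-- The EC-LSVRG iterates from the state `s₀`; iteration `K` uses the randomness `ζ K`. -/
def ecRun {n m d : ℕ} {S S₁ : Type*} (Q : S → Vec d → Vec d) (Q₁ : S₁ → Vec d → Vec d)
    (F : Fin n → Fin m → Vec d → ℝ) (η : ℝ) (s₀ : State n d) (ζ : ℕ → Noise n m S S₁) :
    ℕ → State n d
  | 0 => s₀
  | K + 1 => ecStep Q Q₁ F η (ζ K) (ecRun Q Q₁ F η s₀ ζ K)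

/-- `inf {K ≥ 1 : crit K}`, equal to `⊤` if there is no such `K`. -/
def firstHit (crit : ℕ → Prop) : ℕ∞ := ⨅ (K : ℕ) (_ : 1 ≤ K ∧ crit K), (K : ℕ∞)

/-! ### Catalyst coefficients -/

/-- `α₀ = √q`, and `α_{k+1}` is the positive root of `α² = (1 - α) α_k² + q α`. -/
def alpha (q : ℝ) : ℕ → ℝ
  | 0 => √q
  | k + 1 => ((q - alpha q k ^ 2) + √((q - alpha q k ^ 2) ^ 2 + 4 * alpha q k ^ 2)) / 2

theorem alpha_succ_eq (q : ℝ) (k : ℕ) :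
    alpha q (k + 1) ^ 2 = (1 - alpha q (k + 1)) * alpha q k ^ 2 + q * alpha q (k + 1) := by
  have h := Real.sq_sqrt (show 0 ≤ (q - alpha q k ^ 2) ^ 2 + 4 * alpha q k ^ 2 by positivity)
  simp only [alpha]
  nlinarith [h]

/-- `β_{k+1} = α_k (1 - α_k) / (α_k² + α_{k+1})`; the argument is `k`. -/
def betaSucc (q : ℝ) (k : ℕ) : ℝ :=
  alpha q k * (1 - alpha q k) / (alpha q k ^ 2 + alpha q (k + 1))

/-! ### EC-LSVRG inside Catalyst -/

/-- The data of a run of Catalyst with EC-LSVRG as inner solver. -/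
structure Config (n m d : ℕ) (S S₁ : Type*) where
  /-- the component functions `f_i^{(τ)}` -/
  f : Fin n → Fin m → Vec d → ℝ
  /-- the regularizer -/
  ψ : Vec d → ℝ
  /-- the two compressors -/
  Q : S → Vec d → Vec d
  Q₁ : S₁ → Vec d → Vec d
  /-- smoothness constants of the mean of all components, of each node, of each component, of `ψ` -/
  Lf : ℝ
  Lbar : ℝ
  L : ℝ
  Lψ : ℝ
  /-- strong convexity constant of `ψ` -/
  lam : ℝ
  κ : ℝ
  δ : ℝ
  δ₁ : ℝ
  /-- stepsize and checkpoint probability of the inner solver -/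
  η : ℝ
  p : ℝ
  ρ₀ : ℝ
  /-- the starting point, and the vectors `h_τ` at the start of the first outer iteration -/
  x₀ : Vec d
  h₀ : Fin n → Vec d
  /-- the five coefficients of the Lyapunov function -/
  a : Fin 5 → ℝ
  /-- for each outer iteration: whether `e_τ` is carried over (`true`) or reset to zero -/
  carryE : ℕ → Bool
  /-- for each outer iteration: whether `h_τ` is corrected by `κ (y^{k-2} - y^{k-1})` -/
  shiftH : ℕ → Bool

namespace Config

variable {n m d : ℕ} {S S₁ : Type*}

/-- The objective `P`. -/
def P (D : Config n m d S S₁) (x : Vec d) : ℝ := globalAvg D.f x + D.ψ x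

/-- The components of the Catalyst subproblem with prox-center `y`: `ψ` and the quadratic term are
moved into every component. -/
def comp (D : Config n m d S S₁) (y : Vec d) (τ : Fin n) (i : Fin m) (x : Vec d) : ℝ :=
  D.f τ i x + D.ψ x + D.κ / 2 * ‖x - y‖ ^ 2

/-- The Catalyst subproblem `G(x) = P(x) + κ/2 ‖x - y‖²`. -/
def G (D : Config n m d S S₁) (y x : Vec d) : ℝ := D.P x + D.κ / 2 * ‖x - y‖ ^ 2

/-- `q = λ / (λ + κ)`. -/
def q (D : Config n m d S S₁) : ℝ := D.lam / (D.lam + D.κ)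

/-- `ε_k = (2/9) (P(x⁰) - P^*) (1 - ρ₀)^k`. -/
def eps (D : Config n m d S S₁) (k : ℕ) : ℝ :=
  2 / 9 * (D.P D.x₀ - ⨅ x, D.P x) * (1 - D.ρ₀) ^ k

/-- Smoothness constant of the objective `G` of the subproblem. -/
def ellf (D : Config n m d S S₁) : ℝ := D.Lf + D.Lψ + D.κ

/-- Smoothness constant of every component of the subproblem. -/
def ell (D : Config n m d S S₁) : ℝ := D.L + D.Lψ + D.κ

/-- The Lyapunov function `Φ₄` of EC-LSVRG for the subproblem with prox-center `y`. -/
def Phi4 (D : Config n m d S S₁) (y : Vec d) (s : State n d) : ℝ :=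
  ‖s.x - avg s.e - argmin (D.G y)‖ ^ 2
    + D.a 0 * ‖avg s.e‖ ^ 2
    + D.a 1 * ((1 / (n : ℝ) ^ 2) * ∑ τ, ‖s.e τ‖ ^ 2)
    + D.a 2 * ‖s.hbar - gradient (D.G y) s.w‖ ^ 2
    + D.a 3 * ((1 / (n : ℝ) ^ 2) * ∑ τ, ‖s.h τ - gradient (nodeAvg (D.comp y) τ) s.w‖ ^ 2)
    + D.a 4 * (D.G y s.w - ⨅ x, D.G y x)

/-- The magnitudes of the coefficients of `Φ₄`. -/
def refWeight (D : Config n m d S S₁) : Fin 5 → ℝ :=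
  ![D.ellf * D.η / D.δ,
    (1 - D.δ) * D.ellf * D.η / D.δ,
    (1 - D.δ) * D.ellf * D.η ^ 3 / (D.δ ^ 2 * D.δ₁),
    (1 - D.δ) * D.ellf * D.η ^ 3 / (D.δ ^ 2 * D.δ₁),
    (1 / D.p) * ((1 - D.δ) * D.ellf * D.η ^ 3 / D.δ ^ 2 * (D.ellf + D.δ * D.ell / n)
      + D.ell * D.η ^ 2 / n)]

/-- What is remembered after outer iteration `k`: `x^k`, `y^k`, `y^{k-1}`, and the last vectors
`e_τ`, `h_τ` of the inner loop. -/
structure Outer (n d : ℕ) where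
  x : Vec d
  y : Vec d
  yPrev : Vec d
  e : Fin n → Vec d
  h : Fin n → Vec d

/-- The initial state of the inner loop of outer iteration `k`, given the outcome of outer
iteration `k - 1`. -/
def warmStart (D : Config n m d S S₁) (k : ℕ) (o : Outer n d) : State n d :=
  let h : Fin n → Vec d := fun τ =>
    if D.shiftH k = true then o.h τ + D.κ • (o.yPrev - o.y) else o.h τ
  { x := o.x
    w := o.x
    e := fun τ => if D.carryE k = true then o.e τ else 0
    h := h
    hbar := avg h }

/-- The inner iterates of outer iteration `k`. -/
def inner (D : Config n m d S S₁) (k : ℕ) (o : Outer n d) (ζ : ℕ → Noise n m S S₁) :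
    ℕ → State n d :=
  ecRun D.Q D.Q₁ (D.comp o.y) D.η (D.warmStart k o) ζ

/-- The number of inner iterations of outer iteration `k`. -/
def count (D : Config n m d S S₁) (k : ℕ) (o : Outer n d) (ζ : ℕ → Noise n m S S₁) : ℕ∞ :=
  firstHit fun K =>
    D.Phi4 o.y (D.inner k o ζ K) + (D.G o.y (D.inner k o ζ K).x - ⨅ x, D.G o.y x) ≤ D.eps k

/-- The outcome of outer iteration `k`; its inner loop uses the randomness `ζ (k, ·)`. -/
def outer (D : Config n m d S S₁) (ζ : ℕ × ℕ → Noise n m S S₁) : ℕ → Outer n d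
  | 0 => { x := D.x₀, y := D.x₀, yPrev := D.x₀, e := fun _ => 0, h := D.h₀ }
  | k + 1 =>
    let o := outer D ζ k
    let ζk : ℕ → Noise n m S S₁ := fun K => ζ (k + 1, K)
    let s := D.inner (k + 1) o ζk (D.count (k + 1) o ζk).toNat
    { x := s.x
      y := s.x + betaSucc D.q k • (s.x - o.x)
      yPrev := o.y
      e := s.e
      h := s.h }

/-- `T_k`, for `k ≥ 1`. -/
def T (D : Config n m d S S₁) (ζ : ℕ × ℕ → Noise n m S S₁) (k : ℕ) : ℕ∞ :=
  D.count k (D.outer ζ (k - 1)) fun K => ζ (k, K)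

/-- Convexity and smoothness of the objective: all components are convex, with the three
smoothness constants; `ψ` is `λ`-strongly convex and smooth. -/
structure ObjectiveAssumption (D : Config n m d S S₁) : Prop where
  Lf_nonneg : 0 ≤ D.Lf
  Lbar_nonneg : 0 ≤ D.Lbar
  L_nonneg : 0 ≤ D.L
  Lψ_nonneg : 0 ≤ D.Lψ
  lam_pos : 0 < D.lam
  convex : ∀ τ i, ConvexOn ℝ Set.univ (D.f τ i)
  smooth_global : IsSmooth D.Lf (globalAvg D.f)
  smooth_node : ∀ τ, IsSmooth D.Lbar (nodeAvg D.f τ)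
  smooth_comp : ∀ τ i, IsSmooth D.L (D.f τ i)
  strong : StrongConvexOn Set.univ D.lam D.ψ
  smooth_reg : IsSmooth D.Lψ D.ψ

/-- The scale of the admissible inverse stepsizes. -/
def invStep (D : Config n m d S S₁) : ℝ :=
  D.ellf + D.ell / n + √(1 - D.δ) * D.ellf / D.δ

/-- Error of the very first `h_τ`, relative to `P(x⁰) - P^*`; it is zero when
`h_τ = ∇ f^{(τ)}(x⁰) + ∇ ψ(x⁰)`. -/
def initErr (D : Config n m d S S₁) : ℝ :=
  ((1 / (n : ℝ)) * ∑ τ, ‖D.h₀ τ - (gradient (nodeAvg D.f τ) D.x₀ + gradient D.ψ D.x₀)‖ ^ 2)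
    / (D.P D.x₀ - ⨅ x, D.P x)

/-- The main term of the iteration bound. -/
def rate (D : Config n m d S S₁) : ℝ :=
  1 / D.δ + 1 / D.δ₁ + (D.Lf + D.Lψ) / (D.lam + D.κ) + D.L / (n * (D.lam + D.κ))
    + √(1 - D.δ) * (D.Lf + D.Lψ + D.lam + D.κ) / (D.δ * (D.lam + D.κ))

/-- The logarithmic factor of the iteration bound. -/
def logFactor (D : Config n m d S S₁) : ℝ :=
  Real.log (2 + n * m + 1 / D.δ + 1 / D.δ₁ + D.lam + 1 / D.lam + D.κ + D.Lf + D.Lψ + D.L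
    + 1 / (√D.q - D.ρ₀) + D.initErr)

end Config

end ECCatalyst

end

/-! Error compensation makes the virtual iterate `x - avg e` move as if nothing were compressed: its
step is `η` times an unbiased variance-reduced estimate of `∇G(x)`. Compression enters only through
the distance between `x` and the virtual iterate, so `‖avg e‖²` must be controlled, and this is fed
by `h - ∇F(w)` and by the suboptimality at `x` and `w`.

All of these are collected in one Lyapunov function. Three facts give its sharp constants. Nodes are
independent, so variances are divided by `n` (`integral_norm_avg_sq`). The compressors are unbiased
up to scaling, so `avg e` contracts through its mean and only the variance sees the individual `e τ`
(`integral_avg_error`). The average of the convex node functions is `ellf`-smooth, so each node is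
`n * ellf`-smooth, and the factor `n` is absorbed by the weight `1/n²` (`UpperModel.of_average`).
`FiniteSumProblem.step_le` combines them: in expectation the Lyapunov function shrinks by the factor
`1 - ρ` with `ρ` of order `min (η (λ + κ), δ, δ₁, p)`, and `η/2` times the gap at the current `x` is
gained as well. The feedback of the gap through the compression error has size `(1 - δ) ellf² η³ /
δ²`; it has to stay below `η`, and this is the origin of `√(1 - δ) ellf / δ` in the inverse
stepsize.

The inner run is defined for all times, whether or not the stopping rule has been met, so no stopped
process is needed. `E[T]` is at most the sum over `K` of the probability that the criterion fails at
time `K`. By Markov's inequality and the geometric decay this probability is at most `min (1, N (1 -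
ρ)^K)`, where `N` compares the initial Lyapunov value with the target `eps`; the sum is about `(log
N + 1) / ρ` (`lintegral_T_succ_le`).

It remains to bound `N` by a power of the argument of the logarithm, uniformly in the outer
iteration. This is deterministic once all earlier inner loops have stopped (`lyap_start_le`). The
stopping rule then holds pathwise, so the subproblems were solved to accuracy `eps`, and the
accelerated inexact proximal point method converges linearly: its potential is at most a polynomial
factor times `eps` (`potential_le`). Hence the new gap and the move of the prox-center are of that
size. The old Lyapunov value, bounded by the old `eps`, controls the inherited `e` and `h`
(`lyap_warmStart_le`). A strong induction over outer iterations closes the argument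
(`lintegral_T_le_log`): finite expectations for the earlier loops imply that they stop almost
surely, and this is what the bound on the next start requires. -/

noncomputable section

namespace ECCatalyst

/-! ### First-order inequalities for convex and smooth functions -/

section FirstOrder

variable {E : Type*} [NormedAddCommGroup E] [InnerProductSpace ℝ E]

/-- `f` lies above the quadratic models of curvature `c` with slopes `g`. -/
def LowerModel (c : ℝ) (f : E → ℝ) (g : E → E) : Prop :=
  ∀ x y, f x + inner ℝ (g x) (y - x) + c / 2 * ‖y - x‖ ^ 2 ≤ f y

/-- `f` lies below the quadratic models of curvature `M` with slopes `g`. -/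
def UpperModel (M : ℝ) (f : E → ℝ) (g : E → E) : Prop :=
  ∀ x y, f y ≤ f x + inner ℝ (g x) (y - x) + M / 2 * ‖y - x‖ ^ 2

variable {f f' : E → ℝ} {g g' : E → E} {c c' M M' : ℝ}

theorem LowerModel.add (h : LowerModel c f g) (h' : LowerModel c' f' g') :
    LowerModel (c + c') (fun x => f x + f' x) (fun x => g x + g' x) := by
  intro x y
  have h1 := h x y
  have h2 := h' x y
  rw [inner_add_left]
  linarith

theorem UpperModel.add (h : UpperModel M f g) (h' : UpperModel M' f' g') :
    UpperModel (M + M') (fun x => f x + f' x) (fun x => g x + g' x) := by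
  intro x y
  have h1 := h x y
  have h2 := h' x y
  rw [inner_add_left]
  linarith

theorem LowerModel.mono (h : LowerModel c f g) (hc : c' ≤ c) : LowerModel c' f g := fun x y =>
  le_trans (by gcongr) (h x y)

/-- A quadratic equals its second-order expansion, so the proximal term obeys the lower and the
upper model with the same curvature. -/
theorem half_norm_sub_sq_eq (κ : ℝ) (z x y : E) :
    κ / 2 * ‖y - z‖ ^ 2
      = κ / 2 * ‖x - z‖ ^ 2 + inner ℝ (κ • (x - z)) (y - x) + κ / 2 * ‖y - x‖ ^ 2 := by
  have h : y - z = (x - z) + (y - x) := by abel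
  rw [h, norm_add_sq_real, inner_smul_left]
  simp
  ring

theorem lowerModel_proximal (κ : ℝ) (z : E) :
    LowerModel κ (fun x => κ / 2 * ‖x - z‖ ^ 2) (fun x => κ • (x - z)) := fun x y =>
  (half_norm_sub_sq_eq κ z x y).ge

theorem upperModel_proximal (κ : ℝ) (z : E) :
    UpperModel κ (fun x => κ / 2 * ‖x - z‖ ^ 2) (fun x => κ • (x - z)) := fun x y =>
  (half_norm_sub_sq_eq κ z x y).le

theorem LowerModel.average {m : ℕ} [NeZero m] {f : Fin m → E → ℝ} {g : Fin m → E → E}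
    (h : ∀ i, LowerModel c (f i) (g i)) :
    LowerModel c (fun x => (1 / (m : ℝ)) * ∑ i, f i x) (fun x => (1 / (m : ℝ)) • ∑ i, g i x) := by
  intro x y
  have hm : (0 : ℝ) < m := by exact_mod_cast Nat.pos_of_ne_zero (NeZero.ne m)
  have h1 := Finset.sum_le_sum fun i (_ : i ∈ Finset.univ) => h i x y
  simp only [Finset.sum_add_distrib, Finset.sum_const, Finset.card_univ, Fintype.card_fin,
    nsmul_eq_mul] at h1
  have h2 := mul_le_mul_of_nonneg_left h1 (one_div_nonneg.2 hm.le)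
  rw [real_inner_smul_left, sum_inner]
  have h3 : 1 / (m : ℝ) * (m * (c / 2 * ‖y - x‖ ^ 2)) = c / 2 * ‖y - x‖ ^ 2 := by field_simp
  rw [mul_add, mul_add, h3] at h2
  exact h2

/-- Cocoercivity of the gradient of a convex smooth function. -/
theorem LowerModel.norm_sub_sq_le (h : LowerModel 0 f g) (h' : UpperModel M f g) (hM : 0 < M)
    (x z : E) :
    ‖g x - g z‖ ^ 2 ≤ 2 * M * (f x - f z - inner ℝ (g z) (x - z)) := by
  set v := g x - g z with hv
  -- The test point is a gradient step from `x` for `f` minus its linearization at `z`. The lower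
  -- model based at `z` and the upper model based at `x` are compared there.
  set u := x - M⁻¹ • v with hu
  have h1 := h z u
  have h2 := h' x u
  have e1 : u - x = -(M⁻¹ • v) := by rw [hu]; abel
  have e2 : u - z = (x - z) + -(M⁻¹ • v) := by rw [hu]; abel
  rw [e2, inner_add_right] at h1
  rw [e1] at h2
  have e3 : inner ℝ (g x) (-(M⁻¹ • v)) - inner ℝ (g z) (-(M⁻¹ • v)) = - (M⁻¹ * ‖v‖ ^ 2) := by
    rw [← inner_sub_left, ← hv, inner_neg_right, real_inner_smul_right, real_inner_self_eq_norm_sq]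
  have e4 : ‖-(M⁻¹ • v)‖ ^ 2 = (M⁻¹) ^ 2 * ‖v‖ ^ 2 := by
    rw [norm_neg, norm_smul, mul_pow, Real.norm_eq_abs, sq_abs]
  rw [e4] at h2
  have h3 : M⁻¹ / 2 * ‖v‖ ^ 2 ≤ f x - f z - inner ℝ (g z) (x - z) := by
    have : M / 2 * ((M⁻¹) ^ 2 * ‖v‖ ^ 2) = M⁻¹ / 2 * ‖v‖ ^ 2 := by field_simp
    linarith
  calc ‖v‖ ^ 2 = 2 * M * (M⁻¹ / 2 * ‖v‖ ^ 2) := by field_simp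
    _ ≤ _ := by gcongr

/-- If the average of convex functions lies below its quadratic models of curvature `M`, then each
of the `n` functions lies below its quadratic models of curvature `n M`. -/
theorem UpperModel.of_average {n : ℕ} [NeZero n] {f : Fin n → E → ℝ} {g : Fin n → E → E}
    (h : ∀ i, LowerModel 0 (f i) (g i))
    (h' : UpperModel M (fun x => (1 / (n : ℝ)) * ∑ i, f i x)
      (fun x => (1 / (n : ℝ)) • ∑ i, g i x)) (i : Fin n) :
    UpperModel (n * M) (f i) (g i) := by
  intro x y
  have hn : (0 : ℝ) < n := by exact_mod_cast Nat.pos_of_ne_zero (NeZero.ne n)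
  have h1 := h' x y
  rw [real_inner_smul_left, sum_inner] at h1
  have h2 : ∑ j, (f j y - f j x - inner ℝ (g j x) (y - x)) ≤ n * (M / 2 * ‖y - x‖ ^ 2) := by
    rw [Finset.sum_sub_distrib, Finset.sum_sub_distrib]
    have h3 := mul_le_mul_of_nonneg_left h1 hn.le
    have h4 : ∀ a : ℝ, (n : ℝ) * (1 / n * a) = a := fun a => by field_simp
    rw [mul_add, mul_add, h4, h4, h4] at h3
    linarith
  -- By convexity all Bregman distances are nonnegative, so a single one is at most their sum; the
  -- price is the factor `n`.
  have h5 : f i y - f i x - inner ℝ (g i x) (y - x)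
      ≤ ∑ j, (f j y - f j x - inner ℝ (g j x) (y - x)) :=
    Finset.single_le_sum (f := fun j => f j y - f j x - inner ℝ (g j x) (y - x))
      (fun j _ => by have := h j x y; simp at this; linarith) (Finset.mem_univ i)
  linarith

theorem LowerModel.norm_sub_sq_le_of_eq_zero (h : LowerModel c f g) {x₀ : E} (h0 : g x₀ = 0)
    (x : E) : c / 2 * ‖x - x₀‖ ^ 2 ≤ f x - f x₀ := by
  have := h x₀ x
  rw [h0, inner_zero_left] at this
  linarith

theorem LowerModel.exists_forall_le [FiniteDimensional ℝ E] (h : LowerModel c f g) (hc : 0 < c)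
    (hf : Continuous f) : ∃ x, ∀ y, f x ≤ f y := by
  refine hf.exists_forall_le ?_
  have h1 : ∀ y, f 0 + (c / 2 * ‖y‖ - ‖g 0‖) * ‖y‖ ≤ f y := by
    intro y
    have := h 0 y
    have h2 := neg_le_of_abs_le (abs_real_inner_le_norm (g 0) y)
    simp only [sub_zero] at this
    nlinarith
  refine Filter.tendsto_atTop_mono h1 ?_
  have ht : Filter.Tendsto (fun y : E => ‖y‖) (Filter.cocompact E) Filter.atTop :=
    tendsto_norm_cocompact_atTop
  refine Filter.tendsto_atTop_add_const_left _ _ (Filter.Tendsto.atTop_mul_atTop₀ ?_ ht)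
  exact Filter.tendsto_atTop_add_const_right _ _ (ht.const_mul_atTop (by positivity))

/-- A gradient step of length `1 / M` would lower `f` by at least `‖g x‖² / (2 M)`. -/
theorem UpperModel.eq_zero_of_forall_le (h : UpperModel M f g) (hM : 0 < M) {x : E}
    (hx : ∀ y, f x ≤ f y) : g x = 0 := by
  have h1 := (hx (x - M⁻¹ • g x)).trans (h x (x - M⁻¹ • g x))
  rw [sub_sub_cancel_left, inner_neg_right, real_inner_smul_right, real_inner_self_eq_norm_sq,
    norm_neg, norm_smul, mul_pow, Real.norm_eq_abs, sq_abs] at h1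
  have h2 : M / 2 * (M⁻¹ ^ 2 * ‖g x‖ ^ 2) = M⁻¹ / 2 * ‖g x‖ ^ 2 := by field_simp
  have h3 : 0 < M⁻¹ := inv_pos.2 hM
  have h4 : ‖g x‖ ^ 2 ≤ 0 := by nlinarith
  simpa using le_antisymm h4 (sq_nonneg _)

variable [CompleteSpace E]

theorem hasDerivAt_comp_line {x v : E} {t : ℝ} {γ : E} (h : HasGradientAt f γ (x + t • v)) :
    HasDerivAt (fun s : ℝ => f (x + s • v)) (inner ℝ γ v) t := by
  have h1 : HasDerivAt (fun s : ℝ => x + s • v) v t := by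
    simpa using ((hasDerivAt_id t).smul_const v).const_add x
  have h2 := h.hasFDerivAt.comp_hasDerivAt t h1
  rw [InnerProductSpace.toDual_apply_apply] at h2
  exact h2

/-- On the segment from `x` to `y` this is the one-dimensional fact that the slope of a convex
function over `[0, 1]` is at least its derivative at `0`. -/
theorem lowerModel_of_convexOn (hf : ConvexOn ℝ Set.univ f) (hg : ∀ x, HasGradientAt f (g x) x) :
    LowerModel 0 f g := by
  intro x y
  have hd : HasDerivAt (fun s : ℝ => f (x + s • (y - x))) (inner ℝ (g x) (y - x)) 0 :=
    hasDerivAt_comp_line (by simpa using hg x)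
  have hc : ConvexOn ℝ Set.univ (fun s : ℝ => f (x + s • (y - x))) := by
    have := hf.comp_affineMap (AffineMap.lineMap (k := ℝ) x y)
    have he : f ∘ ⇑(AffineMap.lineMap (k := ℝ) x y) = fun s : ℝ => f (x + s • (y - x)) := by
      funext s
      simp [AffineMap.lineMap_apply, add_comm]
    rwa [Set.preimage_univ, he] at this
  have h := hc.le_slope_of_hasDerivAt (Set.mem_univ 0) (Set.mem_univ 1) zero_lt_one hd
  simp [slope] at h
  simp
  linarith

/-- Subtracting `c / 2 * ‖x‖ ^ 2` leaves a convex function; its tangent inequality plus the exact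
expansion of the quadratic gives the claim. -/
theorem lowerModel_of_strongConvexOn (hf : StrongConvexOn Set.univ c f)
    (hg : ∀ x, HasGradientAt f (g x) x) : LowerModel c f g := by
  rw [strongConvexOn_iff_convex] at hf
  have hq : ∀ x : E, HasGradientAt (fun x : E => c / 2 * ‖x‖ ^ 2) (c • x) x := by
    intro x
    rw [hasGradientAt_iff_hasFDerivAt]
    have := ((hasStrictFDerivAt_norm_sq x).hasFDerivAt).const_mul (c / 2)
    refine this.congr_fderiv ?_
    ext v
    simp
    ring
  have h1 := lowerModel_of_convexOn (g := fun x => g x - c • x) hf fun x => by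
    have := (hg x).hasFDerivAt.sub (hq x).hasFDerivAt
    rw [hasGradientAt_iff_hasFDerivAt, map_sub]
    exact this
  have h2 := h1.add (lowerModel_proximal c (0 : E))
  simpa using h2

/-- Along the segment, `f` minus its quadratic model has a nonpositive derivative, by Cauchy-Schwarz
and the Lipschitz bound, so it does not increase from `0` to `1`. No integration of the gradient is
needed. -/
theorem IsSmooth.upperModel {d : ℕ} {L : ℝ} {f : Vec d → ℝ} (hf : IsSmooth L f) :
    UpperModel L f (gradient f) := by
  intro x y
  set v := y - x with hv
  let φ : ℝ → ℝ := fun t =>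
    f (x + t • v) - t * inner ℝ (gradient f x) v - L / 2 * t ^ 2 * ‖v‖ ^ 2
  have hd : ∀ t, HasDerivAt φ
      (inner ℝ (gradient f (x + t • v)) v - inner ℝ (gradient f x) v - L * t * ‖v‖ ^ 2) t := by
    intro t
    have h1 := hasDerivAt_comp_line (f := f) (x := x) (v := v) (t := t) (hf.1 _).hasGradientAt
    have h2 := (h1.sub ((hasDerivAt_id t).mul_const (inner ℝ (gradient f x) v))).sub
      ((((hasDerivAt_id t).pow 2).const_mul (L / 2)).mul_const (‖v‖ ^ 2))
    refine h2.congr_deriv ?_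
    simp only [id, Nat.cast_ofNat, Nat.add_one_sub_one, pow_one]
    ring
  have hanti : AntitoneOn φ (Set.Icc 0 1) := by
    refine antitoneOn_of_deriv_nonpos (convex_Icc 0 1)
      (fun t _ => (hd t).continuousAt.continuousWithinAt)
      (fun t _ => (hd t).differentiableAt.differentiableWithinAt) fun t ht => ?_
    rw [interior_Icc] at ht
    rw [(hd t).deriv, ← inner_sub_left]
    have h1 := real_inner_le_norm (gradient f (x + t • v) - gradient f x) v
    have h2 := hf.2 (x + t • v) x
    rw [add_sub_cancel_left, norm_smul, Real.norm_of_nonneg ht.1.le] at h2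
    have h3 := mul_le_mul_of_nonneg_right h2 (norm_nonneg v)
    nlinarith
  have h := hanti (Set.left_mem_Icc.2 zero_le_one) (Set.right_mem_Icc.2 zero_le_one) zero_le_one
  simp only [φ] at h
  simp only [one_smul, zero_smul, add_zero, hv, add_sub_cancel] at h
  linarith

end FirstOrder

theorem argmin_spec {d : ℕ} {F : Vec d → ℝ} (h : ∃ x, ∀ y, F x ≤ F y) (y : Vec d) :
    F (argmin F) ≤ F y := Classical.epsilon_spec h y

theorem iInf_eq_argmin {d : ℕ} {F : Vec d → ℝ} (h : ∃ x, ∀ y, F x ≤ F y) :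
    ⨅ x, F x = F (argmin F) :=
  le_antisymm (ciInf_le ⟨F (argmin F), by rintro _ ⟨y, rfl⟩; exact argmin_spec h y⟩ _)
    (le_ciInf fun y => argmin_spec h y)

/-! ### Gradients of sums and averages -/

section Gradient

variable {E : Type*} [NormedAddCommGroup E] [InnerProductSpace ℝ E] [CompleteSpace E]

theorem hasGradientAt_add {f f' : E → ℝ} {g g' x : E} (h : HasGradientAt f g x)
    (h' : HasGradientAt f' g' x) : HasGradientAt (fun x => f x + f' x) (g + g') x := by
  rw [hasGradientAt_iff_hasFDerivAt, map_add]
  exact h.hasFDerivAt.add h'.hasFDerivAt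

theorem hasGradientAt_average {m : ℕ} {f : Fin m → E → ℝ} {g : Fin m → E} {x : E}
    (h : ∀ i, HasGradientAt (f i) (g i) x) :
    HasGradientAt (fun x => (1 / (m : ℝ)) * ∑ i, f i x) ((1 / (m : ℝ)) • ∑ i, g i) x := by
  have h1 := (HasFDerivAt.fun_sum (u := Finset.univ) fun i _ => (h i).hasFDerivAt).const_mul
    (1 / (m : ℝ))
  rw [hasGradientAt_iff_hasFDerivAt]
  refine h1.congr_fderiv ?_
  simp

theorem hasGradientAt_proximal (κ : ℝ) (z x : E) :
    HasGradientAt (fun x => κ / 2 * ‖x - z‖ ^ 2) (κ • (x - z)) x := by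
  rw [hasGradientAt_iff_hasFDerivAt]
  have h1 := ((hasStrictFDerivAt_norm_sq (x - z)).hasFDerivAt.comp x
    ((hasFDerivAt_id x).sub_const z)).const_mul (κ / 2)
  refine h1.congr_fderiv ?_
  ext v
  simp
  ring

end Gradient

theorem norm_avg_sq_le {n d : ℕ} (v : Fin n → Vec d) :
    ‖avg v‖ ^ 2 ≤ (1 / (n : ℝ)) * ∑ τ, ‖v τ‖ ^ 2 := by
  rcases Nat.eq_zero_or_pos n with rfl | hn
  · simp [avg]
  have hn' : (0 : ℝ) < n := by exact_mod_cast hn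
  have h1 : ‖avg v‖ ≤ (1 / (n : ℝ)) * ∑ τ, ‖v τ‖ := by
    rw [avg, norm_smul, Real.norm_of_nonneg (by positivity)]
    gcongr
    exact norm_sum_le _ _
  have h2 := sq_sum_le_card_mul_sum_sq (s := Finset.univ) (f := fun τ => ‖v τ‖)
  simp only [Finset.card_univ, Fintype.card_fin] at h2
  calc ‖avg v‖ ^ 2 ≤ ((1 / (n : ℝ)) * ∑ τ, ‖v τ‖) ^ 2 := by gcongr
    _ = (1 / (n : ℝ)) ^ 2 * (∑ τ, ‖v τ‖) ^ 2 := by ring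
    _ ≤ (1 / (n : ℝ)) ^ 2 * (n * ∑ τ, ‖v τ‖ ^ 2) := by gcongr
    _ = _ := by field_simp

theorem avg_add {n d : ℕ} (v w : Fin n → Vec d) : avg (fun τ => v τ + w τ) = avg v + avg w := by
  simp [avg, Finset.sum_add_distrib]

theorem avg_sub {n d : ℕ} (v w : Fin n → Vec d) : avg (fun τ => v τ - w τ) = avg v - avg w := by
  simp [avg, Finset.sum_sub_distrib, smul_sub]

theorem avg_smul {n d : ℕ} (c : ℝ) (v : Fin n → Vec d) : avg (fun τ => c • v τ) = c • avg v := by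
  simp [avg, ← Finset.smul_sum, smul_comm c]

theorem avg_const {n d : ℕ} [NeZero n] (v : Vec d) : avg (fun _ : Fin n => v) = v := by
  have hn : (n : ℝ) ≠ 0 := by exact_mod_cast NeZero.ne n
  simp [avg, ← Nat.cast_smul_eq_nsmul ℝ, smul_smul, hn]

/-! ### The subproblems of Catalyst -/

/-- The properties of the finite sum `G = avg F` that the analysis of EC-LSVRG uses: the gradients
average, `xs` is the minimizer, and the gradients are cocoercive at `xs`. -/
structure FiniteSumProblem {n m d : ℕ} (F : Fin n → Fin m → Vec d → ℝ) (G : Vec d → ℝ)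
    (xs : Vec d) (c M L : ℝ) : Prop where
  grad_node : ∀ τ x, gradient (nodeAvg F τ) x = (1 / (m : ℝ)) • ∑ i, gradient (F τ i) x
  grad_sum : ∀ x, gradient G x = avg fun τ => gradient (nodeAvg F τ) x
  comp_le : ∀ x, (1 / (n : ℝ)) * ∑ τ, (1 / (m : ℝ)) * ∑ i,
    ‖gradient (F τ i) x - gradient (F τ i) xs‖ ^ 2 ≤ 2 * L * (G x - G xs)
  node_le : ∀ x, (1 / (n : ℝ) ^ 2) * ∑ τ, ‖gradient (nodeAvg F τ) x - gradient (nodeAvg F τ) xs‖ ^ 2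
    ≤ 2 * M * (G x - G xs)
  grad_le : ∀ x, ‖gradient G x‖ ^ 2 ≤ 2 * M * (G x - G xs)
  strong : ∀ x, (G x - G xs) + c / 2 * ‖x - xs‖ ^ 2 ≤ inner ℝ (gradient G x) (x - xs)
  growth : ∀ x, c / 2 * ‖x - xs‖ ^ 2 ≤ G x - G xs

namespace Config

variable {n m d : ℕ} {S S₁ : Type*} {D : Config n m d S S₁}

theorem hasGradientAt_comp (hD : D.ObjectiveAssumption) (y : Vec d) (τ : Fin n) (i : Fin m)
    (x : Vec d) : HasGradientAt (D.comp y τ i)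
      (gradient (D.f τ i) x + gradient D.ψ x + D.κ • (x - y)) x :=
  hasGradientAt_add (hasGradientAt_add ((hD.smooth_comp τ i).1 x).hasGradientAt
    (hD.smooth_reg.1 x).hasGradientAt) (hasGradientAt_proximal _ _ _)

theorem gradient_comp (hD : D.ObjectiveAssumption) (y : Vec d) (τ : Fin n) (i : Fin m)
    (x : Vec d) : gradient (D.comp y τ i) x
      = gradient (D.f τ i) x + gradient D.ψ x + D.κ • (x - y) :=
  (hasGradientAt_comp hD y τ i x).gradient

theorem hasGradientAt_nodeAvg_comp (hD : D.ObjectiveAssumption) (y : Vec d) (τ : Fin n)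
    (x : Vec d) : HasGradientAt (nodeAvg (D.comp y) τ)
      ((1 / (m : ℝ)) • ∑ i, gradient (D.comp y τ i) x) x :=
  hasGradientAt_average fun i => by
    rw [gradient_comp hD]
    exact hasGradientAt_comp hD y τ i x

theorem gradient_nodeAvg_comp (hD : D.ObjectiveAssumption) (y : Vec d) (τ : Fin n) (x : Vec d) :
    gradient (nodeAvg (D.comp y) τ) x = (1 / (m : ℝ)) • ∑ i, gradient (D.comp y τ i) x :=
  (hasGradientAt_nodeAvg_comp hD y τ x).gradient

theorem gradient_nodeAvg (hD : D.ObjectiveAssumption) (τ : Fin n) (x : Vec d) :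
    gradient (nodeAvg D.f τ) x = (1 / (m : ℝ)) • ∑ i, gradient (D.f τ i) x :=
  (hasGradientAt_average fun i => ((hD.smooth_comp τ i).1 x).hasGradientAt).gradient

theorem nodeAvg_comp_eq [NeZero m] (y : Vec d) (τ : Fin n) (x : Vec d) :
    nodeAvg (D.comp y) τ x = nodeAvg D.f τ x + D.ψ x + D.κ / 2 * ‖x - y‖ ^ 2 := by
  have hm : (m : ℝ) ≠ 0 := by exact_mod_cast NeZero.ne m
  simp only [nodeAvg, comp, Finset.sum_add_distrib, Finset.sum_const, Finset.card_univ,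
    Fintype.card_fin, nsmul_eq_mul]
  field_simp

theorem gradient_nodeAvg_comp_eq [NeZero m] (hD : D.ObjectiveAssumption) (y : Vec d) (τ : Fin n)
    (x : Vec d) : gradient (nodeAvg (D.comp y) τ) x
      = gradient (nodeAvg D.f τ) x + gradient D.ψ x + D.κ • (x - y) := by
  have h : nodeAvg (D.comp y) τ = fun x => nodeAvg D.f τ x + D.ψ x + D.κ / 2 * ‖x - y‖ ^ 2 :=
    funext (nodeAvg_comp_eq y τ)
  rw [h]
  exact (hasGradientAt_add (hasGradientAt_add ((hD.smooth_node τ).1 x).hasGradientAt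
    (hD.smooth_reg.1 x).hasGradientAt) (hasGradientAt_proximal _ _ _)).gradient

theorem G_eq_average [NeZero n] [NeZero m] (y : Vec d) :
    D.G y = fun x => (1 / (n : ℝ)) * ∑ τ, nodeAvg (D.comp y) τ x := by
  have hn : (n : ℝ) ≠ 0 := by exact_mod_cast NeZero.ne n
  funext x
  simp only [nodeAvg_comp_eq, G, P, globalAvg, Finset.sum_add_distrib, Finset.sum_const,
    Finset.card_univ, Fintype.card_fin, nsmul_eq_mul]
  field_simp

theorem gradient_G [NeZero n] [NeZero m] (hD : D.ObjectiveAssumption) (y x : Vec d) :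
    gradient (D.G y) x = avg fun τ => gradient (nodeAvg (D.comp y) τ) x := by
  rw [G_eq_average]
  exact (hasGradientAt_average fun τ =>
    (hasGradientAt_nodeAvg_comp hD y τ x).differentiableAt.hasGradientAt).gradient

theorem hasGradientAt_P (hD : D.ObjectiveAssumption) (x : Vec d) :
    HasGradientAt D.P (gradient (globalAvg D.f) x + gradient D.ψ x) x :=
  hasGradientAt_add (hD.smooth_global.1 x).hasGradientAt (hD.smooth_reg.1 x).hasGradientAt

theorem gradient_G_eq (hD : D.ObjectiveAssumption) (y x : Vec d) :
    gradient (D.G y) x = gradient (globalAvg D.f) x + gradient D.ψ x + D.κ • (x - y) :=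
  (hasGradientAt_add (hasGradientAt_P hD x) (hasGradientAt_proximal D.κ y x)).gradient

theorem lowerModel_reg (hD : D.ObjectiveAssumption) : LowerModel D.lam D.ψ (gradient D.ψ) :=
  lowerModel_of_strongConvexOn hD.strong fun x => (hD.smooth_reg.1 x).hasGradientAt

theorem lowerModel_comp (hD : D.ObjectiveAssumption) (y : Vec d) (τ : Fin n) (i : Fin m) :
    LowerModel (D.lam + D.κ) (D.comp y τ i) (gradient (D.comp y τ i)) := by
  have h := ((lowerModel_of_convexOn (hD.convex τ i)
    fun x => ((hD.smooth_comp τ i).1 x).hasGradientAt).add (lowerModel_reg hD)).add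
      (lowerModel_proximal D.κ y)
  rw [zero_add] at h
  rw [show gradient (D.comp y τ i) = _ from funext (gradient_comp hD y τ i)]
  exact h

theorem upperModel_comp (hD : D.ObjectiveAssumption) (y : Vec d) (τ : Fin n) (i : Fin m) :
    UpperModel D.ell (D.comp y τ i) (gradient (D.comp y τ i)) := by
  rw [show gradient (D.comp y τ i) = _ from funext (gradient_comp hD y τ i)]
  exact ((hD.smooth_comp τ i).upperModel.add hD.smooth_reg.upperModel).add
    (upperModel_proximal D.κ y)

theorem lowerModel_nodeAvg_comp [NeZero m] (hD : D.ObjectiveAssumption) (y : Vec d) (τ : Fin n) :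
    LowerModel (D.lam + D.κ) (nodeAvg (D.comp y) τ) (gradient (nodeAvg (D.comp y) τ)) := by
  rw [show gradient (nodeAvg (D.comp y) τ) = _ from funext (gradient_nodeAvg_comp hD y τ)]
  exact LowerModel.average fun i => lowerModel_comp hD y τ i

theorem upperModel_G (hD : D.ObjectiveAssumption) (y : Vec d) :
    UpperModel D.ellf (D.G y) (gradient (D.G y)) := by
  rw [show gradient (D.G y) = _ from funext (gradient_G_eq hD y)]
  exact (hD.smooth_global.upperModel.add hD.smooth_reg.upperModel).add (upperModel_proximal D.κ y)

theorem lowerModel_P [NeZero n] [NeZero m] (hD : D.ObjectiveAssumption) :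
    LowerModel D.lam D.P (gradient D.P) := by
  have h1 : LowerModel 0 (globalAvg D.f) (gradient (globalAvg D.f)) := by
    have h2 : LowerModel 0 (globalAvg D.f) (fun x => (1 / (n : ℝ)) • ∑ τ,
        (1 / (m : ℝ)) • ∑ i, gradient (D.f τ i) x) :=
      LowerModel.average fun τ => LowerModel.average fun i =>
        lowerModel_of_convexOn (hD.convex τ i) fun x => ((hD.smooth_comp τ i).1 x).hasGradientAt
    have h3 : gradient (globalAvg D.f) = fun x => (1 / (n : ℝ)) • ∑ τ,
        (1 / (m : ℝ)) • ∑ i, gradient (D.f τ i) x := by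
      funext x
      exact (hasGradientAt_average fun τ => hasGradientAt_average fun i =>
        ((hD.smooth_comp τ i).1 x).hasGradientAt).gradient
    rwa [h3]
  have h4 := h1.add (lowerModel_reg hD)
  rw [zero_add] at h4
  rw [show gradient D.P = _ from funext fun x => (hasGradientAt_P hD x).gradient]
  exact h4

theorem lowerModel_G [NeZero n] [NeZero m] (hD : D.ObjectiveAssumption) (y : Vec d) :
    LowerModel (D.lam + D.κ) (D.G y) (gradient (D.G y)) := by
  have h := (lowerModel_P hD).add (lowerModel_proximal D.κ y)
  rw [show gradient (D.G y) = _ from funext (gradient_G_eq hD y)]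
  rwa [show gradient D.P = _ from funext fun x => (hasGradientAt_P hD x).gradient] at h

theorem continuous_P (hD : D.ObjectiveAssumption) : Continuous D.P :=
  continuous_iff_continuousAt.2 fun x => (hasGradientAt_P hD x).continuousAt

theorem continuous_uncurry_G (hD : D.ObjectiveAssumption) :
    Continuous fun z : Vec d × Vec d => D.G z.1 z.2 := by
  have := continuous_P hD
  unfold G
  fun_prop

theorem exists_forall_P_le [NeZero n] [NeZero m] (hD : D.ObjectiveAssumption) :
    ∃ x, ∀ z, D.P x ≤ D.P z :=
  (lowerModel_P hD).exists_forall_le hD.lam_pos (continuous_P hD)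

theorem exists_forall_G_le [NeZero n] [NeZero m] (hD : D.ObjectiveAssumption) (hκ : 0 ≤ D.κ)
    (y : Vec d) : ∃ x, ∀ z, D.G y x ≤ D.G y z :=
  (lowerModel_G hD y).exists_forall_le (by linarith [hD.lam_pos])
    ((continuous_uncurry_G hD).comp (Continuous.prodMk_right y))

theorem iInf_G [NeZero n] [NeZero m] (hD : D.ObjectiveAssumption) (hκ : 0 ≤ D.κ) (y : Vec d) :
    ⨅ x, D.G y x = D.G y (argmin (D.G y)) :=
  iInf_eq_argmin (exists_forall_G_le hD hκ y)

theorem iInf_P [NeZero n] [NeZero m] (hD : D.ObjectiveAssumption) :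
    ⨅ x, D.P x = D.P (argmin D.P) :=
  iInf_eq_argmin (exists_forall_P_le hD)

theorem nontrivial_of_iInf_lt [NeZero n] [NeZero m] (hD : D.ObjectiveAssumption)
    (hP : (⨅ x, D.P x) < D.P D.x₀) : D.x₀ ≠ argmin D.P := by
  rw [iInf_P hD] at hP
  intro h
  rw [← h] at hP
  exact lt_irrefl _ hP

/-- At two distinct points the lower model of curvature `lam` lies below the upper model of
curvature `Lψ`. The assumption that `x₀` is not optimal provides such points, and it follows that
`ellf` and `ell` are at least `lam + κ`, in particular positive. -/
theorem lam_le_of_ne (hD : D.ObjectiveAssumption) {x y : Vec d} (h : x ≠ y) : D.lam ≤ D.Lψ := by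
  have h1 := lowerModel_reg hD y x
  have h2 := hD.smooth_reg.upperModel y x
  have h3 : 0 < ‖x - y‖ ^ 2 := by
    have := norm_pos_iff.2 (sub_ne_zero.2 h)
    positivity
  by_contra! h4
  nlinarith

theorem grad_nodeAvg_comp_lipschitz [NeZero m] (hD : D.ObjectiveAssumption) (hκ : 0 ≤ D.κ)
    (y : Vec d) (τ : Fin n) (x x' : Vec d) :
    ‖gradient (nodeAvg (D.comp y) τ) x - gradient (nodeAvg (D.comp y) τ) x'‖
      ≤ D.ell * ‖x - x'‖ := by
  have hm : (0 : ℝ) < m := by exact_mod_cast Nat.pos_of_ne_zero (NeZero.ne m)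
  rw [gradient_nodeAvg_comp_eq hD, gradient_nodeAvg_comp_eq hD, gradient_nodeAvg hD,
    gradient_nodeAvg hD]
  have h1 : ‖(1 / (m : ℝ)) • ∑ i, gradient (D.f τ i) x
      - (1 / (m : ℝ)) • ∑ i, gradient (D.f τ i) x'‖ ≤ D.L * ‖x - x'‖ := by
    rw [← smul_sub, ← Finset.sum_sub_distrib, norm_smul, Real.norm_of_nonneg (by positivity)]
    calc 1 / (m : ℝ) * ‖∑ i, (gradient (D.f τ i) x - gradient (D.f τ i) x')‖
        ≤ 1 / (m : ℝ) * ∑ i : Fin m, D.L * ‖x - x'‖ := by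
          gcongr
          exact norm_sum_le_of_le _ fun i _ => (hD.smooth_comp τ i).2 x x'
      _ = D.L * ‖x - x'‖ := by simp; field_simp
  have h2 := hD.smooth_reg.2 x x'
  have h3 : ‖D.κ • (x - y) - D.κ • (x' - y)‖ = D.κ * ‖x - x'‖ := by
    rw [← smul_sub, sub_sub_sub_cancel_right, norm_smul, Real.norm_of_nonneg hκ]
  rw [add_sub_add_comm, add_sub_add_comm]
  refine (norm_add₃_le).trans ?_
  rw [h3, ell]
  linarith

/-- The node gradients at the minimizer average to zero, so the average of the Bregman distances of
the nodes from the minimizer is exactly the gap of `G` (`hbreg`). Cocoercivity of each component, of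
each node and of `G` then bounds squared gradient differences by this one quantity. -/
theorem finiteSumProblem [NeZero n] [NeZero m] (hD : D.ObjectiveAssumption) (hκ : 0 ≤ D.κ)
    (hf : 0 < D.ellf) (hl : 0 < D.ell) (y : Vec d) :
    FiniteSumProblem (D.comp y) (D.G y) (argmin (D.G y)) (D.lam + D.κ) D.ellf D.ell := by
  have hn : (0 : ℝ) < n := by exact_mod_cast Nat.pos_of_ne_zero (NeZero.ne n)
  have hm : (0 : ℝ) < m := by exact_mod_cast Nat.pos_of_ne_zero (NeZero.ne m)
  have hμ : 0 ≤ D.lam + D.κ := by linarith [hD.lam_pos]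
  set xs := argmin (D.G y) with hxs
  have hmin : ∀ z, D.G y xs ≤ D.G y z := argmin_spec (exists_forall_G_le hD hκ y)
  have h0 : gradient (D.G y) xs = 0 := (upperModel_G hD y).eq_zero_of_forall_le hf hmin
  have hG : ∀ x, D.G y x = (1 / (n : ℝ)) * ∑ τ, nodeAvg (D.comp y) τ x :=
    fun x => congrFun (G_eq_average y) x
  have hbreg : ∀ x, (1 / (n : ℝ)) * ∑ τ, (nodeAvg (D.comp y) τ x - nodeAvg (D.comp y) τ xs
      - Inner.inner ℝ (gradient (nodeAvg (D.comp y) τ) xs) (x - xs)) = D.G y x - D.G y xs := by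
    intro x
    have h1 : (1 / (n : ℝ)) * ∑ τ, Inner.inner ℝ (gradient (nodeAvg (D.comp y) τ) xs) (x - xs) = 0 := by
      rw [← sum_inner, ← real_inner_smul_left]
      have := gradient_G hD y xs
      rw [h0, avg] at this
      rw [← this, inner_zero_left]
    rw [Finset.sum_sub_distrib, Finset.sum_sub_distrib, mul_sub, mul_sub, h1, hG, hG]
    ring
  refine ⟨gradient_nodeAvg_comp hD y, gradient_G hD y, fun x => ?_, fun x => ?_, fun x => ?_,
    fun x => ?_, fun x => (lowerModel_G hD y).norm_sub_sq_le_of_eq_zero h0 x⟩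
  · rw [← hbreg, mul_left_comm]
    refine mul_le_mul_of_nonneg_left ?_ (by positivity)
    rw [Finset.mul_sum]
    refine Finset.sum_le_sum fun τ _ => ?_
    calc (1 / (m : ℝ)) * ∑ i, ‖gradient (D.comp y τ i) x - gradient (D.comp y τ i) xs‖ ^ 2
        ≤ (1 / (m : ℝ)) * ∑ i, 2 * D.ell * (D.comp y τ i x - D.comp y τ i xs
            - Inner.inner ℝ (gradient (D.comp y τ i) xs) (x - xs)) := by
          gcongr with i
          exact ((lowerModel_comp hD y τ i).mono hμ).norm_sub_sq_le (upperModel_comp hD y τ i) hl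
            x xs
      _ = _ := by
          rw [← Finset.mul_sum, Finset.sum_sub_distrib, Finset.sum_sub_distrib,
            gradient_nodeAvg_comp hD, real_inner_smul_left, sum_inner, nodeAvg, nodeAvg]
          ring
  -- Each node has smoothness `n * ellf`, because the average has `ellf`. The weight `1 / n ^ 2`
  -- absorbs the factor `n`, so the bound involves `ellf` and not the smoothness of single nodes.
  · have hup : UpperModel D.ellf (fun x => (1 / (n : ℝ)) * ∑ τ, nodeAvg (D.comp y) τ x)
        (fun x => (1 / (n : ℝ)) • ∑ τ, gradient (nodeAvg (D.comp y) τ) x) := by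
      have h := upperModel_G hD y
      rw [show gradient (D.G y) = _ from funext (gradient_G hD y)] at h
      rwa [G_eq_average y] at h
    have hlow : ∀ τ, LowerModel 0 (nodeAvg (D.comp y) τ) (gradient (nodeAvg (D.comp y) τ)) :=
      fun τ => (lowerModel_nodeAvg_comp hD y τ).mono hμ
    have h1 := Finset.sum_le_sum fun τ (_ : τ ∈ Finset.univ) =>
      (hlow τ).norm_sub_sq_le (UpperModel.of_average hlow hup τ) (by positivity) x xs
    rw [← Finset.mul_sum] at h1
    rw [← hbreg]
    refine (mul_le_mul_of_nonneg_left h1 (by positivity)).trans_eq ?_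
    field_simp
  · have := ((lowerModel_G hD y).mono hμ).norm_sub_sq_le (upperModel_G hD y) hf x xs
    rwa [h0, sub_zero, inner_zero_left, sub_zero] at this
  · have := lowerModel_G hD y x xs
    rw [← neg_sub x xs, inner_neg_right, norm_neg] at this
    linarith

end Config

/-! ### Second moments -/

section SecondMoment

variable {d n m : ℕ} {α : Type*} [MeasurableSpace α] {ρ : Measure α}

theorem memLp_coord {Y : α → Vec d} (hY : MemLp Y 2 ρ) (j : Fin d) :
    MemLp (fun a => Y a j) 2 ρ :=
  hY.norm.of_le ((continuous_apply j).comp_aestronglyMeasurable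
    ((PiLp.continuous_ofLp 2 _).comp_aestronglyMeasurable hY.aestronglyMeasurable))
    (Filter.Eventually.of_forall fun a => by
      rw [norm_norm]
      exact PiLp.norm_apply_le (Y a) j)

theorem integral_coord {Y : α → Vec d} (hY : Integrable Y ρ) (j : Fin d) :
    (∫ a, Y a ∂ρ) j = ∫ a, Y a j ∂ρ :=
  ((EuclideanSpace.proj (𝕜 := ℝ) j : Vec d →L[ℝ] ℝ).integral_comp_comm hY).symm

theorem norm_sq_eq_sum (v : Vec d) : ‖v‖ ^ 2 = ∑ j, v j ^ 2 := by
  rw [EuclideanSpace.norm_sq_eq]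
  simp

theorem norm_avg_sq_eq (v : Fin n → Vec d) :
    ‖avg v‖ ^ 2 = 1 / (n : ℝ) ^ 2 * ∑ j, (∑ τ, v τ j) ^ 2 := by
  rw [avg, norm_smul, mul_pow, norm_sq_eq_sum]
  simp

theorem integral_norm_sq {Y : α → Vec d} (hY : MemLp Y 2 ρ) :
    ∫ a, ‖Y a‖ ^ 2 ∂ρ = ∑ j, ∫ a, Y a j ^ 2 ∂ρ := by
  simp only [norm_sq_eq_sum]
  exact integral_finsetSum _ fun j _ => (memLp_coord hY j).integrable_sq

variable [IsProbabilityMeasure ρ]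

theorem integrable_sq_sum_pi {n : ℕ} {X : Fin n → α → ℝ} (hX : ∀ τ, MemLp (X τ) 2 ρ) :
    Integrable (fun z : Fin n → α => (∑ τ, X τ (z τ)) ^ 2) (Measure.pi fun _ => ρ) := by
  have h : MemLp (fun z : Fin n → α => ∑ τ, X τ (z τ)) 2 (Measure.pi fun _ => ρ) :=
    memLp_finsetSum _ fun τ _ => (hX τ).comp_measurePreserving
      (measurePreserving_eval (fun _ : Fin n => ρ) τ)
  exact h.integrable_sq

/-- Variances of independent variables add, without cross terms. Applied to each coordinate, this is
the source of every gain of `1 / n` in the final rate. -/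
theorem integral_sq_sum_pi {n : ℕ} {X : Fin n → α → ℝ} (hX : ∀ τ, MemLp (X τ) 2 ρ) :
    ∫ z : Fin n → α, (∑ τ, X τ (z τ)) ^ 2 ∂(Measure.pi fun _ => ρ)
      = (∑ τ, ∫ a, X τ a ∂ρ) ^ 2 + ∑ τ, (∫ a, X τ a ^ 2 ∂ρ - (∫ a, X τ a ∂ρ) ^ 2) := by
  have hX' : ∀ τ, MemLp (fun z : Fin n → α => X τ (z τ)) 2 (Measure.pi fun _ => ρ) := fun τ =>
    (hX τ).comp_measurePreserving (measurePreserving_eval (fun _ : Fin n => ρ) τ)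
  have h : MemLp (fun z : Fin n → α => ∑ τ, X τ (z τ)) 2 (Measure.pi fun _ => ρ) :=
    memLp_finsetSum _ fun τ _ => hX' τ
  have h1 := variance_sum_pi (μ := fun _ : Fin n => ρ) (X := X) hX
  have h2 : (∑ τ, fun z : Fin n → α => X τ (z τ)) = fun z => ∑ τ, X τ (z τ) := by
    funext z
    simp
  rw [h2, variance_eq_sub h] at h1
  simp only [fun τ => variance_eq_sub (hX τ)] at h1
  have h3 : ∫ z : Fin n → α, ∑ τ, X τ (z τ) ∂(Measure.pi fun _ => ρ) = ∑ τ, ∫ a, X τ a ∂ρ := by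
    rw [integral_finsetSum _ fun τ _ => (hX' τ).integrable one_le_two]
    refine Finset.sum_congr rfl fun τ _ => ?_
    exact integral_comp_eval (μ := fun _ : Fin n => ρ) (hX τ).aestronglyMeasurable
  rw [h3] at h1
  simp only [Pi.pow_apply] at h1
  linarith

theorem integrable_norm_avg_sq {Y : Fin n → α → Vec d} (hY : ∀ τ, MemLp (Y τ) 2 ρ) :
    Integrable (fun z : Fin n → α => ‖avg fun τ => Y τ (z τ)‖ ^ 2) (Measure.pi fun _ => ρ) := by
  simp only [norm_avg_sq_eq]
  exact (integrable_finsetSum _ fun j _ =>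
    integrable_sq_sum_pi fun τ => memLp_coord (hY τ) j).const_mul _

/-- The second moment of an average of independent random vectors. -/
theorem integral_norm_avg_sq {Y : Fin n → α → Vec d} (hY : ∀ τ, MemLp (Y τ) 2 ρ) :
    ∫ z : Fin n → α, ‖avg fun τ => Y τ (z τ)‖ ^ 2 ∂(Measure.pi fun _ => ρ)
      = ‖avg fun τ => ∫ a, Y τ a ∂ρ‖ ^ 2
        + 1 / (n : ℝ) ^ 2 * ∑ τ, (∫ a, ‖Y τ a‖ ^ 2 ∂ρ - ‖∫ a, Y τ a ∂ρ‖ ^ 2) := by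
  simp only [norm_avg_sq_eq]
  rw [integral_const_mul, integral_finsetSum _ fun j _ =>
    integrable_sq_sum_pi fun τ => memLp_coord (hY τ) j]
  simp only [fun τ => integral_norm_sq (hY τ)]
  simp only [fun j => integral_sq_sum_pi fun τ => memLp_coord (hY τ) j, norm_sq_eq_sum,
    fun τ => integral_coord ((hY τ).integrable one_le_two)]
  rw [Finset.sum_add_distrib, mul_add, Finset.sum_comm (s := Finset.univ (α := Fin d))]
  simp only [Finset.sum_sub_distrib]

theorem integral_node {φ : Fin n → α → ℝ} (hφ : ∀ τ, Integrable (φ τ) ρ) :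
    Integrable (fun z : Fin n → α => ∑ τ, φ τ (z τ)) (Measure.pi fun _ => ρ) ∧
    ∫ z : Fin n → α, ∑ τ, φ τ (z τ) ∂(Measure.pi fun _ => ρ) = ∑ τ, ∫ a, φ τ a ∂ρ := by
  have h : ∀ τ, Integrable (fun z : Fin n → α => φ τ (z τ)) (Measure.pi fun _ => ρ) := fun τ =>
    (measurePreserving_eval (fun _ : Fin n => ρ) τ).integrable_comp_of_integrable (hφ τ)
  refine ⟨integrable_finsetSum _ fun τ _ => h τ, ?_⟩
  rw [integral_finsetSum _ fun τ _ => h τ]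
  exact Finset.sum_congr rfl fun τ _ =>
    integral_comp_eval (μ := fun _ : Fin n => ρ) (hφ τ).aestronglyMeasurable

/-- The variance does not change under reflection and translation. -/
theorem integral_norm_const_sub_sq {Y : α → Vec d} (hY : MemLp Y 2 ρ) (c : Vec d) :
    ∫ a, ‖c - Y a‖ ^ 2 ∂ρ = ‖c - ∫ a, Y a ∂ρ‖ ^ 2
      + (∫ a, ‖Y a‖ ^ 2 ∂ρ - ‖∫ a, Y a ∂ρ‖ ^ 2) := by
  have h1 := hY.integrable one_le_two
  have h2 : Integrable (fun a => ‖Y a‖ ^ 2) ρ := hY.integrable_norm_pow (by norm_num)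
  have h3 : Integrable (fun a => inner ℝ c (Y a)) ρ := h1.const_inner c
  simp only [norm_sub_sq_real]
  have h4 : Integrable (fun a => ‖c‖ ^ 2 - 2 * inner ℝ c (Y a)) ρ :=
    (integrable_const _).sub (h3.const_mul 2)
  rw [integral_add h4 h2,
    integral_sub (integrable_const _) (h3.const_mul 2), integral_const_mul, integral_inner h1]
  simp

/-- The second moment is the squared mean plus `r ^ 2` times the variance of `a`, and the variance
is at most the second moment of `a`. -/
theorem sum_norm_add_smul_sq_le [NeZero m] (c : Vec d) (r : ℝ) (a : Fin m → Vec d) :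
    (1 / (m : ℝ)) * ∑ i, ‖c + r • a i‖ ^ 2
      ≤ ‖c + r • ((1 / (m : ℝ)) • ∑ i, a i)‖ ^ 2 + r ^ 2 * ((1 / (m : ℝ)) * ∑ i, ‖a i‖ ^ 2) := by
  have hm : (m : ℝ) ≠ 0 := by exact_mod_cast NeZero.ne m
  simp only [norm_add_sq_real, inner_smul_right, norm_smul, mul_pow, Finset.sum_add_distrib,
    inner_sum, Real.norm_eq_abs, sq_abs, ← Finset.mul_sum]
  have h : 0 ≤ r ^ 2 * (|(1 / (m : ℝ))| ^ 2 * ‖∑ i, a i‖ ^ 2) := by positivity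
  rw [sq_abs] at h
  have h1 : (1 / (m : ℝ)) * ∑ _i : Fin m, ‖c‖ ^ 2 = ‖c‖ ^ 2 := by
    simp
    field_simp
  rw [mul_add, mul_add, h1]
  linarith

end SecondMoment

/-! ### The law of one node -/

section NodeLaw

variable {d m : ℕ} [NeZero m] {S S₁ : Type*} [MeasurableSpace S] [MeasurableSpace S₁]
  {ν : Measure S} {ν₁ : Measure S₁}
  {E : Type*} [NormedAddCommGroup E] [NormedSpace ℝ E]

theorem IsContractionCompressor.measurable_apply {Q : S → Vec d → Vec d} {δ : ℝ}
    (hQ : IsContractionCompressor ν Q δ) (x : Vec d) : Measurable fun s => Q s x :=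
  hQ.measurable.comp (measurable_id.prodMk measurable_const)

theorem IsContractionCompressor.integrable_sq {Q : S → Vec d → Vec d} {δ : ℝ}
    (hQ : IsContractionCompressor ν Q δ) (x : Vec d) :
    Integrable (fun s => ‖x - Q s x‖ ^ 2) ν := by
  refine ⟨(((hQ.measurable_apply x).const_sub x).norm.pow_const 2).aestronglyMeasurable, ?_⟩
  rw [hasFiniteIntegral_iff_ofReal (Filter.Eventually.of_forall fun s => sq_nonneg _)]
  exact (hQ.contraction x).trans_lt ENNReal.ofReal_lt_top

theorem IsContractionCompressor.memLp {Q : S → Vec d → Vec d} {δ : ℝ}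
    (hQ : IsContractionCompressor ν Q δ) (x : Vec d) : MemLp (fun s => x - Q s x) 2 ν :=
  (memLp_two_iff_integrable_sq_norm
    ((hQ.measurable_apply x).const_sub x).aestronglyMeasurable).2 (hQ.integrable_sq x)

theorem IsContractionCompressor.integral_le {Q : S → Vec d → Vec d} {δ : ℝ}
    (hQ : IsContractionCompressor ν Q δ) (x : Vec d) :
    ∫ s, ‖x - Q s x‖ ^ 2 ∂ν ≤ (1 - δ) * ‖x‖ ^ 2 := by
  rw [integral_eq_lintegral_of_nonneg_ae (Filter.Eventually.of_forall fun s => sq_nonneg _)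
    (hQ.integrable_sq x).aestronglyMeasurable]
  refine ENNReal.toReal_le_of_le_ofReal ?_ (hQ.contraction x)
  exact mul_nonneg (by linarith [hQ.le_one]) (sq_nonneg _)

variable [IsProbabilityMeasure ν] [IsProbabilityMeasure ν₁]

/-- The law of the index and the two seeds of one node. -/
def nodeLaw (m : ℕ) [NeZero m] (ν : Measure S) (ν₁ : Measure S₁) : Measure (Fin m × S × S₁) :=
  (PMF.uniformOfFintype (Fin m)).toMeasure.prod (ν.prod ν₁)

instance : IsProbabilityMeasure (nodeLaw m ν ν₁) := by
  unfold nodeLaw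
  infer_instance

theorem integral_uniform [CompleteSpace E] (φ : Fin m → E) :
    ∫ i, φ i ∂(PMF.uniformOfFintype (Fin m)).toMeasure = (1 / (m : ℝ)) • ∑ i, φ i := by
  rw [PMF.integral_eq_sum]
  simp [Finset.smul_sum]

theorem integral_uniform_prod [CompleteSpace E] {β : Type*} [MeasurableSpace β] {θ : Measure β}
    [IsProbabilityMeasure θ] {φ : Fin m → β → E} (hm : ∀ i, StronglyMeasurable (φ i))
    (hφ : ∀ i, Integrable (φ i) θ) :
    Integrable (fun z : Fin m × β => φ z.1 z.2)
      ((PMF.uniformOfFintype (Fin m)).toMeasure.prod θ) ∧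
    ∫ z : Fin m × β, φ z.1 z.2 ∂((PMF.uniformOfFintype (Fin m)).toMeasure.prod θ)
      = (1 / (m : ℝ)) • ∑ i, ∫ b, φ i b ∂θ := by
  have hm' : StronglyMeasurable fun z : Fin m × β => φ z.1 z.2 := by
    -- Splitting according to the finitely many values of the index reduces joint measurability to
    -- the measurability of each `φ i`.
    have h : (fun z : Fin m × β => φ z.1 z.2)
        = fun z => ∑ i, Set.indicator ((fun z : Fin m × β => z.1) ⁻¹' {i}) (fun z => φ i z.2) z := by
      funext z
      rw [Finset.sum_eq_single z.1]
      · simp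
      · intro i _ hi
        simp [Set.indicator, hi.symm]
      · simp
    rw [h]
    refine Finset.stronglyMeasurable_fun_sum _ fun i _ => ?_
    exact ((hm i).comp_measurable measurable_snd).indicator
      (measurable_fst (measurableSet_singleton i))
  have hint : Integrable (fun z : Fin m × β => φ z.1 z.2)
      ((PMF.uniformOfFintype (Fin m)).toMeasure.prod θ) := by
    rw [integrable_prod_iff hm'.aestronglyMeasurable]
    exact ⟨Filter.Eventually.of_forall hφ, Integrable.of_finite⟩
  exact ⟨hint, by rw [integral_prod _ hint, integral_uniform]⟩

theorem IsContractionCompressor.integral_eq {Q : S → Vec d → Vec d} {δ : ℝ}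
    (hQ : IsContractionCompressor ν Q δ) (hmean : ∀ x, ∫ s, Q s x ∂ν = δ • x) (x : Vec d) :
    ∫ s, (x - Q s x) ∂ν = (1 - δ) • x := by
  have h : Integrable (fun s => Q s x) ν := by
    have h1 := (integrable_const x).sub ((hQ.memLp x).integrable one_le_two)
    simpa [Pi.sub_def] using h1
  rw [integral_sub (integrable_const x) h, hmean]
  simp [sub_smul]

variable {Q : S → Vec d → Vec d} {δ : ℝ} {Q₁ : S₁ → Vec d → Vec d} {δ₁ : ℝ}

/-- The error of compressing a vector that depends on the random index. -/
theorem nodeLaw_error (hQ : IsContractionCompressor ν Q δ)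
    (hmean : ∀ x, ∫ s, Q s x ∂ν = δ • x) (v : Fin m → Vec d) :
    MemLp (fun z : Fin m × S × S₁ => v z.1 - Q z.2.1 (v z.1)) 2 (nodeLaw m ν ν₁) ∧
    ∫ z, (v z.1 - Q z.2.1 (v z.1)) ∂(nodeLaw m ν ν₁)
      = (1 - δ) • ((1 / (m : ℝ)) • ∑ i, v i) ∧
    ∫ z, ‖v z.1 - Q z.2.1 (v z.1)‖ ^ 2 ∂(nodeLaw m ν ν₁)
      ≤ (1 - δ) * ((1 / (m : ℝ)) * ∑ i, ‖v i‖ ^ 2) := by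
  have hmeas : ∀ i, Measurable fun b : S × S₁ => v i - Q b.1 (v i) := fun i =>
    ((hQ.measurable_apply (v i)).const_sub (v i)).comp measurable_fst
  have h1 := integral_uniform_prod (m := m) (θ := ν.prod ν₁)
    (φ := fun i (b : S × S₁) => v i - Q b.1 (v i)) (fun i => (hmeas i).stronglyMeasurable)
    fun i => ((hQ.memLp (v i)).integrable one_le_two).comp_fst ν₁
  have h2 := integral_uniform_prod (m := m) (θ := ν.prod ν₁)
    (φ := fun i (b : S × S₁) => ‖v i - Q b.1 (v i)‖ ^ 2)
    (fun i => ((hmeas i).norm.pow_const 2).stronglyMeasurable)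
    fun i => (hQ.integrable_sq (v i)).comp_fst ν₁
  refine ⟨(memLp_two_iff_integrable_sq_norm h1.1.aestronglyMeasurable).2 h2.1, ?_, ?_⟩
  · rw [nodeLaw, h1.2]
    simp only [fun i => integral_fun_fst (μ := ν) (ν := ν₁) (fun s => v i - Q s (v i)),
      hQ.integral_eq hmean]
    simp [Finset.smul_sum, smul_comm (1 - δ)]
  · rw [nodeLaw, h2.2]
    simp only [fun i => integral_fun_fst (μ := ν) (ν := ν₁) (fun s => ‖v i - Q s (v i)‖ ^ 2)]
    rw [smul_eq_mul, mul_left_comm]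
    have hm : (0 : ℝ) ≤ 1 / (m : ℝ) := by positivity
    refine mul_le_mul_of_nonneg_left ?_ hm
    rw [Finset.mul_sum]
    refine Finset.sum_le_sum fun i _ => ?_
    simpa using hQ.integral_le (v i)

/-- Functions of the random index. -/
theorem nodeLaw_index (v : Fin m → Vec d) :
    MemLp (fun z : Fin m × S × S₁ => v z.1) 2 (nodeLaw m ν ν₁) ∧
    ∫ z, v z.1 ∂(nodeLaw m ν ν₁) = (1 / (m : ℝ)) • ∑ i, v i ∧
    ∫ z, ‖v z.1‖ ^ 2 ∂(nodeLaw m ν ν₁) = (1 / (m : ℝ)) * ∑ i, ‖v i‖ ^ 2 := by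
  have h1 := integral_uniform_prod (m := m) (θ := ν.prod ν₁)
    (φ := fun i (_ : S × S₁) => v i) (fun i => stronglyMeasurable_const)
    fun i => integrable_const _
  have h2 := integral_uniform_prod (m := m) (θ := ν.prod ν₁)
    (φ := fun i (_ : S × S₁) => ‖v i‖ ^ 2) (fun i => stronglyMeasurable_const)
    fun i => integrable_const _
  refine ⟨(memLp_two_iff_integrable_sq_norm h1.1.aestronglyMeasurable).2 h2.1, ?_, ?_⟩
  · rw [nodeLaw, h1.2]
    simp
  · rw [nodeLaw, h2.2]
    simp

/-- Adding a compressed vector to a constant. -/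
theorem nodeLaw_compressed (hQ₁ : IsContractionCompressor ν₁ Q₁ δ₁)
    (hmean₁ : ∀ x, ∫ s, Q₁ s x ∂ν₁ = δ₁ • x) (c v : Vec d) :
    MemLp (fun z : Fin m × S × S₁ => c + Q₁ z.2.2 v) 2 (nodeLaw m ν ν₁) ∧
    ∫ z, (c + Q₁ z.2.2 v) ∂(nodeLaw m ν ν₁) = c + δ₁ • v ∧
    ∫ z, ‖c + Q₁ z.2.2 v‖ ^ 2 ∂(nodeLaw m ν ν₁) ≤ ‖c + δ₁ • v‖ ^ 2 + δ₁ * (1 - δ₁) * ‖v‖ ^ 2 := by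
  have he : ∀ s, c + Q₁ s v = (c + v) - (v - Q₁ s v) := fun s => by abel
  have hL : MemLp (fun s => c + Q₁ s v) 2 ν₁ := by
    simp only [he]
    exact (memLp_const (c + v)).sub (hQ₁.memLp v)
  have hmp : MeasurePreserving (fun z : Fin m × S × S₁ => z.2.2) (nodeLaw m ν ν₁) ν₁ :=
    measurePreserving_snd.comp measurePreserving_snd
  have hint : ∀ {E' : Type} [NormedAddCommGroup E'] [NormedSpace ℝ E'] {φ : S₁ → E'},
      AEStronglyMeasurable φ ν₁ → ∫ z, φ z.2.2 ∂(nodeLaw m ν ν₁) = ∫ s, φ s ∂ν₁ := by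
    intro E' _ _ φ hφ
    rw [← hmp.map_eq] at hφ
    rw [← integral_map hmp.aemeasurable hφ, hmp.map_eq]
  have hmeanv : ∫ s, (c + Q₁ s v) ∂ν₁ = c + δ₁ • v := by
    simp only [he]
    rw [integral_sub (integrable_const _) ((hQ₁.memLp v).integrable one_le_two),
      hQ₁.integral_eq hmean₁]
    simp only [integral_const, probReal_univ, one_smul, sub_smul]
    abel
  refine ⟨hL.comp_measurePreserving hmp, ?_, ?_⟩
  · rw [hint (φ := fun s => c + Q₁ s v) hL.aestronglyMeasurable, hmeanv]
  · rw [hint (φ := fun s => ‖c + Q₁ s v‖ ^ 2) (hL.aestronglyMeasurable.norm.pow 2)]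
    simp only [he]
    rw [integral_norm_const_sub_sq (hQ₁.memLp v), hQ₁.integral_eq hmean₁]
    have h1 := hQ₁.integral_le v
    have h2 : c + v - (1 - δ₁) • v = c + δ₁ • v := by
      rw [sub_smul, one_smul]
      abel
    rw [h2, norm_smul, mul_pow, Real.norm_eq_abs, sq_abs]
    nlinarith

end NodeLaw

/-! ### Second moments of the quantities in one iteration -/

section NodeAverages

variable {n m d : ℕ} {S S₁ : Type*} [MeasurableSpace S] [MeasurableSpace S₁]
  {ν : Measure S} [IsProbabilityMeasure ν] {ν₁ : Measure S₁} [IsProbabilityMeasure ν₁]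
  {Q : S → Vec d → Vec d} {δ : ℝ} {Q₁ : S₁ → Vec d → Vec d} {δ₁ : ℝ}

/-- The mean of the squared norms of a doubly indexed family, divided by the number of nodes. -/
def meanSq (a : Fin n → Fin m → Vec d) : ℝ :=
  1 / (n : ℝ) ^ 2 * ∑ τ, (1 / (m : ℝ)) * ∑ i, ‖a τ i‖ ^ 2

theorem meanSq_nonneg (a : Fin n → Fin m → Vec d) : 0 ≤ meanSq a := by
  unfold meanSq
  positivity

theorem mean_affine [NeZero m] (c : Vec d) (r : ℝ) (a : Fin m → Vec d) :
    (1 / (m : ℝ)) • ∑ i, (c + r • a i) = c + r • ((1 / (m : ℝ)) • ∑ i, a i) := by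
  have hm : (m : ℝ) ≠ 0 := by exact_mod_cast NeZero.ne m
  rw [Finset.sum_add_distrib, smul_add, ← Finset.smul_sum, smul_comm r]
  simp [← Nat.cast_smul_eq_nsmul ℝ, smul_smul, hm]

theorem integral_norm_avg_sq_le {α : Type*} [MeasurableSpace α] {ρ : Measure α}
    [IsProbabilityMeasure ρ] {Y : Fin n → α → Vec d} {y : Fin n → Vec d} {R : Fin n → ℝ}
    (hY : ∀ τ, MemLp (Y τ) 2 ρ) (hy : ∀ τ, ∫ a, Y τ a ∂ρ = y τ)
    (hR : ∀ τ, ∫ a, ‖Y τ a‖ ^ 2 ∂ρ ≤ ‖y τ‖ ^ 2 + R τ) :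
    ∫ z : Fin n → α, ‖avg fun τ => Y τ (z τ)‖ ^ 2 ∂(Measure.pi fun _ => ρ)
      ≤ ‖avg y‖ ^ 2 + 1 / (n : ℝ) ^ 2 * ∑ τ, R τ := by
  rw [integral_norm_avg_sq hY]
  simp only [hy]
  have h : ∑ τ, (∫ a, ‖Y τ a‖ ^ 2 ∂ρ - ‖y τ‖ ^ 2) ≤ ∑ τ, R τ :=
    Finset.sum_le_sum fun τ _ => by linarith [hR τ]
  gcongr

theorem integral_sum_norm_sq_le {α : Type*} [MeasurableSpace α] {ρ : Measure α}
    [IsProbabilityMeasure ρ] {Y : Fin n → α → Vec d} {R : Fin n → ℝ}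
    (hY : ∀ τ, MemLp (Y τ) 2 ρ) (hR : ∀ τ, ∫ a, ‖Y τ a‖ ^ 2 ∂ρ ≤ R τ) :
    Integrable (fun z : Fin n → α => 1 / (n : ℝ) ^ 2 * ∑ τ, ‖Y τ (z τ)‖ ^ 2)
      (Measure.pi fun _ => ρ) ∧
    ∫ z : Fin n → α, 1 / (n : ℝ) ^ 2 * ∑ τ, ‖Y τ (z τ)‖ ^ 2 ∂(Measure.pi fun _ => ρ)
      ≤ 1 / (n : ℝ) ^ 2 * ∑ τ, R τ := by
  have h := integral_node (ρ := ρ) (φ := fun τ a => ‖Y τ a‖ ^ 2)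
    fun τ => (hY τ).integrable_norm_pow (by norm_num)
  refine ⟨h.1.const_mul _, ?_⟩
  rw [integral_const_mul, h.2]
  exact mul_le_mul_of_nonneg_left (Finset.sum_le_sum fun τ _ => hR τ) (by positivity)

variable [NeZero m] (c : Fin n → Vec d) (r : ℝ) (a : Fin n → Fin m → Vec d)

theorem integral_avg_index :
    Integrable (fun z : Fin n → Fin m × S × S₁ => ‖avg fun τ => c τ + r • a τ (z τ).1‖ ^ 2)
      (Measure.pi fun _ => nodeLaw m ν ν₁) ∧
    ∫ z : Fin n → Fin m × S × S₁, ‖avg fun τ => c τ + r • a τ (z τ).1‖ ^ 2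
        ∂(Measure.pi fun _ => nodeLaw m ν ν₁)
      ≤ ‖avg fun τ => c τ + r • ((1 / (m : ℝ)) • ∑ i, a τ i)‖ ^ 2 + r ^ 2 * meanSq a := by
  have h := fun τ => nodeLaw_index (ν := ν) (ν₁ := ν₁) fun i => c τ + r • a τ i
  have hY : ∀ τ, MemLp ((fun τ (z : Fin m × S × S₁) => c τ + r • a τ z.1) τ) 2
    (nodeLaw m ν ν₁) := fun τ => (h τ).1
  have h1 := integrable_norm_avg_sq hY
  have h2 := integral_norm_avg_sq_le
    (y := fun τ => c τ + r • ((1 / (m : ℝ)) • ∑ i, a τ i))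
    (R := fun τ => r ^ 2 * ((1 / (m : ℝ)) * ∑ i, ‖a τ i‖ ^ 2)) hY
    (fun τ => ((h τ).2.1).trans (mean_affine _ _ _)) fun τ => by
      have h3 := (h τ).2.2
      have h4 := sum_norm_add_smul_sq_le (c τ) r (a τ)
      exact h3.trans_le h4
  refine ⟨h1, h2.trans_eq ?_⟩
  simp only [meanSq, ← Finset.mul_sum]
  ring

theorem nodeLaw_error_le (hQ : IsContractionCompressor ν Q δ)
    (hmean : ∀ x, ∫ s, Q s x ∂ν = δ • x) (τ : Fin n) :
    ∫ z, ‖c τ + r • a τ z.1 - Q z.2.1 (c τ + r • a τ z.1)‖ ^ 2 ∂(nodeLaw m ν ν₁)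
      ≤ (1 - δ) * ‖c τ + r • ((1 / (m : ℝ)) • ∑ i, a τ i)‖ ^ 2
        + (1 - δ) * r ^ 2 * ((1 / (m : ℝ)) * ∑ i, ‖a τ i‖ ^ 2) := by
  have h1 := (nodeLaw_error (ν₁ := ν₁) hQ hmean fun i => c τ + r • a τ i).2.2
  have h2 := mul_le_mul_of_nonneg_left (sum_norm_add_smul_sq_le (c τ) r (a τ))
    (sub_nonneg.2 hQ.le_one)
  refine (h1.trans h2).trans_eq ?_
  ring

/-- The compression error of a node has mean `1 - δ` times the mean input, so the average over nodes
contracts with the factor `(1 - δ) ^ 2`. What is left is variance: second moment minus squared mean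
has factor `(1 - δ) - (1 - δ) ^ 2 = (1 - δ) * δ`, and it enters only with the weight `1 / n ^ 2`. -/
theorem integral_avg_error (hQ : IsContractionCompressor ν Q δ)
    (hmean : ∀ x, ∫ s, Q s x ∂ν = δ • x) :
    Integrable (fun z : Fin n → Fin m × S × S₁ => ‖avg fun τ => c τ + r • a τ (z τ).1
        - Q (z τ).2.1 (c τ + r • a τ (z τ).1)‖ ^ 2) (Measure.pi fun _ => nodeLaw m ν ν₁) ∧
    ∫ z : Fin n → Fin m × S × S₁, ‖avg fun τ => c τ + r • a τ (z τ).1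
        - Q (z τ).2.1 (c τ + r • a τ (z τ).1)‖ ^ 2 ∂(Measure.pi fun _ => nodeLaw m ν ν₁)
      ≤ (1 - δ) ^ 2 * ‖avg fun τ => c τ + r • ((1 / (m : ℝ)) • ∑ i, a τ i)‖ ^ 2
        + (1 - δ) * δ * (1 / (n : ℝ) ^ 2
          * ∑ τ, ‖c τ + r • ((1 / (m : ℝ)) • ∑ i, a τ i)‖ ^ 2)
        + (1 - δ) * r ^ 2 * meanSq a := by
  have h := fun τ => nodeLaw_error (ν₁ := ν₁) hQ hmean fun i => c τ + r • a τ i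
  have hY : ∀ τ, MemLp ((fun τ (z : Fin m × S × S₁) => c τ + r • a τ z.1
    - Q z.2.1 (c τ + r • a τ z.1)) τ) 2 (nodeLaw m ν ν₁) := fun τ => (h τ).1
  have h1 := integrable_norm_avg_sq hY
  have h2 := integral_norm_avg_sq_le
    (y := fun τ => (1 - δ) • (c τ + r • ((1 / (m : ℝ)) • ∑ i, a τ i)))
    (R := fun τ => (1 - δ) * δ * ‖c τ + r • ((1 / (m : ℝ)) • ∑ i, a τ i)‖ ^ 2
      + (1 - δ) * r ^ 2 * ((1 / (m : ℝ)) * ∑ i, ‖a τ i‖ ^ 2)) hY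
    (fun τ => by rw [← mean_affine]; exact (h τ).2.1) fun τ => by
      have h3 := nodeLaw_error_le (ν₁ := ν₁) c r a hQ hmean τ
      refine h3.trans_eq ?_
      rw [norm_smul, mul_pow, Real.norm_eq_abs, sq_abs]
      ring
  refine ⟨h1, h2.trans_eq ?_⟩
  rw [avg_smul, norm_smul, mul_pow, Real.norm_eq_abs, sq_abs, meanSq, Finset.sum_add_distrib,
    ← Finset.mul_sum, ← Finset.mul_sum]
  ring

theorem integral_sum_error (hQ : IsContractionCompressor ν Q δ)
    (hmean : ∀ x, ∫ s, Q s x ∂ν = δ • x) :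
    Integrable (fun z : Fin n → Fin m × S × S₁ => 1 / (n : ℝ) ^ 2 * ∑ τ, ‖c τ + r • a τ (z τ).1
        - Q (z τ).2.1 (c τ + r • a τ (z τ).1)‖ ^ 2) (Measure.pi fun _ => nodeLaw m ν ν₁) ∧
    ∫ z : Fin n → Fin m × S × S₁, 1 / (n : ℝ) ^ 2 * ∑ τ, ‖c τ + r • a τ (z τ).1
        - Q (z τ).2.1 (c τ + r • a τ (z τ).1)‖ ^ 2 ∂(Measure.pi fun _ => nodeLaw m ν ν₁)
      ≤ (1 - δ) * (1 / (n : ℝ) ^ 2 * ∑ τ, ‖c τ + r • ((1 / (m : ℝ)) • ∑ i, a τ i)‖ ^ 2)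
        + (1 - δ) * r ^ 2 * meanSq a := by
  have hY : ∀ τ, MemLp ((fun τ (z : Fin m × S × S₁) => c τ + r • a τ z.1
    - Q z.2.1 (c τ + r • a τ z.1)) τ) 2 (nodeLaw m ν ν₁) := fun τ =>
    (nodeLaw_error (ν₁ := ν₁) hQ hmean fun i => c τ + r • a τ i).1
  have h := integral_sum_norm_sq_le hY fun τ => nodeLaw_error_le c r a hQ hmean τ
  refine ⟨h.1, h.2.trans_eq ?_⟩
  rw [meanSq, Finset.sum_add_distrib, ← Finset.mul_sum, ← Finset.mul_sum]
  ring

variable (v : Fin n → Vec d)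

/-- Again mean plus variance; for the compressor `Q₁` the variance factor is `(1 - δ₁) - (1 - δ₁) ^
2`. -/
theorem integral_avg_compressed (hQ₁ : IsContractionCompressor ν₁ Q₁ δ₁)
    (hmean₁ : ∀ x, ∫ s, Q₁ s x ∂ν₁ = δ₁ • x) :
    Integrable (fun z : Fin n → Fin m × S × S₁ => ‖avg fun τ => c τ + Q₁ (z τ).2.2 (v τ)‖ ^ 2)
      (Measure.pi fun _ => nodeLaw m ν ν₁) ∧
    ∫ z : Fin n → Fin m × S × S₁, ‖avg fun τ => c τ + Q₁ (z τ).2.2 (v τ)‖ ^ 2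
        ∂(Measure.pi fun _ => nodeLaw m ν ν₁)
      ≤ ‖avg fun τ => c τ + δ₁ • v τ‖ ^ 2
        + δ₁ * (1 - δ₁) * (1 / (n : ℝ) ^ 2 * ∑ τ, ‖v τ‖ ^ 2) := by
  have h := fun τ => nodeLaw_compressed (m := m) (ν := ν) hQ₁ hmean₁ (c τ) (v τ)
  have hY : ∀ τ, MemLp ((fun τ (z : Fin m × S × S₁) => c τ + Q₁ z.2.2 (v τ)) τ) 2
    (nodeLaw m ν ν₁) := fun τ => (h τ).1
  have h1 := integrable_norm_avg_sq hY
  have h2 := integral_norm_avg_sq_le (y := fun τ => c τ + δ₁ • v τ)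
    (R := fun τ => δ₁ * (1 - δ₁) * ‖v τ‖ ^ 2) hY (fun τ => (h τ).2.1) fun τ => (h τ).2.2
  refine ⟨h1, h2.trans_eq ?_⟩
  simp only [← Finset.mul_sum]
  ring

theorem integral_sum_compressed (hQ₁ : IsContractionCompressor ν₁ Q₁ δ₁)
    (hmean₁ : ∀ x, ∫ s, Q₁ s x ∂ν₁ = δ₁ • x) :
    Integrable (fun z : Fin n → Fin m × S × S₁ =>
      1 / (n : ℝ) ^ 2 * ∑ τ, ‖c τ + Q₁ (z τ).2.2 (v τ)‖ ^ 2)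
      (Measure.pi fun _ => nodeLaw m ν ν₁) ∧
    ∫ z : Fin n → Fin m × S × S₁, 1 / (n : ℝ) ^ 2 * ∑ τ, ‖c τ + Q₁ (z τ).2.2 (v τ)‖ ^ 2
        ∂(Measure.pi fun _ => nodeLaw m ν ν₁)
      ≤ 1 / (n : ℝ) ^ 2 * ∑ τ, ‖c τ + δ₁ • v τ‖ ^ 2
        + δ₁ * (1 - δ₁) * (1 / (n : ℝ) ^ 2 * ∑ τ, ‖v τ‖ ^ 2) := by
  have h := fun τ => nodeLaw_compressed (m := m) (ν := ν) hQ₁ hmean₁ (c τ) (v τ)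
  have hY : ∀ τ, MemLp ((fun τ (z : Fin m × S × S₁) => c τ + Q₁ z.2.2 (v τ)) τ) 2
    (nodeLaw m ν ν₁) := fun τ => (h τ).1
  have h' := integral_sum_norm_sq_le hY fun τ => (h τ).2.2
  refine ⟨h'.1, h'.2.trans_eq ?_⟩
  rw [Finset.sum_add_distrib, ← Finset.mul_sum]
  ring

end NodeAverages

/-! ### One iteration -/

section Step

variable {n m d : ℕ}

/-- The Lyapunov function of EC-LSVRG with coefficients `b` for the finite sum `G = avg F` with
minimizer `xs`. -/
def lyapunov (F : Fin n → Fin m → Vec d → ℝ) (G : Vec d → ℝ) (xs : Vec d) (b : Fin 5 → ℝ)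
    (s : State n d) : ℝ :=
  ‖s.x - avg s.e - xs‖ ^ 2
    + b 0 * ‖avg s.e‖ ^ 2
    + b 1 * ((1 / (n : ℝ) ^ 2) * ∑ τ, ‖s.e τ‖ ^ 2)
    + b 2 * ‖s.hbar - gradient G s.w‖ ^ 2
    + b 3 * ((1 / (n : ℝ) ^ 2) * ∑ τ, ‖s.h τ - gradient (nodeAvg F τ) s.w‖ ^ 2)
    + b 4 * (G s.w - G xs)

theorem lyapunov_nonneg {F : Fin n → Fin m → Vec d → ℝ} {G : Vec d → ℝ} {xs : Vec d}
    {μ M L : ℝ} (hF : FiniteSumProblem F G xs μ M L) (hμ : 0 ≤ μ) {b : Fin 5 → ℝ}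
    (hb : ∀ j, 0 ≤ b j) (s : State n d) : 0 ≤ lyapunov F G xs b s := by
  have h0 := hb 0
  have h1 := hb 1
  have h2 := hb 2
  have h3 := hb 3
  have h4 := hb 4
  have h5 : 0 ≤ G s.w - G xs := le_trans (by positivity) (hF.growth s.w)
  unfold lyapunov
  positivity

variable [NeZero n] [NeZero m] {S S₁ : Type*} [MeasurableSpace S] [MeasurableSpace S₁]
  {ν : Measure S} [IsProbabilityMeasure ν] {ν₁ : Measure S₁} [IsProbabilityMeasure ν₁]
  {Q : S → Vec d → Vec d} {δ : ℝ} {Q₁ : S₁ → Vec d → Vec d} {δ₁ : ℝ}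
  {F : Fin n → Fin m → Vec d → ℝ} {G : Vec d → ℝ} {xs : Vec d} {μ M L : ℝ}

/-- The bound on the expectation of the Lyapunov function after one iteration, given that the new
checkpoint is `w`. -/
def stepBound (F : Fin n → Fin m → Vec d → ℝ) (G : Vec d → ℝ) (xs : Vec d) (b : Fin 5 → ℝ)
    (δ δ₁ η : ℝ) (s : State n d) (w : Vec d) : ℝ :=
  (‖s.x - avg s.e - xs - η • gradient G s.x‖ ^ 2
      + η ^ 2 * meanSq fun τ i => gradient (F τ i) s.x - gradient (F τ i) s.w)
    + b 0 * ((1 - δ) ^ 2 * ‖avg s.e + η • (gradient G s.x - s.hbar)‖ ^ 2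
      + (1 - δ) * δ * (1 / (n : ℝ) ^ 2
        * ∑ τ, ‖s.e τ + η • (gradient (nodeAvg F τ) s.x - s.h τ)‖ ^ 2)
      + (1 - δ) * η ^ 2 * meanSq fun τ i => gradient (F τ i) s.x - gradient (F τ i) s.w)
    + b 1 * ((1 - δ) * (1 / (n : ℝ) ^ 2
        * ∑ τ, ‖s.e τ + η • (gradient (nodeAvg F τ) s.x - s.h τ)‖ ^ 2)
      + (1 - δ) * η ^ 2 * meanSq fun τ i => gradient (F τ i) s.x - gradient (F τ i) s.w)
    + b 2 * (‖(1 - δ₁) • (s.hbar - gradient G s.w) + (gradient G s.w - gradient G w)‖ ^ 2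
      + δ₁ * (1 - δ₁)
        * ((1 / (n : ℝ) ^ 2) * ∑ τ, ‖s.h τ - gradient (nodeAvg F τ) s.w‖ ^ 2))
    + b 3 * ((1 / (n : ℝ) ^ 2) * ∑ τ, ‖(1 - δ₁) • (s.h τ - gradient (nodeAvg F τ) s.w)
        + (gradient (nodeAvg F τ) s.w - gradient (nodeAvg F τ) w)‖ ^ 2
      + δ₁ * (1 - δ₁)
        * ((1 / (n : ℝ) ^ 2) * ∑ τ, ‖s.h τ - gradient (nodeAvg F τ) s.w‖ ^ 2))
    + b 4 * (G w - G xs)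

/-- After the step, each part of the Lyapunov function is the squared norm, or a sum of squared
norms, of one of the random families treated above: an affine function of the sampled index, a
compression error, or a constant plus a compressed vector. The coin is fixed here, so the new
checkpoint `w` is deterministic. -/
theorem integral_lyapunov_step_le (hF : FiniteSumProblem F G xs μ M L)
    (hQ : IsContractionCompressor ν Q δ) (hmean : ∀ x, ∫ s, Q s x ∂ν = δ • x)
    (hQ₁ : IsContractionCompressor ν₁ Q₁ δ₁) (hmean₁ : ∀ x, ∫ s, Q₁ s x ∂ν₁ = δ₁ • x)
    {b : Fin 5 → ℝ} (hb : ∀ j, 0 ≤ b j) (η : ℝ) {s : State n d} (hs : s.hbar = avg s.h)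
    (u : Bool) :
    Integrable (fun z => lyapunov F G xs b (ecStep Q Q₁ F η (z, u) s))
      (Measure.pi fun _ => nodeLaw m ν ν₁) ∧
    ∫ z, lyapunov F G xs b (ecStep Q Q₁ F η (z, u) s) ∂(Measure.pi fun _ => nodeLaw m ν ν₁)
      ≤ stepBound F G xs b δ δ₁ η s (if u = true then s.x else s.w) := by
  set w := if u = true then s.x else s.w with hw
  set a : Fin n → Fin m → Vec d := fun τ i => gradient (F τ i) s.x - gradient (F τ i) s.w with ha
  have hmA : ∀ τ, (1 / (m : ℝ)) • ∑ i, a τ i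
      = gradient (nodeAvg F τ) s.x - gradient (nodeAvg F τ) s.w := by
    intro τ
    rw [hF.grad_node, hF.grad_node, ← smul_sub, ← Finset.sum_sub_distrib]
  set ce : Fin n → Vec d := fun τ => s.e τ + η • (gradient (nodeAvg F τ) s.w - s.h τ) with hce
  have hceA : ∀ τ, ce τ + η • ((1 / (m : ℝ)) • ∑ i, a τ i)
      = s.e τ + η • (gradient (nodeAvg F τ) s.x - s.h τ) := by
    intro τ
    rw [hmA, hce]
    module
  set cx : Fin n → Vec d := fun τ => (s.x - avg s.e - xs) + (-η) • gradient (nodeAvg F τ) s.w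
    with hcx
  set v : Fin n → Vec d := fun τ => gradient (nodeAvg F τ) s.w - s.h τ with hv
  set ch : Fin n → Vec d := fun τ => s.h τ - gradient (nodeAvg F τ) w with hch
  have hvA : ∀ τ, ch τ + δ₁ • v τ = (1 - δ₁) • (s.h τ - gradient (nodeAvg F τ) s.w)
      + (gradient (nodeAvg F τ) s.w - gradient (nodeAvg F τ) w) := by
    intro τ
    rw [hch, hv]
    module
  have hvn : ∀ τ, ‖v τ‖ ^ 2 = ‖s.h τ - gradient (nodeAvg F τ) s.w‖ ^ 2 := fun τ => by
    rw [hv, norm_sub_rev]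
  obtain ⟨iX, bX⟩ := integral_avg_index (ν := ν) (ν₁ := ν₁) cx (-η) a
  obtain ⟨iE, bE⟩ := integral_avg_error (ν₁ := ν₁) ce η a hQ hmean
  obtain ⟨iE', bE'⟩ := integral_sum_error (ν₁ := ν₁) ce η a hQ hmean
  obtain ⟨iH, bH⟩ := integral_avg_compressed (m := m) (ν := ν) ch v hQ₁ hmean₁
  obtain ⟨iH', bH'⟩ := integral_sum_compressed (m := m) (ν := ν) ch v hQ₁ hmean₁
  have hg : ∀ (z : Fin n → Fin m × S × S₁) τ, η • (gradient (F τ (z τ).1) s.x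
      - gradient (F τ (z τ).1) s.w + gradient (nodeAvg F τ) s.w - s.h τ) + s.e τ
      = ce τ + η • a τ (z τ).1 := by
    intro z τ
    rw [hce, ha]
    module
  have hstep : ∀ z : Fin n → Fin m × S × S₁, lyapunov F G xs b (ecStep Q Q₁ F η (z, u) s)
      = ‖avg fun τ => cx τ + (-η) • a τ (z τ).1‖ ^ 2
        + b 0 * ‖avg fun τ => ce τ + η • a τ (z τ).1
          - Q (z τ).2.1 (ce τ + η • a τ (z τ).1)‖ ^ 2
        + b 1 * (1 / (n : ℝ) ^ 2 * ∑ τ, ‖ce τ + η • a τ (z τ).1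
          - Q (z τ).2.1 (ce τ + η • a τ (z τ).1)‖ ^ 2)
        + b 2 * ‖avg fun τ => ch τ + Q₁ (z τ).2.2 (v τ)‖ ^ 2
        + b 3 * (1 / (n : ℝ) ^ 2 * ∑ τ, ‖ch τ + Q₁ (z τ).2.2 (v τ)‖ ^ 2)
        + b 4 * (G w - G xs) := by
    intro z
    have e1 : (ecStep Q Q₁ F η (z, u) s).e = fun τ => ce τ + η • a τ (z τ).1
        - Q (z τ).2.1 (ce τ + η • a τ (z τ).1) := by
      funext τ
      simp only [ecStep, hg]
      rw [← hg]
      abel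
    have e2 : (ecStep Q Q₁ F η (z, u) s).w = w := rfl
    have e3 : ∀ τ, (ecStep Q Q₁ F η (z, u) s).h τ - gradient (nodeAvg F τ) w
        = ch τ + Q₁ (z τ).2.2 (v τ) := by
      intro τ
      simp only [ecStep, hch, hv]
      abel
    have e4 : (ecStep Q Q₁ F η (z, u) s).hbar - gradient G w
        = avg fun τ => ch τ + Q₁ (z τ).2.2 (v τ) := by
      rw [avg_add, hch, avg_sub, ← hF.grad_sum, ← hs]
      simp only [ecStep]
      abel
    -- The compressed messages cancel between `x` and `avg e`, and `avg h` cancels against `hbar`.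
    -- The virtual iterate is left with an uncompressed stochastic gradient step.
    have e5 : (ecStep Q Q₁ F η (z, u) s).x - avg (ecStep Q Q₁ F η (z, u) s).e - xs
        = avg fun τ => cx τ + (-η) • a τ (z τ).1 := by
      rw [e1, avg_sub]
      simp only [ecStep, hg]
      rw [hs, sub_sub, sub_sub, ← avg_smul, hcx]
      simp only [hce, avg_add, avg_smul, avg_sub, avg_const]
      module
    rw [lyapunov, e5, e1, e2, e4]
    simp only [e3]
  simp only [hstep]
  have i1 := iX.fun_add (iE.const_mul (b 0))
  have i2 := i1.fun_add (iE'.const_mul (b 1))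
  have i3 := i2.fun_add (iH.const_mul (b 2))
  have i4 := i3.fun_add (iH'.const_mul (b 3))
  refine ⟨i4.add (integrable_const _), ?_⟩
  rw [integral_add i4 (integrable_const _), integral_add i3 (iH'.const_mul (b 3)),
    integral_add i2 (iH.const_mul (b 2)), integral_add i1 (iE'.const_mul (b 1)),
    integral_add iX (iE.const_mul (b 0))]
  simp only [integral_const_mul, integral_const, probReal_univ, one_smul]
  rw [stepBound]
  rw [integral_const_mul] at bE' bH'
  simp only [hceA] at bE bE'
  simp only [hvA, hvn] at bH bH'
  have f1 : (avg fun τ => s.e τ + η • (gradient (nodeAvg F τ) s.x - s.h τ))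
      = avg s.e + η • (gradient G s.x - s.hbar) := by
    rw [avg_add, avg_smul, avg_sub, hs, hF.grad_sum]
  have f2 : (avg fun τ => (1 - δ₁) • (s.h τ - gradient (nodeAvg F τ) s.w)
      + (gradient (nodeAvg F τ) s.w - gradient (nodeAvg F τ) w))
      = (1 - δ₁) • (s.hbar - gradient G s.w) + (gradient G s.w - gradient G w) := by
    rw [avg_add, avg_smul, avg_sub, avg_sub, hs, hF.grad_sum, hF.grad_sum]
  have f3 : (avg fun τ => cx τ + (-η) • ((1 / (m : ℝ)) • ∑ i, a τ i))
      = s.x - avg s.e - xs - η • gradient G s.x := by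
    simp only [hmA, hcx, avg_add, avg_smul, avg_sub, avg_const, ← hF.grad_sum]
    module
  rw [f1] at bE
  rw [f2] at bH
  rw [f3, neg_sq] at bX
  have k := fun {x y : ℝ} {j : Fin 5} (h : x ≤ y) => mul_le_mul_of_nonneg_left h (hb j)
  exact add_le_add (add_le_add (add_le_add (add_le_add (add_le_add bX (k bE)) (k bE')) (k bH))
    (k bH')) le_rfl

theorem lintegral_lyapunov_step_le (hF : FiniteSumProblem F G xs μ M L) (hμ : 0 ≤ μ)
    (hQ : IsContractionCompressor ν Q δ) (hmean : ∀ x, ∫ s, Q s x ∂ν = δ • x)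
    (hQ₁ : IsContractionCompressor ν₁ Q₁ δ₁) (hmean₁ : ∀ x, ∫ s, Q₁ s x ∂ν₁ = δ₁ • x)
    {b : Fin 5 → ℝ} (hb : ∀ j, 0 ≤ b j) (η : ℝ) {s : State n d} (hs : s.hbar = avg s.h)
    {p : ℝ} (hp0 : 0 ≤ p) (hp1 : p ≤ 1) :
    0 ≤ p * stepBound F G xs b δ δ₁ η s s.x + (1 - p) * stepBound F G xs b δ δ₁ η s s.w ∧
    ∫⁻ z, ENNReal.ofReal (lyapunov F G xs b (ecStep Q Q₁ F η z s)) ∂(noiseLaw n m ν ν₁ p)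
      ≤ ENNReal.ofReal (p * stepBound F G xs b δ δ₁ η s s.x
        + (1 - p) * stepBound F G xs b δ δ₁ η s s.w) := by
  have hΦ : ∀ z : Noise n m S S₁, 0 ≤ lyapunov F G xs b (ecStep Q Q₁ F η z s) := fun z =>
    lyapunov_nonneg hF hμ hb _
  have hint := integral_lyapunov_step_le hF hQ hmean hQ₁ hmean₁ hb η hs
  have hcoin : ∀ u, ∫⁻ z, ENNReal.ofReal (lyapunov F G xs b (ecStep Q Q₁ F η (z, u) s))
      ∂(Measure.pi fun _ => nodeLaw m ν ν₁)
      ≤ ENNReal.ofReal (stepBound F G xs b δ δ₁ η s (if u = true then s.x else s.w)) := by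
    intro u
    rw [← ofReal_integral_eq_lintegral_ofReal (hint u).1
      (Filter.Eventually.of_forall fun z => hΦ (z, u))]
    exact ENNReal.ofReal_le_ofReal (hint u).2
  have hnn : ∀ u, 0 ≤ stepBound F G xs b δ δ₁ η s (if u = true then s.x else s.w) := fun u =>
    (integral_nonneg fun z => hΦ (z, u)).trans (hint u).2
  have ht := hnn true
  have hf := hnn false
  simp only [if_true, Bool.false_eq_true, if_false] at ht hf
  -- The inequality form of Tonelli's theorem needs no joint measurability; measurability for each
  -- value of the coin is enough afterwards.
  refine ⟨add_nonneg (mul_nonneg hp0 ht) (mul_nonneg (sub_nonneg.2 hp1) hf),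
    (lintegral_prod_le _).trans ?_⟩
  simp only [lintegral_add_measure, lintegral_smul_measure, lintegral_dirac, smul_eq_mul]
  rw [ENNReal.ofReal_add (by positivity) (mul_nonneg (by linarith) hf),
    ENNReal.ofReal_mul hp0, ENNReal.ofReal_mul (by linarith)]
  have hm : ∀ u, AEMeasurable
      (fun z => ENNReal.ofReal (lyapunov F G xs b (ecStep Q Q₁ F η (z, u) s)))
      (Measure.pi fun _ => nodeLaw m ν ν₁) := fun u =>
    (hint u).1.aestronglyMeasurable.aemeasurable.ennreal_ofReal
  change ∫⁻ z, _ ∂(Measure.pi fun _ => nodeLaw m ν ν₁) ≤ _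
  rw [lintegral_add_left' ((hm true).const_mul _), lintegral_const_mul'' _ (hm true),
    lintegral_const_mul'' _ (hm false)]
  have h1 := hcoin true
  have h2 := hcoin false
  simp only [if_true, Bool.false_eq_true, if_false] at h1 h2
  gcongr

end Step

/-! ### Decrease of the Lyapunov function in one iteration -/

section Young

variable {E : Type*} [NormedAddCommGroup E]

theorem norm_add_sq_le_young {s : ℝ} (hs : 0 < s) (a b : E) :
    ‖a + b‖ ^ 2 ≤ (1 + s) * ‖a‖ ^ 2 + (1 + 1 / s) * ‖b‖ ^ 2 := by
  have h1 : ‖a + b‖ ^ 2 ≤ (‖a‖ + ‖b‖) ^ 2 := by gcongr; exact norm_add_le a b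
  have h2 : 2 * ‖a‖ * ‖b‖ ≤ s * ‖a‖ ^ 2 + 1 / s * ‖b‖ ^ 2 := by
    have h3 : 0 ≤ (s * ‖a‖ - ‖b‖) ^ 2 / s := by positivity
    have h4 : (s * ‖a‖ - ‖b‖) ^ 2 / s = s * ‖a‖ ^ 2 + 1 / s * ‖b‖ ^ 2 - 2 * ‖a‖ * ‖b‖ := by
      field_simp
      ring
    linarith
  nlinarith

theorem norm_add_sq_le_two (a b : E) : ‖a + b‖ ^ 2 ≤ 2 * ‖a‖ ^ 2 + 2 * ‖b‖ ^ 2 := by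
  have := norm_add_sq_le_young one_pos a b
  norm_num at this
  linarith

theorem norm_sub_sq_le_two (a b : E) : ‖a - b‖ ^ 2 ≤ 2 * ‖a‖ ^ 2 + 2 * ‖b‖ ^ 2 := by
  have := norm_add_sq_le_two a (-b)
  rwa [← sub_eq_add_neg, norm_neg] at this

theorem norm_sub_sq_le_of_center (a b x : E) :
    ‖a - b‖ ^ 2 ≤ 2 * ‖a - x‖ ^ 2 + 2 * ‖b - x‖ ^ 2 := by
  have := norm_sub_sq_le_two (a - x) (b - x)
  rwa [sub_sub_sub_cancel_right] at this

variable [NormedSpace ℝ E]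

/-- The shift `u` occurs only when the coin shows `true`. Young's inequality is therefore needed
only on that event, and its parameter `δ / (2 * p)` makes the total expansion `p * (1 + δ / (2 * p))
+ (1 - p) = 1 + δ / 2`, independent of `p`. -/
theorem coin_norm_sq_le {p δ : ℝ} (hp : 0 < p) (hδ : 0 < δ) (v u : E) :
    p * ‖(1 - δ) • v + u‖ ^ 2 + (1 - p) * ‖(1 - δ) • v‖ ^ 2
      ≤ (1 + δ / 2) * (1 - δ) ^ 2 * ‖v‖ ^ 2 + p * (1 + 2 * p / δ) * ‖u‖ ^ 2 := by
  have h := mul_le_mul_of_nonneg_left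
    (norm_add_sq_le_young (s := δ / (2 * p)) (by positivity) ((1 - δ) • v) u) hp.le
  rw [norm_smul, mul_pow, Real.norm_eq_abs, sq_abs] at h ⊢
  have h1 : p * ((1 + δ / (2 * p)) * ((1 - δ) ^ 2 * ‖v‖ ^ 2)
      + (1 + 1 / (δ / (2 * p))) * ‖u‖ ^ 2)
      = (p + δ / 2) * ((1 - δ) ^ 2 * ‖v‖ ^ 2) + p * (1 + 2 * p / δ) * ‖u‖ ^ 2 := by
    field_simp
  rw [h1] at h
  linarith

theorem sum_norm_add_smul_sq_le_young {n : ℕ} {s : ℝ} (hs : 0 < s) (η : ℝ) (a b : Fin n → E) :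
    1 / (n : ℝ) ^ 2 * ∑ τ, ‖a τ + η • b τ‖ ^ 2
      ≤ (1 + s) * (1 / (n : ℝ) ^ 2 * ∑ τ, ‖a τ‖ ^ 2)
        + (1 + 1 / s) * η ^ 2 * (1 / (n : ℝ) ^ 2 * ∑ τ, ‖b τ‖ ^ 2) := by
  have h := Finset.sum_le_sum fun τ (_ : τ ∈ Finset.univ) => norm_add_sq_le_young hs (a τ) (η • b τ)
  simp only [norm_smul, mul_pow, Real.norm_eq_abs, sq_abs] at h
  rw [Finset.sum_add_distrib, ← Finset.mul_sum, ← Finset.mul_sum, ← Finset.mul_sum] at h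
  refine (mul_le_mul_of_nonneg_left h (by positivity)).trans_eq ?_
  ring

end Young

/-- The combination of the one-step inequalities for the parts of the Lyapunov function. -/
theorem combine_step {X E₁ E₂ H₁ H₂ A W δ δ₁ η M l B p μ ρ r t K b₀ b₁ b₂ b₃ b₄ : ℝ}
    (hX : 0 ≤ X) (hE₁ : 0 ≤ E₁) (hE₂ : 0 ≤ E₂) (hH₁ : 0 ≤ H₁) (hH₂ : 0 ≤ H₂) (hA : 0 ≤ A)
    (hW : 0 ≤ W) (hδ : 0 < δ) (hδ' : δ ≤ 1) (hM : 0 < M) (hl : 0 ≤ l)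
    (hB : 1 ≤ B) (ht : 0 ≤ t)
    (hK : K = 31920 * B ^ 2) (hb₀ : 0 ≤ b₀) (hb₁ : 0 ≤ b₁)
    (e0 : b₀ * δ = 10 * M * η) (e1 : b₁ = 8 * (1 - δ) * b₀) (er : r * δ = 1 - δ)
    (et : b₀ * r * η ^ 2 = 10 * t) (e2 : b₂ * δ₁ = 80 * t) (e3 : b₃ * δ₁ = 2400 * t)
    (hb₂ : 0 ≤ b₂) (hb₃ : 0 ≤ b₃) (hb₄ : 0 ≤ b₄)
    (e2p : b₂ * p ≤ 80 * t * B) (e3p : b₃ * p ≤ 2400 * t * B)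
    (e4 : b₄ * p = 2 * (K * t * (M + δ * l)) + 8 * η ^ 2 * l)
    (hsmall : 3 * (K * t * (M + δ * l)) + 8 * η ^ 2 * l ≤ η / 2)
    (hρμ : ρ ≤ η * μ / 2) (hρδ : ρ ≤ δ / 4) (hρδ₁ : ρ ≤ δ₁ / 4) (hρp : ρ ≤ p / 2) :
    ((1 - η * μ / 2) * X - η * A + 5 * η * M * E₁ + 4 * η ^ 2 * l * W)
      + b₀ * ((1 - δ) * E₁ + r * η ^ 2 * (2 * H₁ + 8 * M * (A + W)) + 2 * δ * (1 - δ) * E₂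
        + 2 * δ * (1 - δ) * η ^ 2 * (2 * H₂ + 8 * M * (A + W))
        + (1 - δ) * η ^ 2 * (4 * l * (A + W)))
      + b₁ * ((1 - δ / 2) * E₂ + 3 * r * η ^ 2 * (2 * H₂ + 8 * M * (A + W))
        + (1 - δ) * η ^ 2 * (4 * l * (A + W)))
      + b₂ * ((1 - δ₁ / 2) * H₁ + δ₁ * H₂ + p * (3 * B) * (4 * M * (A + W)))
      + b₃ * ((1 - δ₁ / 2) * H₂ + p * (3 * B) * (4 * M * (A + W)))
      + b₄ * ((1 - p) * W + p * A)
      ≤ (1 - ρ) * (X + b₀ * E₁ + b₁ * E₂ + b₂ * H₁ + b₃ * H₂ + b₄ * W) - η / 2 * A := by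
  set c := 1 - δ with hc
  have hc0 : 0 ≤ c := by linarith
  have hc1 : c ≤ 1 := by linarith
  have et' : b₀ * c * η ^ 2 = 10 * t * δ := by rw [← er, ← et]; ring
  -- coefficients
  have k1 : (1 - η * μ / 2) * X ≤ (1 - ρ) * X := by gcongr
  -- The weights form a cascade. `b₀` is such that the incoming `5 * η * M` is half of its decrease
  -- `b₀ * δ`; `b₁`, `b₂`, `b₃` are such that the terms fed into `E₂`, `H₁`, `H₂` use a quarter of
  -- `b₁ * δ`, `b₂ * δ₁`, `b₃ * δ₁`. For `H₂` these terms are at most `40 t + 480 t + 80 t = 600 t`,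
  -- hence `2400 t`. The rest of the decrease covers `ρ`.
  have k2 : (5 * η * M + b₀ * (1 - δ)) * E₁ ≤ ((1 - ρ) * b₀) * E₁ := by
    refine mul_le_mul_of_nonneg_right ?_ hE₁
    have h1 : ρ * b₀ ≤ δ / 4 * b₀ := by gcongr
    linarith only [h1, e0, mul_nonneg hb₀ hδ.le]
  have k3 : (b₀ * (2 * δ * c) + b₁ * (1 - δ / 2)) * E₂ ≤ ((1 - ρ) * b₁) * E₂ := by
    refine mul_le_mul_of_nonneg_right ?_ hE₂
    have h1 : ρ * b₁ ≤ δ / 4 * b₁ := by gcongr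
    have h2 : b₁ * δ = 8 * (b₀ * δ * c) := by rw [e1]; ring
    linarith only [h1, h2]
  have k4 : (2 * (b₀ * r * η ^ 2) + b₂ * (1 - δ₁ / 2)) * H₁ ≤ ((1 - ρ) * b₂) * H₁ := by
    refine mul_le_mul_of_nonneg_right ?_ hH₁
    have h1 : ρ * b₂ ≤ δ₁ / 4 * b₂ := by gcongr
    rw [et]
    linarith only [h1, e2]
  have hδ2 : δ * δ ≤ 1 := mul_le_one₀ hδ' hδ.le hδ'
  have h8 : b₁ * r * η ^ 2 = 80 * (c * t) := by
    rw [e1, show 8 * c * b₀ * r * η ^ 2 = 8 * c * (b₀ * r * η ^ 2) by ring, et]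
    ring
  have hct : c * t ≤ t := mul_le_of_le_one_left ht hc1
  have hdt : δ * δ * t ≤ t := mul_le_of_le_one_left ht hδ2
  have k5 : (b₀ * (4 * δ * c * η ^ 2) + 6 * (b₁ * r * η ^ 2) + b₂ * δ₁ + b₃ * (1 - δ₁ / 2)) * H₂
      ≤ ((1 - ρ) * b₃) * H₂ := by
    refine mul_le_mul_of_nonneg_right ?_ hH₂
    have h1 : ρ * b₃ ≤ δ₁ / 4 * b₃ := by gcongr
    have h2 : b₀ * (4 * δ * c * η ^ 2) = 40 * (δ * δ * t) := by
      rw [show b₀ * (4 * δ * c * η ^ 2) = 4 * δ * (b₀ * c * η ^ 2) by ring, et']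
      ring
    rw [h8, h2]
    linarith only [h1, e2, e3, hct, hdt]
  -- All feedback of the two gaps `A` and `W` caused by compression. The constant in `K` is the sum
  -- of the coefficients of `t * M`: `80 + 160 + 1920 + 960 + 28800 = 31920`, with `B ^ 2` as a
  -- common upper factor.
  have hZ : b₀ * (r * η ^ 2 * (8 * M) + 2 * δ * c * η ^ 2 * (8 * M) + c * η ^ 2 * (4 * l))
      + b₁ * (3 * r * η ^ 2 * (8 * M) + c * η ^ 2 * (4 * l))
      + b₂ * (p * (3 * B) * (4 * M)) + b₃ * (p * (3 * B) * (4 * M)) ≤ K * t * (M + δ * l) := by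
    have h1 : b₀ * (r * η ^ 2 * (8 * M)) = 80 * (t * M) := by
      rw [show b₀ * (r * η ^ 2 * (8 * M)) = 8 * M * (b₀ * r * η ^ 2) by ring, et]; ring
    have h2 : b₀ * (2 * δ * c * η ^ 2 * (8 * M)) = 160 * (δ * δ * t * M) := by
      rw [show b₀ * (2 * δ * c * η ^ 2 * (8 * M)) = 16 * δ * M * (b₀ * c * η ^ 2) by ring, et']; ring
    have h3 : b₀ * (c * η ^ 2 * (4 * l)) = 40 * (t * (δ * l)) := by
      rw [show b₀ * (c * η ^ 2 * (4 * l)) = 4 * l * (b₀ * c * η ^ 2) by ring, et']; ring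
    have h4 : b₁ * (3 * r * η ^ 2 * (8 * M)) = 1920 * (c * t * M) := by
      rw [show b₁ * (3 * r * η ^ 2 * (8 * M)) = 24 * M * (b₁ * r * η ^ 2) by ring, h8]; ring
    have h5 : b₁ * (c * η ^ 2 * (4 * l)) = 320 * (c * t * (δ * l)) := by
      rw [e1, show 8 * c * b₀ * (c * η ^ 2 * (4 * l)) = 32 * c * l * (b₀ * c * η ^ 2) by ring, et']
      ring
    have h6 : b₂ * (p * (3 * B) * (4 * M)) ≤ 960 * (B ^ 2 * (t * M)) := by
      have := mul_le_mul_of_nonneg_right e2p (show 0 ≤ 12 * B * M by positivity)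
      linarith only [this]
    have h7 : b₃ * (p * (3 * B) * (4 * M)) ≤ 28800 * (B ^ 2 * (t * M)) := by
      have := mul_le_mul_of_nonneg_right e3p (show 0 ≤ 12 * B * M by positivity)
      linarith only [this]
    have hB2 : 1 ≤ B ^ 2 := one_le_pow₀ hB
    have htM : 0 ≤ t * M := by positivity
    have htl : 0 ≤ t * (δ * l) := by positivity
    have m1 : δ * δ * t * M ≤ t * M := by gcongr
    have m2 : c * t * M ≤ t * M := by gcongr
    have m3 : c * t * (δ * l) ≤ t * (δ * l) := by gcongr
    have m4 : t * M ≤ B ^ 2 * (t * M) := le_mul_of_one_le_left htM hB2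
    have m5 : t * (δ * l) ≤ B ^ 2 * (t * (δ * l)) := le_mul_of_one_le_left htl hB2
    rw [hK]
    linarith only [h1, h2, h3, h4, h5, h6, h7, m1, m2, m3, m4, m5, htl]
  have k6 := mul_le_mul_of_nonneg_right hZ (add_nonneg hA hW)
  -- `b₄ * p` is twice the total coefficient of `W`, so half of the decrease of `W` pays for that
  -- coefficient and half for `ρ`. Each update of the checkpoint moves `b₄ * p` to `A`, where the
  -- gain `η` has to absorb it; this is the role of `hsmall`.
  have k7 : (-η + K * t * (M + δ * l) + b₄ * p) * A ≤ (-(η / 2)) * A := by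
    refine mul_le_mul_of_nonneg_right ?_ hA
    linarith only [e4, hsmall]
  have k8 : (4 * η ^ 2 * l + K * t * (M + δ * l) + b₄ * (1 - p)) * W ≤ ((1 - ρ) * b₄) * W := by
    refine mul_le_mul_of_nonneg_right ?_ hW
    have h1 : ρ * b₄ ≤ p / 2 * b₄ := by gcongr
    linarith only [h1, e4]
  linarith only [k1, k2, k3, k4, k5, k6, k7, k8]

/-- The one-step inequalities for the compression errors. -/
theorem error_parts_le {δ η E₁ E₂ H₁ H₂ Y Z N₁ N₂ U₁ U₂ V : ℝ} (hδ : 0 < δ) (hδ' : δ ≤ 1)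
    (hE₁0 : 0 ≤ E₁) (hE₂0 : 0 ≤ E₂) (hU₁0 : 0 ≤ U₁) (hU₂0 : 0 ≤ U₂)
    (hN₁ : N₁ ≤ (1 + δ) * E₁ + (1 + 1 / δ) * (η ^ 2 * U₁))
    (hN₂ : N₂ ≤ (1 + δ / 2) * E₂ + (1 + 1 / (δ / 2)) * η ^ 2 * U₂)
    (hN₂' : N₂ ≤ (1 + 1) * E₂ + (1 + 1 / 1) * η ^ 2 * U₂)
    (hU₁ : U₁ ≤ 2 * H₁ + Y) (hU₂ : U₂ ≤ 2 * H₂ + Y) (hV : V ≤ Z) :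
    (1 - δ) ^ 2 * N₁ + (1 - δ) * δ * N₂ + (1 - δ) * η ^ 2 * V
      ≤ (1 - δ) * E₁ + (1 - δ) / δ * η ^ 2 * (2 * H₁ + Y) + 2 * δ * (1 - δ) * E₂
        + 2 * δ * (1 - δ) * η ^ 2 * (2 * H₂ + Y)
        + (1 - δ) * η ^ 2 * (Z) ∧
    (1 - δ) * N₂ + (1 - δ) * η ^ 2 * V
      ≤ (1 - δ / 2) * E₂ + 3 * ((1 - δ) / δ) * η ^ 2 * (2 * H₂ + Y)
        + (1 - δ) * η ^ 2 * (Z) := by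
  have hc0 : 0 ≤ 1 - δ := sub_nonneg.2 hδ'
  have hVm := mul_le_mul_of_nonneg_left hV (mul_nonneg hc0 (sq_nonneg η))
  constructor
  · have q1 := mul_le_mul_of_nonneg_left hN₁ (sq_nonneg (1 - δ))
    have q2 := mul_le_mul_of_nonneg_left hN₂' (mul_nonneg hc0 hδ.le)
    have q3 : (1 - δ) ^ 2 * (1 + δ) * E₁ ≤ (1 - δ) * E₁ := by
      refine mul_le_mul_of_nonneg_right ?_ hE₁0
      nlinarith only [mul_nonneg hc0 (mul_nonneg hδ.le hδ.le)]
    have q4 : (1 - δ) ^ 2 * (1 + 1 / δ) ≤ (1 - δ) / δ := by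
      rw [le_div_iff₀ hδ]
      have : (1 - δ) ^ 2 * (1 + 1 / δ) * δ = (1 - δ) ^ 2 * (1 + δ) := by field_simp; ring
      rw [this]
      nlinarith only [mul_nonneg hc0 (mul_nonneg hδ.le hδ.le)]
    have q5 := mul_le_mul_of_nonneg_right q4 (mul_nonneg (sq_nonneg η) hU₁0)
    have q6 := mul_le_mul_of_nonneg_left hU₁
      (show 0 ≤ (1 - δ) / δ * η ^ 2 by positivity)
    have q7 := mul_le_mul_of_nonneg_left hU₂
      (show 0 ≤ 2 * δ * (1 - δ) * η ^ 2 by positivity)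
    norm_num at q2
    linarith only [q1, q2, q3, q5, q6, q7, hVm]
  · have q1 := mul_le_mul_of_nonneg_left hN₂ hc0
    have q3 : (1 - δ) * (1 + δ / 2) * E₂ ≤ (1 - δ / 2) * E₂ := by
      refine mul_le_mul_of_nonneg_right ?_ hE₂0
      nlinarith only [sq_nonneg δ]
    have q4 : (1 - δ) * (1 + 1 / (δ / 2)) ≤ 3 * ((1 - δ) / δ) := by
      rw [← mul_div_assoc, le_div_iff₀ hδ]
      have : (1 - δ) * (1 + 1 / (δ / 2)) * δ = (1 - δ) * (2 + δ) := by field_simp; ring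
      rw [this]
      nlinarith only [hδ, hδ', sq_nonneg δ]
    have q5 := mul_le_mul_of_nonneg_right q4 (mul_nonneg (sq_nonneg η) hU₂0)
    have q6 := mul_le_mul_of_nonneg_left hU₂
      (show 0 ≤ 3 * ((1 - δ) / δ) * η ^ 2 by positivity)
    linarith only [q1, q3, q5, q6, hVm]

/-! ### Contraction of the Lyapunov function for a finite-sum problem -/

section Step

variable {n m d : ℕ} [NeZero n] {F : Fin n → Fin m → Vec d → ℝ} {G : Vec d → ℝ} {xs : Vec d}
  {μ M L : ℝ}

theorem FiniteSumProblem.meanSq_le (hF : FiniteSumProblem F G xs μ M L) (x w : Vec d) :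
    meanSq (fun τ i => gradient (F τ i) x - gradient (F τ i) w)
      ≤ 4 * (L / n) * (G x - G xs + (G w - G xs)) := by
  have hn : (0 : ℝ) < n := by exact_mod_cast Nat.pos_of_ne_zero (NeZero.ne n)
  have h1 := hF.comp_le x
  have h2 := hF.comp_le w
  have h3 : (1 / (n : ℝ)) * ∑ τ, (1 / (m : ℝ)) * ∑ i,
      ‖gradient (F τ i) x - gradient (F τ i) w‖ ^ 2
      ≤ 2 * ((1 / (n : ℝ)) * ∑ τ, (1 / (m : ℝ)) * ∑ i,
        ‖gradient (F τ i) x - gradient (F τ i) xs‖ ^ 2)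
        + 2 * ((1 / (n : ℝ)) * ∑ τ, (1 / (m : ℝ)) * ∑ i,
        ‖gradient (F τ i) w - gradient (F τ i) xs‖ ^ 2) := by
    simp only [Finset.mul_sum]
    simp only [← Finset.sum_add_distrib]
    gcongr with τ _ i _
    have := mul_le_mul_of_nonneg_left (norm_sub_sq_le_of_center (gradient (F τ i) x)
      (gradient (F τ i) w) (gradient (F τ i) xs)) (show 0 ≤ 1 / (n : ℝ) * (1 / m) by positivity)
    linarith
  have h4 : meanSq (fun τ i => gradient (F τ i) x - gradient (F τ i) w)
      = 1 / n * ((1 / (n : ℝ)) * ∑ τ, (1 / (m : ℝ)) * ∑ i,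
        ‖gradient (F τ i) x - gradient (F τ i) w‖ ^ 2) := by
    rw [meanSq]
    field_simp
  rw [h4]
  calc _ ≤ 1 / (n : ℝ) * (2 * (2 * L * (G x - G xs)) + 2 * (2 * L * (G w - G xs))) := by
        gcongr
        linarith
    _ = _ := by field_simp; ring

omit [NeZero n] in
theorem FiniteSumProblem.grad_sub_le (hF : FiniteSumProblem F G xs μ M L) (x w : Vec d) :
    ‖gradient G x - gradient G w‖ ^ 2 ≤ 4 * M * (G x - G xs + (G w - G xs)) := by
  have h1 := hF.grad_le x
  have h2 := hF.grad_le w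
  have h3 := norm_sub_sq_le_two (gradient G x) (gradient G w)
  linarith

omit [NeZero n] in
theorem FiniteSumProblem.node_sub_le (hF : FiniteSumProblem F G xs μ M L) (x w : Vec d) :
    1 / (n : ℝ) ^ 2 * ∑ τ, ‖gradient (nodeAvg F τ) x - gradient (nodeAvg F τ) w‖ ^ 2
      ≤ 4 * M * (G x - G xs + (G w - G xs)) := by
  have h1 := hF.node_le x
  have h2 := hF.node_le w
  have h3 := Finset.sum_le_sum fun τ (_ : τ ∈ Finset.univ) => norm_sub_sq_le_of_center
    (gradient (nodeAvg F τ) x) (gradient (nodeAvg F τ) w) (gradient (nodeAvg F τ) xs)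
  rw [Finset.sum_add_distrib, ← Finset.mul_sum, ← Finset.mul_sum] at h3
  have h4 := mul_le_mul_of_nonneg_left h3 (show 0 ≤ 1 / (n : ℝ) ^ 2 by positivity)
  linarith

/-- The gradient is taken at `x` and not at the virtual iterate `x - e`. The mismatch `2 * η * ⟨g,
e⟩` is split by Young's inequality into half of `η` times the gap, using `‖g‖² ≤ 2 M (G x - G xs)`,
and `4 * η * M * ‖e‖²`. Of the gap coefficient `-2 * η`, this uses `η / 2`, and the terms quadratic
in `η` use another `η / 2` by the stepsize condition. -/
theorem FiniteSumProblem.dist_step_le (hF : FiniteSumProblem F G xs μ M L) (hμ : 0 ≤ μ)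
    (hμM : μ ≤ M) (hM : 0 < M) {η : ℝ} (hη : 0 ≤ η) (hη' : η * (2 * M + 4 * (L / n)) ≤ 1 / 2)
    (x w e : Vec d) :
    ‖x - e - xs - η • gradient G x‖ ^ 2
      + η ^ 2 * meanSq (fun τ i => gradient (F τ i) x - gradient (F τ i) w)
      ≤ (1 - η * μ / 2) * ‖x - e - xs‖ ^ 2 - η * (G x - G xs) + 5 * η * M * ‖e‖ ^ 2
        + 4 * η ^ 2 * (L / n) * (G w - G xs) := by
  have hV := mul_le_mul_of_nonneg_left (hF.meanSq_le x w) (sq_nonneg η)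
  have hA : 0 ≤ G x - G xs := le_trans (by positivity) (hF.growth x)
  set g := gradient G x with hg
  have h1 : ‖x - e - xs - η • g‖ ^ 2
      = ‖x - e - xs‖ ^ 2 - 2 * η * (inner ℝ g (x - xs) - inner ℝ g e) + η ^ 2 * ‖g‖ ^ 2 := by
    rw [norm_sub_sq_real, inner_smul_right, norm_smul, mul_pow, Real.norm_eq_abs, sq_abs,
      real_inner_comm, show x - e - xs = (x - xs) - e by abel, inner_sub_right]
    ring
  have h2 := hF.strong x
  have h3 := hF.grad_le x
  rw [← hg] at h2 h3
  have h4 : 2 * inner ℝ g e ≤ (G x - G xs) / 2 + 4 * M * ‖e‖ ^ 2 := by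
    have h5 := real_inner_le_norm g e
    have h6 : 2 * (‖g‖ * ‖e‖) ≤ ‖g‖ ^ 2 / (4 * M) + 4 * M * ‖e‖ ^ 2 := by
      have h7 : 0 ≤ (‖g‖ - 4 * M * ‖e‖) ^ 2 / (4 * M) := by positivity
      have h8 : (‖g‖ - 4 * M * ‖e‖) ^ 2 / (4 * M)
          = ‖g‖ ^ 2 / (4 * M) + 4 * M * ‖e‖ ^ 2 - 2 * (‖g‖ * ‖e‖) := by
        field_simp
        ring
      linarith
    have h9 : ‖g‖ ^ 2 / (4 * M) ≤ (G x - G xs) / 2 := by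
      rw [div_le_iff₀ (by positivity)]
      linarith
    linarith
  have h5 : ‖x - e - xs‖ ^ 2 ≤ 2 * ‖x - xs‖ ^ 2 + 2 * ‖e‖ ^ 2 := by
    rw [show x - e - xs = (x - xs) - e by abel]
    exact norm_sub_sq_le_two _ _
  have m1 := mul_le_mul_of_nonneg_left h2 hη
  have m2 := mul_le_mul_of_nonneg_left h4 hη
  have m3 := mul_le_mul_of_nonneg_left h3 (sq_nonneg η)
  have m4 := mul_le_mul_of_nonneg_left h5 (mul_nonneg hη hμ)
  have m5 := mul_le_mul_of_nonneg_left hη' (mul_nonneg hη hA)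
  have m6 : η * μ * ‖e‖ ^ 2 ≤ η * M * ‖e‖ ^ 2 := by gcongr
  rw [h1]
  linarith only [hV, m1, m2, m3, m4, m5, m6]

/-- The coefficients for which the Lyapunov function decreases. -/
def coeff (δ δ₁ η M l K p : ℝ) : Fin 5 → ℝ :=
  ![10 * (M * η / δ),
    80 * ((1 - δ) * M * η / δ),
    80 * ((1 - δ) * M * η ^ 3 / (δ ^ 2 * δ₁)),
    2400 * ((1 - δ) * M * η ^ 3 / (δ ^ 2 * δ₁)),
    1 / p * (2 * (K * ((1 - δ) * M * η ^ 3 / δ ^ 2) * (M + δ * l)) + 8 * η ^ 2 * l)]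

/-- Averages the one-step bounds over the coin and inserts them into `combine_step`. The negative
gap term is kept because the stopping rule also tests the gap at the current `x`, on which the
Lyapunov function has no direct hold. -/
theorem FiniteSumProblem.step_le (hF : FiniteSumProblem F G xs μ M L) (hμ : 0 ≤ μ)
    (hμM : μ ≤ M) (hM : 0 < M) (hL : 0 ≤ L) {δ δ₁ η p B K ρ : ℝ} (hδ : 0 < δ) (hδ' : δ ≤ 1)
    (hδ₁ : 0 < δ₁) (hδ₁' : δ₁ ≤ 1) (hη : 0 ≤ η) (hη' : η * (2 * M + 4 * (L / n)) ≤ 1 / 2)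
    (hB : 1 ≤ B) (hp : 0 < p) (hpB : p ≤ B * δ₁) (hK : K = 31920 * B ^ 2)
    (hsmall : 3 * (K * ((1 - δ) * M * η ^ 3 / δ ^ 2) * (M + δ * (L / n))) + 8 * η ^ 2 * (L / n)
      ≤ η / 2)
    (hρμ : ρ ≤ η * μ / 2) (hρδ : ρ ≤ δ / 4) (hρδ₁ : ρ ≤ δ₁ / 4) (hρp : ρ ≤ p / 2)
    (s : State n d) :
    p * stepBound F G xs (coeff δ δ₁ η M (L / n) K p) δ δ₁ η s s.x
      + (1 - p) * stepBound F G xs (coeff δ δ₁ η M (L / n) K p) δ δ₁ η s s.w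
      ≤ (1 - ρ) * lyapunov F G xs (coeff δ δ₁ η M (L / n) K p) s - η / 2 * (G s.x - G xs) := by
  have hn : (0 : ℝ) < n := by exact_mod_cast Nat.pos_of_ne_zero (NeZero.ne n)
  set l := L / (n : ℝ) with hldef
  have hl : 0 ≤ l := by positivity
  have hc0 : 0 ≤ 1 - δ := by linarith
  set t := (1 - δ) * M * η ^ 3 / δ ^ 2 with ht_def
  have ht : 0 ≤ t := by positivity
  have hA : 0 ≤ G s.x - G xs := le_trans (by positivity) (hF.growth s.x)
  have hW : 0 ≤ G s.w - G xs := le_trans (by positivity) (hF.growth s.w)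
  generalize hb : coeff δ δ₁ η M l K p = b
  have hn2 : 0 ≤ 1 / (n : ℝ) ^ 2 := by positivity
  have hsum : ∀ v : Fin n → Vec d, 0 ≤ 1 / (n : ℝ) ^ 2 * ∑ τ, ‖v τ‖ ^ 2 := fun v =>
    mul_nonneg hn2 (Finset.sum_nonneg fun τ _ => sq_nonneg _)
  have b0 : b 0 = 10 * (M * η / δ) := by rw [← hb]; rfl
  have b1 : b 1 = 80 * ((1 - δ) * M * η / δ) := by rw [← hb]; rfl
  have b2 : b 2 = 80 * ((1 - δ) * M * η ^ 3 / (δ ^ 2 * δ₁)) := by rw [← hb]; rfl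
  have b3 : b 3 = 2400 * ((1 - δ) * M * η ^ 3 / (δ ^ 2 * δ₁)) := by rw [← hb]; rfl
  have b4 : b 4 = 1 / p * (2 * (K * t * (M + δ * l)) + 8 * η ^ 2 * l) := by rw [← hb]; rfl
  have hKpos : 0 ≤ K := by rw [hK]; positivity
  have hb0 : 0 ≤ b 0 := by rw [b0]; positivity
  have hb1 : 0 ≤ b 1 := by rw [b1]; positivity
  have hb2 : 0 ≤ b 2 := by rw [b2]; positivity
  have hb3 : 0 ≤ b 3 := by rw [b3]; positivity
  have hb4 : 0 ≤ b 4 := by rw [b4]; positivity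
  have f2 : b 2 * δ₁ = 80 * t := by rw [b2, ht_def]; field_simp
  have f3 : b 3 * δ₁ = 2400 * t := by rw [b3, ht_def]; field_simp
  have main := combine_step (X := ‖s.x - avg s.e - xs‖ ^ 2) (E₁ := ‖avg s.e‖ ^ 2)
    (E₂ := (1 / (n : ℝ) ^ 2) * ∑ τ, ‖s.e τ‖ ^ 2)
    (H₁ := ‖s.hbar - gradient G s.w‖ ^ 2)
    (H₂ := (1 / (n : ℝ) ^ 2) * ∑ τ, ‖s.h τ - gradient (nodeAvg F τ) s.w‖ ^ 2)
    (A := G s.x - G xs) (W := G s.w - G xs) (δ := δ) (δ₁ := δ₁) (η := η) (M := M) (l := l)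
    (B := B) (p := p) (μ := μ) (ρ := ρ) (r := (1 - δ) / δ) (t := t) (K := K)
    (b₀ := b 0) (b₁ := b 1) (b₂ := b 2) (b₃ := b 3) (b₄ := b 4)
    (sq_nonneg _) (sq_nonneg _) (hsum _) (sq_nonneg _) (hsum _) hA hW hδ hδ'
    hM hl hB ht hK hb0 hb1 (by rw [b0]; field_simp) (by rw [b0, b1]; field_simp; ring)
    (by field_simp) (by rw [b0, ht_def]; field_simp) f2 f3 hb2 hb3 hb4
    (by rw [← f2, mul_assoc (b 2), mul_comm δ₁]; gcongr)
    (by rw [← f3, mul_assoc (b 3), mul_comm δ₁]; gcongr)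
    (by rw [b4]; field_simp) hsmall hρμ hρδ hρδ₁ hρp
  refine le_trans ?_ main
  have hS : 0 ≤ G s.x - G xs + (G s.w - G xs) := add_nonneg hA hW
  have pX := hF.dist_step_le hμ hμM hM hη hη' s.x s.w (avg s.e)
  have hV := hF.meanSq_le s.x s.w
  have hV0 := meanSq_nonneg fun τ i => gradient (F τ i) s.x - gradient (F τ i) s.w
  have hU₁ : ‖gradient G s.x - s.hbar‖ ^ 2
      ≤ 2 * ‖s.hbar - gradient G s.w‖ ^ 2 + 8 * M * (G s.x - G xs + (G s.w - G xs)) := by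
    have h1 := norm_sub_sq_le_of_center (gradient G s.x) s.hbar (gradient G s.w)
    have h2 := hF.grad_sub_le s.x s.w
    linarith only [h1, h2]
  have hU₂ : (1 / (n : ℝ) ^ 2) * ∑ τ, ‖gradient (nodeAvg F τ) s.x - s.h τ‖ ^ 2
      ≤ 2 * ((1 / (n : ℝ) ^ 2) * ∑ τ, ‖s.h τ - gradient (nodeAvg F τ) s.w‖ ^ 2)
        + 8 * M * (G s.x - G xs + (G s.w - G xs)) := by
    have h1 := Finset.sum_le_sum fun τ (_ : τ ∈ Finset.univ) => norm_sub_sq_le_of_center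
      (gradient (nodeAvg F τ) s.x) (s.h τ) (gradient (nodeAvg F τ) s.w)
    rw [Finset.sum_add_distrib, ← Finset.mul_sum, ← Finset.mul_sum] at h1
    have h2 := hF.node_sub_le s.x s.w
    have h3 := mul_le_mul_of_nonneg_left h1 hn2
    linarith only [h2, h3]
  have hN₁ := norm_add_sq_le_young hδ (avg s.e) (η • (gradient G s.x - s.hbar))
  rw [norm_smul, mul_pow, Real.norm_eq_abs, sq_abs] at hN₁
  have hN₂ := sum_norm_add_smul_sq_le_young (half_pos hδ) η s.e
    fun τ => gradient (nodeAvg F τ) s.x - s.h τ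
  have hN₂' := sum_norm_add_smul_sq_le_young one_pos η s.e
    fun τ => gradient (nodeAvg F τ) s.x - s.h τ
  have cH₁ := coin_norm_sq_le hp hδ₁ (s.hbar - gradient G s.w) (gradient G s.w - gradient G s.x)
  have cH₂ : p * (1 / (n : ℝ) ^ 2 * ∑ τ, ‖(1 - δ₁) • (s.h τ - gradient (nodeAvg F τ) s.w)
        + (gradient (nodeAvg F τ) s.w - gradient (nodeAvg F τ) s.x)‖ ^ 2)
      + (1 - p) * (1 / (n : ℝ) ^ 2
        * ∑ τ, ‖(1 - δ₁) • (s.h τ - gradient (nodeAvg F τ) s.w)‖ ^ 2)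
      ≤ (1 + δ₁ / 2) * (1 - δ₁) ^ 2
          * (1 / (n : ℝ) ^ 2 * ∑ τ, ‖s.h τ - gradient (nodeAvg F τ) s.w‖ ^ 2)
        + p * (1 + 2 * p / δ₁) * (1 / (n : ℝ) ^ 2
          * ∑ τ, ‖gradient (nodeAvg F τ) s.w - gradient (nodeAvg F τ) s.x‖ ^ 2) := by
    have h1 := Finset.sum_le_sum fun τ (_ : τ ∈ Finset.univ) => coin_norm_sq_le hp hδ₁
      (s.h τ - gradient (nodeAvg F τ) s.w) (gradient (nodeAvg F τ) s.w - gradient (nodeAvg F τ) s.x)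
    simp only [Finset.sum_add_distrib, ← Finset.mul_sum] at h1
    have h3 := mul_le_mul_of_nonneg_left h1 hn2
    linarith only [h3]
  -- This is where `p` must not exceed a multiple of `δ₁`: the checkpoint may not move faster than
  -- the vectors `h τ` can follow.
  have hpB' : p * (1 + 2 * p / δ₁) ≤ p * (3 * B) := by
    have : p / δ₁ ≤ B := by rwa [div_le_iff₀ hδ₁]
    refine mul_le_mul_of_nonneg_left ?_ hp.le
    rw [mul_div_assoc]
    linarith only [this, hB]
  have hG := hF.grad_sub_le s.w s.x
  have hNd := hF.node_sub_le s.w s.x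
  have hcoef₁ : (1 + δ₁ / 2) * (1 - δ₁) ^ 2 + δ₁ * (1 - δ₁) ≤ 1 - δ₁ / 2 := by
    have h1 := mul_nonneg hδ₁.le (sub_nonneg.2 hδ₁')
    have h2 := mul_nonneg h1 hδ₁.le
    nlinarith only [h1, h2, hδ₁]
  have hcoef₂ : (1 + δ₁ / 2) * (1 - δ₁) ^ 2 ≤ 1 - δ₁ / 2 := by
    have h1 := mul_nonneg hδ₁.le (sub_nonneg.2 hδ₁')
    have h2 := mul_nonneg h1 hδ₁.le
    nlinarith only [h1, h2, hδ₁]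
  have hcoef₃ : δ₁ * (1 - δ₁) ≤ δ₁ := by nlinarith only [sq_nonneg δ₁]
  have hE₁0 : 0 ≤ ‖avg s.e‖ ^ 2 := sq_nonneg _
  have hE₂0 : 0 ≤ (1 / (n : ℝ) ^ 2) * ∑ τ, ‖s.e τ‖ ^ 2 := hsum _
  have hH₁0 : 0 ≤ ‖s.hbar - gradient G s.w‖ ^ 2 := sq_nonneg _
  have hH₂0 : 0 ≤ (1 / (n : ℝ) ^ 2) * ∑ τ, ‖s.h τ - gradient (nodeAvg F τ) s.w‖ ^ 2 := hsum _
  have hU₁0 : 0 ≤ ‖gradient G s.x - s.hbar‖ ^ 2 := sq_nonneg _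
  have hU₂0 : 0 ≤ 1 / (n : ℝ) ^ 2 * ∑ τ, ‖gradient (nodeAvg F τ) s.x - s.h τ‖ ^ 2 := hsum _
  have hNd0 : 0 ≤ 1 / (n : ℝ) ^ 2
      * ∑ τ, ‖gradient (nodeAvg F τ) s.w - gradient (nodeAvg F τ) s.x‖ ^ 2 := hsum _
  have hpB0 : 0 ≤ p * (3 * B) := mul_nonneg hp.le (by linarith only [hB])
  set X := ‖s.x - avg s.e - xs‖ ^ 2
  set E₁ := ‖avg s.e‖ ^ 2 with hE₁
  set E₂ := (1 / (n : ℝ) ^ 2) * ∑ τ, ‖s.e τ‖ ^ 2 with hE₂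
  set H₁ := ‖s.hbar - gradient G s.w‖ ^ 2 with hH₁
  set H₂ := (1 / (n : ℝ) ^ 2) * ∑ τ, ‖s.h τ - gradient (nodeAvg F τ) s.w‖ ^ 2 with hH₂
  set A := G s.x - G xs
  set W := G s.w - G xs
  set V := meanSq fun τ i => gradient (F τ i) s.x - gradient (F τ i) s.w
  set N₁ := ‖avg s.e + η • (gradient G s.x - s.hbar)‖ ^ 2
  set N₂ := 1 / (n : ℝ) ^ 2 * ∑ τ, ‖s.e τ + η • (gradient (nodeAvg F τ) s.x - s.h τ)‖ ^ 2
  set U₁ := ‖gradient G s.x - s.hbar‖ ^ 2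
  set U₂ := 1 / (n : ℝ) ^ 2 * ∑ τ, ‖gradient (nodeAvg F τ) s.x - s.h τ‖ ^ 2
  obtain ⟨pE₁, pE₂⟩ := error_parts_le (η := η) (H₁ := H₁) (H₂ := H₂) (Y := 8 * M * (A + W))
    (Z := 4 * l * (A + W)) hδ hδ' hE₁0 hE₂0 hU₁0 hU₂0 hN₁ hN₂ hN₂' hU₁ hU₂ hV
  have pH₁ : p * ‖(1 - δ₁) • (s.hbar - gradient G s.w) + (gradient G s.w - gradient G s.x)‖ ^ 2
      + (1 - p) * ‖(1 - δ₁) • (s.hbar - gradient G s.w)‖ ^ 2 + δ₁ * (1 - δ₁) * H₂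
      ≤ (1 - δ₁ / 2) * H₁ + δ₁ * H₂ + p * (3 * B) * (4 * M * (A + W)) := by
    have q1 := mul_le_mul_of_nonneg_right hcoef₂ hH₁0
    have q2 := mul_le_mul_of_nonneg_right hcoef₃ hH₂0
    have q3 := mul_le_mul hpB' (hG.trans_eq (by ring : _ = 4 * M * (A + W))) (sq_nonneg _) hpB0
    linarith only [q1, q2, q3, cH₁]
  have pH₂ : p * (1 / (n : ℝ) ^ 2 * ∑ τ, ‖(1 - δ₁) • (s.h τ - gradient (nodeAvg F τ) s.w)
        + (gradient (nodeAvg F τ) s.w - gradient (nodeAvg F τ) s.x)‖ ^ 2)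
      + (1 - p) * (1 / (n : ℝ) ^ 2
        * ∑ τ, ‖(1 - δ₁) • (s.h τ - gradient (nodeAvg F τ) s.w)‖ ^ 2) + δ₁ * (1 - δ₁) * H₂
      ≤ (1 - δ₁ / 2) * H₂ + p * (3 * B) * (4 * M * (A + W)) := by
    have q1 := mul_le_mul_of_nonneg_right hcoef₁ hH₂0
    have q3 := mul_le_mul hpB' (hNd.trans_eq (by ring : _ = 4 * M * (A + W))) hNd0 hpB0
    linarith only [q1, q3, cH₂]
  have r1 := mul_le_mul_of_nonneg_left pE₁ hb0
  have r2 := mul_le_mul_of_nonneg_left pE₂ hb1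
  have r3 := mul_le_mul_of_nonneg_left pH₁ hb2
  have r4 := mul_le_mul_of_nonneg_left pH₂ hb3
  simp only [stepBound, sub_self, add_zero]
  linarith only [pX, r1, r2, r3, r4]

end Step

/-! ### First hitting times -/

theorem firstHit_eq_find {crit : ℕ → Prop} [DecidablePred fun K => 1 ≤ K ∧ crit K]
    (h : ∃ K, 1 ≤ K ∧ crit K) : firstHit crit = (Nat.find h : ℕ) := by
  refine le_antisymm (iInf₂_le (Nat.find h) (Nat.find_spec h)) (le_iInf₂ fun K hK => ?_)
  exact_mod_cast Nat.find_min' h hK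

theorem firstHit_eq_top {crit : ℕ → Prop} (h : ¬∃ K, 1 ≤ K ∧ crit K) : firstHit crit = ⊤ := by
  simp only [firstHit, iInf_eq_top]
  exact fun K hK => absurd ⟨K, hK⟩ h

theorem firstHit_toNat_spec {crit : ℕ → Prop} (h : firstHit crit ≠ ⊤) :
    crit (firstHit crit).toNat := by
  classical
  have h' : ∃ K, 1 ≤ K ∧ crit K := by
    by_contra h'
    exact h (firstHit_eq_top h')
  rw [firstHit_eq_find h', ENat.toNat_natCast]
  exact (Nat.find_spec h').2

/-- Every index before the first hit contributes `1`, including the index `0`, at which the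
criterion is not tested. If there is no hit, all terms are `1` and both sides are infinite. -/
theorem firstHit_le_tsum (crit : ℕ → Prop) [DecidablePred crit] :
    ((firstHit crit : ℕ∞) : ℝ≥0∞) ≤ ∑' K : ℕ, if 1 ≤ K → ¬crit K then 1 else 0 := by
  classical
  by_cases h : ∃ K, 1 ≤ K ∧ crit K
  · rw [firstHit_eq_find h]
    calc ((Nat.find h : ℕ∞) : ℝ≥0∞)
        = ∑ K ∈ Finset.range (Nat.find h), 1 := by simp
      _ ≤ ∑ K ∈ Finset.range (Nat.find h), if 1 ≤ K → ¬crit K then 1 else 0 := by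
          refine Finset.sum_le_sum fun K hK => ?_
          rw [if_pos]
          exact fun h1 h2 => Nat.find_min h (Finset.mem_range.1 hK) ⟨h1, h2⟩
      _ ≤ _ := ENNReal.sum_le_tsum _
  · have h1 : ∀ K : ℕ, (if 1 ≤ K → ¬crit K then (1 : ℝ≥0∞) else 0) = 1 := fun K =>
      if_pos fun h1 h2 => h ⟨K, h1, h2⟩
    simp only [h1]
    rw [ENNReal.tsum_const_eq_top_of_ne_zero one_ne_zero]
    exact le_top

/-- Hits are sought from index `1` on, so the value `0` of `toNat` can only stand for `⊤` and no
information is lost. -/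
theorem firstHit_toNat_eq_iff (crit : ℕ → Prop) (N : ℕ) : (firstHit crit).toNat = N ↔
    (1 ≤ N ∧ crit N ∧ ∀ j, j < N → 1 ≤ j → ¬crit j) ∨ (N = 0 ∧ ∀ j, 1 ≤ j → ¬crit j) := by
  classical
  by_cases h : ∃ K, 1 ≤ K ∧ crit K
  · rw [firstHit_eq_find h, ENat.toNat_natCast, Nat.find_eq_iff]
    constructor
    · rintro ⟨⟨h1, h2⟩, h3⟩
      exact Or.inl ⟨h1, h2, fun j hj h4 h5 => h3 j hj ⟨h4, h5⟩⟩
    · rintro (⟨h1, h2, h3⟩ | ⟨_, h2⟩)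
      · exact ⟨⟨h1, h2⟩, fun j hj h4 => h3 j hj h4.1 h4.2⟩
      · obtain ⟨K, hK⟩ := h
        exact absurd hK.2 (h2 K hK.1)
  · rw [firstHit_eq_top h, ENat.toNat_top]
    constructor
    · intro h0
      exact Or.inr ⟨h0.symm, fun j h1 h2 => h ⟨j, h1, h2⟩⟩
    · rintro (⟨h1, h2, _⟩ | ⟨h1, _⟩)
      · exact absurd ⟨N, h1, h2⟩ h
      · exact h1.symm

theorem measurable_firstHit_toNat {α : Type*} [MeasurableSpace α] {crit : α → ℕ → Prop}
    (h : ∀ K, Measurable fun a => crit a K) : Measurable fun a => (firstHit (crit a)).toNat := by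
  refine measurable_to_countable' fun N => ?_
  have : (fun a => (firstHit (crit a)).toNat) ⁻¹' {N} = {a |
      (1 ≤ N ∧ crit a N ∧ ∀ j, j < N → 1 ≤ j → ¬crit a j)
        ∨ (N = 0 ∧ ∀ j, 1 ≤ j → ¬crit a j)} := by
    ext a
    exact firstHit_toNat_eq_iff _ _
  rw [this]
  refine measurableSet_setOfPred.2 (Measurable.or ?_ ?_)
  · exact measurable_const.and ((h N).and (Measurable.forall fun j =>
      measurable_const.imp (measurable_const.imp (h j).not)))
  · exact measurable_const.and (Measurable.forall fun j => measurable_const.imp (h j).not)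

/-! ### Measurability of the iterates -/

section Measurability

variable {n m d : ℕ} {α : Type*} [MeasurableSpace α]

/-- The σ-algebra pulled back from the tuple of fields, for which the projections and the
constructor are measurable. -/
instance : MeasurableSpace (State n d) :=
  MeasurableSpace.comap (fun s => (s.x, s.w, s.e, s.h, s.hbar)) inferInstance

instance : MeasurableSpace (Config.Outer n d) :=
  MeasurableSpace.comap (fun o => (o.x, o.y, o.yPrev, o.e, o.h)) inferInstance

theorem State.measurable_tuple :
    Measurable fun s : State n d => (s.x, s.w, s.e, s.h, s.hbar) := comap_measurable _

theorem State.measurable_x : Measurable (State.x : State n d → _) :=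
  State.measurable_tuple.fst

theorem State.measurable_w : Measurable (State.w : State n d → _) :=
  State.measurable_tuple.snd.fst

theorem State.measurable_e : Measurable (State.e : State n d → _) :=
  State.measurable_tuple.snd.snd.fst

theorem State.measurable_h : Measurable (State.h : State n d → _) :=
  State.measurable_tuple.snd.snd.snd.fst

theorem State.measurable_hbar : Measurable (State.hbar : State n d → _) :=
  State.measurable_tuple.snd.snd.snd.snd

theorem State.measurable_mk {x w hbar : α → Vec d} {e h : α → Fin n → Vec d} (hx : Measurable x)
    (hw : Measurable w) (he : Measurable e) (hh : Measurable h) (hb : Measurable hbar) :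
    Measurable fun a => State.mk (x a) (w a) (e a) (h a) (hbar a) :=
  measurable_comap_iff.2 (hx.prodMk (hw.prodMk (he.prodMk (hh.prodMk hb))))

theorem Outer.measurable_tuple :
    Measurable fun o : Config.Outer n d => (o.x, o.y, o.yPrev, o.e, o.h) := comap_measurable _

theorem Outer.measurable_x : Measurable (Config.Outer.x : Config.Outer n d → _) :=
  Outer.measurable_tuple.fst

theorem Outer.measurable_y : Measurable (Config.Outer.y : Config.Outer n d → _) :=
  Outer.measurable_tuple.snd.fst

theorem Outer.measurable_yPrev : Measurable (Config.Outer.yPrev : Config.Outer n d → _) :=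
  Outer.measurable_tuple.snd.snd.fst

theorem Outer.measurable_e : Measurable (Config.Outer.e : Config.Outer n d → _) :=
  Outer.measurable_tuple.snd.snd.snd.fst

theorem Outer.measurable_h : Measurable (Config.Outer.h : Config.Outer n d → _) :=
  Outer.measurable_tuple.snd.snd.snd.snd

theorem Outer.measurable_mk {x y yPrev : α → Vec d} {e h : α → Fin n → Vec d} (hx : Measurable x)
    (hy : Measurable y) (hy' : Measurable yPrev) (he : Measurable e) (hh : Measurable h) :
    Measurable fun a => Config.Outer.mk (x a) (y a) (yPrev a) (e a) (h a) :=
  measurable_comap_iff.2 (hx.prodMk (hy.prodMk (hy'.prodMk (he.prodMk hh))))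

theorem measurable_avg {v : α → Fin n → Vec d} (hv : Measurable v) :
    Measurable fun a => avg (v a) := by
  unfold avg
  exact (Finset.measurable_fun_sum _ fun τ _ => measurable_pi_iff.1 hv τ).const_smul (1 / (n : ℝ))

theorem IsSmooth.continuous_gradient {L : ℝ} {f : Vec d → ℝ} (hf : IsSmooth L f) :
    Continuous (gradient f) :=
  (LipschitzWith.of_dist_le' fun x y => by
    rw [dist_eq_norm, dist_eq_norm]
    exact hf.2 x y).continuous

theorem measurable_index {β γ : Type*} [MeasurableSpace β] [MeasurableSpace γ]
    {g : Fin m → β → γ} (hg : ∀ i, Measurable (g i)) {i : α → Fin m} (hi : Measurable i)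
    {x : α → β} (hx : Measurable x) : Measurable fun a => g (i a) (x a) := by
  have h : Measurable fun z : Fin m × β => g z.1 z.2 :=
    measurable_from_prod_countable_right fun j => hg j
  exact h.comp (hi.prodMk hx)

theorem measurable_at_time {γ : Type*} [MeasurableSpace γ] {g : ℕ → α → γ}
    (hg : ∀ K, Measurable (g K)) {N : α → ℕ} (hN : Measurable N) :
    Measurable fun a => g (N a) a := by
  have h : Measurable fun z : ℕ × α => g z.1 z.2 :=
    measurable_from_prod_countable_right fun j => hg j
  exact h.comp (hN.prodMk measurable_id)

theorem LowerModel.growth {c : ℝ} {f : Vec d → ℝ}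
    (h : LowerModel c f (gradient f)) (hf : ∃ x, ∀ y, f x ≤ f y) (x : Vec d) :
    c / 2 * ‖x - argmin f‖ ^ 2 ≤ f x - f (argmin f) := by
  refine h.norm_sub_sq_le_of_eq_zero ?_ x
  -- Fermat's rule needs no differentiability here: where `f` is not differentiable, `fderiv` is
  -- zero by convention.
  have h := IsLocalMin.fderiv_eq_zero (Filter.Eventually.of_forall (argmin_spec hf) :
    IsLocalMin f (argmin f))
  simp [gradient, h]

namespace Config

variable [NeZero n] [NeZero m] {S S₁ : Type*} {D : Config n m d S S₁}

omit [NeZero n] [NeZero m] in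
theorem measurable_gradient_comp (hD : D.ObjectiveAssumption) {y x : α → Vec d} {τ : Fin n}
    {i : α → Fin m} (hy : Measurable y) (hx : Measurable x) (hi : Measurable i) :
    Measurable fun a => gradient (D.comp (y a) τ (i a)) (x a) := by
  simp only [gradient_comp hD]
  have h1 := measurable_index (g := fun i => gradient (D.f τ i))
    (fun i => (hD.smooth_comp τ i).continuous_gradient.measurable) hi hx
  have h2 := hD.smooth_reg.continuous_gradient.measurable.comp hx
  exact (h1.add h2).add ((hx.sub hy).const_smul D.κ)

omit [NeZero n] in
theorem measurable_gradient_nodeAvg_comp (hD : D.ObjectiveAssumption) {y x : α → Vec d}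
    {τ : Fin n} (hy : Measurable y) (hx : Measurable x) :
    Measurable fun a => gradient (nodeAvg (D.comp (y a)) τ) (x a) := by
  simp only [gradient_nodeAvg_comp_eq hD]
  have h1 := (hD.smooth_node τ).continuous_gradient.measurable.comp hx
  have h2 := hD.smooth_reg.continuous_gradient.measurable.comp hx
  exact (h1.add h2).add ((hx.sub hy).const_smul D.κ)

omit [NeZero n] in
theorem measurable_ecStep [MeasurableSpace S] [MeasurableSpace S₁] (hD : D.ObjectiveAssumption) (hQ : Measurable (Function.uncurry D.Q))
    (hQ₁ : Measurable (Function.uncurry D.Q₁)) {y : α → Vec d} {z : α → Noise n m S S₁}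
    {s : α → State n d} (hy : Measurable y) (hz : Measurable z) (hs : Measurable s) :
    Measurable fun a => ecStep D.Q D.Q₁ (D.comp (y a)) D.η (z a) (s a) := by
  have hsx := State.measurable_x.comp hs
  have hsw := State.measurable_w.comp hs
  have hse := fun τ => measurable_pi_iff.1 (State.measurable_e.comp hs) τ
  have hsh := fun τ => measurable_pi_iff.1 (State.measurable_h.comp hs) τ
  have hsb := State.measurable_hbar.comp hs
  have hzn := fun τ => measurable_pi_iff.1 hz.fst τ
  have hgw := fun τ => measurable_gradient_nodeAvg_comp hD (τ := τ) hy hsw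
  have hg : ∀ τ, Measurable fun a => gradient (D.comp (y a) τ ((z a).1 τ).1) (s a).x
      - gradient (D.comp (y a) τ ((z a).1 τ).1) (s a).w
      + gradient (nodeAvg (D.comp (y a)) τ) (s a).w - (s a).h τ := fun τ =>
    (((measurable_gradient_comp hD hy hsx (hzn τ).fst).sub
      (measurable_gradient_comp hD hy hsw (hzn τ).fst)).add (hgw τ)).sub (hsh τ)
  have hv := fun τ => ((hg τ).const_smul D.η).add (hse τ)
  have hyy := fun τ => hQ.comp ((hzn τ).snd.fst.prodMk (hv τ))
  have hzz := fun τ => hQ₁.comp ((hzn τ).snd.snd.prodMk ((hgw τ).sub (hsh τ)))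
  refine State.measurable_mk ?_ ?_ ?_ ?_ ?_
  · exact hsx.sub ((measurable_avg (measurable_pi_iff.2 hyy)).add (hsb.const_smul D.η))
  · exact Measurable.ite (hz.snd (measurableSet_singleton true)) hsx hsw
  · exact measurable_pi_iff.2 fun τ => ((hse τ).add ((hg τ).const_smul D.η)).sub (hyy τ)
  · exact measurable_pi_iff.2 fun τ => (hsh τ).add (hzz τ)
  · exact hsb.add (measurable_avg (measurable_pi_iff.2 hzz))

theorem growth_G (hD : D.ObjectiveAssumption) (hκ : 0 ≤ D.κ) (y x : Vec d) :
    (D.lam + D.κ) / 2 * ‖x - argmin (D.G y)‖ ^ 2 ≤ D.G y x - D.G y (argmin (D.G y)) :=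
  (lowerModel_G hD y).growth (exists_forall_G_le hD hκ y) x

theorem growth_P (hD : D.ObjectiveAssumption) (x : Vec d) :
    D.lam / 2 * ‖x - argmin D.P‖ ^ 2 ≤ D.P x - D.P (argmin D.P) :=
  (lowerModel_P hD).growth (exists_forall_P_le hD) x

/-- The proximal map is nonexpansive: adding the quadratic growth of both subproblems, each tested
at the other's minimizer, bounds `(λ + κ) ‖p - p'‖²` by `κ ⟨p - p', y - y'⟩`. Its purpose is
measurability of the minimizer in the prox-center. -/
theorem argmin_G_lipschitz (hD : D.ObjectiveAssumption) (hκ : 0 ≤ D.κ) :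
    LipschitzWith 1 fun y => argmin (D.G y) := by
  refine LipschitzWith.of_dist_le_mul fun y y' => ?_
  rw [dist_eq_norm, dist_eq_norm, NNReal.coe_one, one_mul]
  have key := growth_G hD hκ
  set p := argmin (D.G y)
  set p' := argmin (D.G y')
  have h1 := key y p'
  have h2 := key y' p
  rw [norm_sub_rev] at h1
  have h3 : D.G y p' - D.G y p + (D.G y' p - D.G y' p') = D.κ * Inner.inner ℝ (p - p') (y - y') := by
    simp only [G]
    have e1 := half_norm_sub_sq_eq D.κ y p p'
    have e2 := half_norm_sub_sq_eq D.κ y' p p'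
    rw [real_inner_smul_left] at e1 e2
    have e3 : Inner.inner ℝ (p - y') (p' - p) - Inner.inner ℝ (p - y) (p' - p)
        = - Inner.inner ℝ (p - p') (y - y') := by
      rw [← inner_sub_left, sub_sub_sub_cancel_left, ← neg_sub p p', inner_neg_right,
        real_inner_comm]
    linear_combination e1 - e2 - D.κ * e3
  have h4 := real_inner_le_norm (p - p') (y - y')
  have h5 := mul_le_mul_of_nonneg_left h4 hκ
  have hl := hD.lam_pos
  by_contra! h6
  have h7 : 0 < ‖p - p'‖ := (norm_nonneg _).trans_lt h6
  have h8 : D.κ * (‖p - p'‖ * ‖y - y'‖) ≤ D.κ * (‖p - p'‖ * ‖p - p'‖) := by gcongr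
  have h9 : 0 < D.lam * (‖p - p'‖ * ‖p - p'‖) := by positivity
  nlinarith

omit [NeZero n] [NeZero m] in
theorem measurable_G (hD : D.ObjectiveAssumption) {y x : α → Vec d} (hy : Measurable y)
    (hx : Measurable x) : Measurable fun a => D.G (y a) (x a) := by
  have h1 := (continuous_uncurry_G hD).measurable.comp (hy.prodMk hx)
  rw [Function.comp_def] at h1
  exact h1

theorem measurable_argmin_G (hD : D.ObjectiveAssumption) (hκ : 0 ≤ D.κ) {y : α → Vec d}
    (hy : Measurable y) : Measurable fun a => argmin (D.G (y a)) := by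
  have h1 := (argmin_G_lipschitz hD hκ).continuous.measurable.comp hy
  rw [Function.comp_def] at h1
  exact h1

theorem measurable_gap (hD : D.ObjectiveAssumption) (hκ : 0 ≤ D.κ)
    {y x : α → Vec d} (hy : Measurable y) (hx : Measurable x) :
    Measurable fun a => D.G (y a) (x a) - D.G (y a) (argmin (D.G (y a))) :=
  (measurable_G hD hy hx).sub (measurable_G hD hy (measurable_argmin_G hD hκ hy))

theorem measurable_lyapunov (hD : D.ObjectiveAssumption) (hκ : 0 ≤ D.κ) (b : Fin 5 → ℝ)
    {y : α → Vec d} {s : α → State n d} (hy : Measurable y) (hs : Measurable s) :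
    Measurable fun a => lyapunov (D.comp (y a)) (D.G (y a)) (argmin (D.G (y a))) b (s a) := by
  have hsx := State.measurable_x.comp hs
  have hsw := State.measurable_w.comp hs
  have hse := State.measurable_e.comp hs
  have hse' := fun τ => measurable_pi_iff.1 hse τ
  have hsh := fun τ => measurable_pi_iff.1 (State.measurable_h.comp hs) τ
  have hsb := State.measurable_hbar.comp hs
  have hgw := fun τ => measurable_gradient_nodeAvg_comp hD (τ := τ) hy hsw
  have harg := measurable_argmin_G hD hκ hy
  have hgG : Measurable fun a => gradient (D.G (y a)) (s a).w := by
    simp only [gradient_G hD]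
    exact measurable_avg (measurable_pi_iff.2 hgw)
  unfold lyapunov
  refine Measurable.add (Measurable.add (Measurable.add (Measurable.add (Measurable.add ?_ ?_) ?_)
    ?_) ?_) ?_
  · exact ((hsx.sub (measurable_avg hse)).sub harg).norm.pow_const 2
  · exact ((measurable_avg hse).norm.pow_const 2).const_mul _
  · exact ((Finset.measurable_fun_sum _ fun τ _ => (hse' τ).norm.pow_const 2).const_mul _).const_mul _
  · exact ((hsb.sub hgG).norm.pow_const 2).const_mul _
  · exact ((Finset.measurable_fun_sum _ fun τ _ =>
      ((hsh τ).sub (hgw τ)).norm.pow_const 2).const_mul _).const_mul _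
  · exact (measurable_gap hD hκ hy hsw).const_mul _

theorem Phi4_eq_lyapunov (hD : D.ObjectiveAssumption) (hκ : 0 ≤ D.κ) (y : Vec d)
    (s : State n d) : D.Phi4 y s = lyapunov (D.comp y) (D.G y) (argmin (D.G y)) D.a s := by
  rw [Phi4, lyapunov, iInf_G hD hκ]

omit [NeZero n] [NeZero m] in
theorem measurable_warmStart (k : ℕ) {o : α → Outer n d} (ho : Measurable o) :
    Measurable fun a => D.warmStart k (o a) := by
  have hx := Outer.measurable_x.comp ho
  have he := fun τ => measurable_pi_iff.1 (Outer.measurable_e.comp ho) τ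
  have hh := fun τ => measurable_pi_iff.1 (Outer.measurable_h.comp ho) τ
  have hyy := ((Outer.measurable_yPrev.comp ho).sub (Outer.measurable_y.comp ho)).const_smul D.κ
  have hh' : Measurable fun a => fun τ : Fin n =>
      if D.shiftH k = true then (o a).h τ + D.κ • ((o a).yPrev - (o a).y) else (o a).h τ := by
    refine measurable_pi_iff.2 fun τ => ?_
    by_cases h : D.shiftH k = true
    · simp only [h, if_true]
      exact (hh τ).add hyy
    · simp only [h]
      exact hh τ
  refine State.measurable_mk hx hx ?_ hh' (measurable_avg hh')
  refine measurable_pi_iff.2 fun τ => ?_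
  by_cases h : D.carryE k = true
  · simp only [h, if_true]
    exact he τ
  · simp only [h]
    exact measurable_const

omit [NeZero n] in
theorem measurable_inner [MeasurableSpace S] [MeasurableSpace S₁] (hD : D.ObjectiveAssumption) (hQ : Measurable (Function.uncurry D.Q))
    (hQ₁ : Measurable (Function.uncurry D.Q₁)) (k : ℕ) {o : α → Outer n d} (ho : Measurable o)
    {z : ℕ → α → Noise n m S S₁} (K : ℕ) (hz : ∀ i < K, Measurable (z i)) :
    Measurable fun a => D.inner k (o a) (fun i => z i a) K := by
  induction K with
  | zero => exact measurable_warmStart k ho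
  | succ K ih =>
    exact measurable_ecStep hD hQ hQ₁ (Outer.measurable_y.comp ho) (hz K K.lt_succ_self)
      (ih fun i hi => hz i (hi.trans K.lt_succ_self))

/-- The stopping criterion of outer iteration `k`. -/
def Stop (D : Config n m d S S₁) (k : ℕ) (y : Vec d) (s : State n d) : Prop :=
  D.Phi4 y s + (D.G y s.x - ⨅ x, D.G y x) ≤ D.eps k

theorem measurable_stop (hD : D.ObjectiveAssumption) (hκ : 0 ≤ D.κ) (k : ℕ) {y : α → Vec d}
    {s : α → State n d} (hy : Measurable y) (hs : Measurable s) :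
    Measurable fun a => D.Stop k (y a) (s a) := by
  simp only [Stop, Phi4_eq_lyapunov hD hκ, iInf_G hD hκ]
  exact measurableSet_setOfPred.1 (measurableSet_le ((measurable_lyapunov hD hκ D.a hy hs).add
    (measurable_gap hD hκ hy (State.measurable_x.comp hs))) measurable_const)

theorem measurable_outer [MeasurableSpace S] [MeasurableSpace S₁] (hD : D.ObjectiveAssumption) (hκ : 0 ≤ D.κ)
    (hQ : Measurable (Function.uncurry D.Q)) (hQ₁ : Measurable (Function.uncurry D.Q₁)) (k : ℕ)
    {ζ : ℕ × ℕ → α → Noise n m S S₁} (hζ : ∀ j, j.1 ≤ k → Measurable (ζ j)) :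
    Measurable fun a => D.outer (fun j => ζ j a) k := by
  induction k with
  | zero => exact measurable_const
  | succ k ih =>
    have ho := ih fun j hj => hζ j (hj.trans k.le_succ)
    have hin : ∀ K, Measurable fun a => D.inner (k + 1) (D.outer (fun j => ζ j a) k)
        (fun K => ζ (k + 1, K) a) K := fun K =>
      measurable_inner hD hQ hQ₁ (k + 1) ho K fun i _ => hζ _ le_rfl
    have hN : Measurable fun a => (D.count (k + 1) (D.outer (fun j => ζ j a) k)
        (fun K => ζ (k + 1, K) a)).toNat :=
      measurable_firstHit_toNat fun K => measurable_stop hD hκ (k + 1)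
        (Outer.measurable_y.comp ho) (hin K)
    have hs := measurable_at_time hin hN
    have hx := State.measurable_x.comp hs
    exact Outer.measurable_mk hx
      (hx.add ((hx.sub (Outer.measurable_x.comp ho)).const_smul (betaSucc D.q k)))
      (Outer.measurable_y.comp ho) (State.measurable_e.comp hs) (State.measurable_h.comp hs)

end Config

end Measurability

/-! ### Integration against fresh randomness -/

/-- If `X` depends only on the variables `ζ j` with `j ∈ J`, then `ζ i` with `i ∉ J` can be
integrated out first. -/
theorem lintegral_fresh {Ω ι N β : Type*} [mΩ : MeasurableSpace Ω] [mN : MeasurableSpace N]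
    [MeasurableSpace β] {μ : Measure Ω} [IsProbabilityMeasure μ] {ζ : ι → Ω → N}
    (hζ : ∀ j, Measurable (ζ j)) (hind : iIndepFun ζ μ) {J : Set ι} {i : ι} (hi : i ∉ J)
    {X : Ω → β} (hX : Measurable[⨆ j ∈ J, mN.comap (ζ j)] X) {f : N × β → ℝ≥0∞}
    (hf : Measurable f) :
    ∫⁻ ω, f (ζ i ω, X ω) ∂μ = ∫⁻ ω, ∫⁻ z, f (z, X ω) ∂(μ.map (ζ i)) ∂μ := by
  have hle : ∀ j, mN.comap (ζ j) ≤ mΩ := fun j => (hζ j).comap_le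
  have hXm : Measurable X := hX.mono (iSup₂_le fun j _ => hle j) le_rfl
  have h1 := indep_iSup_of_disjoint hle ((iIndepFun_iff_iIndep _ _ _).1 hind)
    (Set.disjoint_singleton_left.2 hi)
  rw [iSup_singleton] at h1
  have h2 : IndepFun (ζ i) X μ :=
    (IndepFun_iff_Indep _ _ _).2 (indep_of_indep_of_le_right h1 hX.comap_le)
  rw [indepFun_iff_map_prod_eq_prod_map_map (hζ i).aemeasurable hXm.aemeasurable] at h2
  have := Measure.isProbabilityMeasure_map (μ := μ) (hζ i).aemeasurable
  have := Measure.isProbabilityMeasure_map (μ := μ) hXm.aemeasurable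
  rw [← lintegral_map hf ((hζ i).prodMk hXm), h2, lintegral_prod_symm _ hf.aemeasurable,
    lintegral_map hf.lintegral_prod_left' hXm]

/-! ### Geometric decay -/

/-- The gain `a * v K` is a part of `u K`, because the sum on the left is at most `u K`; so it
decays at the same rate as `u`. -/
theorem geometric_decay {u v : ℕ → ℝ≥0∞} {a r : ℝ≥0∞} (h : ∀ K, u (K + 1) + a * v K ≤ r * u K)
    (hr : r ≤ 1) (K : ℕ) : u K ≤ r ^ K * u 0 ∧ a * v K ≤ r ^ K * u 0 := by
  have h1 : ∀ K, u K ≤ r ^ K * u 0 := by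
    intro K
    induction K with
    | zero => simp
    | succ K ih =>
      calc u (K + 1) ≤ r * u K := le_self_add.trans (h K)
        _ ≤ r * (r ^ K * u 0) := by gcongr
        _ = r ^ (K + 1) * u 0 := by rw [pow_succ']; ring
  refine ⟨h1 K, ?_⟩
  calc a * v K ≤ r * u K := le_add_self.trans (h K)
    _ ≤ 1 * u K := by gcongr
    _ = u K := one_mul _
    _ ≤ _ := h1 K

/-- The terms are bounded by `1` up to the index `K₀ = ⌈log N / ρ⌉`, where `N * (1 - ρ) ^ K₀ ≤ 1`,
and by a geometric series after it. -/
theorem tsum_min_geometric_le {N ρ : ℝ} (hN : 1 ≤ N) (hρ : 0 < ρ) (hρ' : ρ ≤ 1) {t : ℕ → ℝ≥0∞}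
    (h1 : ∀ K, t K ≤ 1) (h2 : ∀ K, t K ≤ ENNReal.ofReal (N * (1 - ρ) ^ K)) :
    ∑' K, t K ≤ ENNReal.ofReal (Real.log N / ρ + 1 / ρ + 1) := by
  have hlog := Real.log_nonneg hN
  obtain ⟨K₀, hK₀, hK₀'⟩ : ∃ K₀ : ℕ, Real.log N / ρ ≤ K₀ ∧ (K₀ : ℝ) ≤ Real.log N / ρ + 1 :=
    ⟨⌈Real.log N / ρ⌉₊, Nat.le_ceil _, (Nat.ceil_lt_add_one (div_nonneg hlog hρ.le)).le⟩
  have hN0 : 0 < N := one_pos.trans_le hN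
  have h1ρ : 0 ≤ 1 - ρ := sub_nonneg.2 hρ'
  have hdec : N * (1 - ρ) ^ K₀ ≤ 1 := by
    have e1 : 1 - ρ ≤ Real.exp (-ρ) := by linarith only [Real.add_one_le_exp (-ρ)]
    have e2 : Real.log N ≤ ρ * K₀ := by
      rwa [← div_le_iff₀' hρ]
    calc N * (1 - ρ) ^ K₀ ≤ N * Real.exp (-ρ) ^ K₀ := by gcongr
      _ = N * Real.exp (-(ρ * K₀)) := by rw [← Real.exp_nat_mul]; ring_nf
      _ ≤ N * Real.exp (-Real.log N) := by gcongr
      _ = 1 := by rw [Real.exp_neg, Real.exp_log hN0, mul_inv_cancel₀ hN0.ne']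
  have htail : ∀ K, t (K + K₀) ≤ ENNReal.ofReal (1 - ρ) ^ K := by
    intro K
    refine (h2 _).trans ?_
    rw [← ENNReal.ofReal_pow h1ρ]
    refine ENNReal.ofReal_le_ofReal ?_
    calc N * (1 - ρ) ^ (K + K₀) = (1 - ρ) ^ K * (N * (1 - ρ) ^ K₀) := by ring
      _ ≤ (1 - ρ) ^ K * 1 := by gcongr
      _ = _ := mul_one _
  have hhead : ∑ K ∈ Finset.range K₀, t K ≤ ENNReal.ofReal (Real.log N / ρ + 1) := by
    calc ∑ K ∈ Finset.range K₀, t K ≤ ∑ K ∈ Finset.range K₀, 1 := Finset.sum_le_sum fun K _ => h1 K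
      _ = ENNReal.ofReal K₀ := by simp
      _ ≤ _ := ENNReal.ofReal_le_ofReal hK₀'
  calc ∑' K, t K = ∑ K ∈ Finset.range K₀, t K + ∑' K, t (K + K₀) :=
        ((ENNReal.summable (f := fun K => t (K + K₀))).sum_add_tsum_nat_add' (f := t)).symm
    _ ≤ ENNReal.ofReal (Real.log N / ρ + 1) + ∑' K, ENNReal.ofReal (1 - ρ) ^ K :=
        add_le_add hhead (ENNReal.tsum_le_tsum htail)
    _ = ENNReal.ofReal (Real.log N / ρ + 1) + ENNReal.ofReal (1 / ρ) := by
        rw [ENNReal.tsum_geometric, ← ENNReal.ofReal_one, ← ENNReal.ofReal_sub _ h1ρ,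
          sub_sub_cancel, ← ENNReal.ofReal_inv_of_pos hρ, one_div]
    _ = _ := by
        rw [← ENNReal.ofReal_add (by positivity) (by positivity)]
        ring_nf

/-! ### The expected number of inner iterations -/

namespace Config

variable {n m d : ℕ} {S S₁ : Type*} {D : Config n m d S S₁}

theorem inner_hbar (k : ℕ) (o : Outer n d) (z : ℕ → Noise n m S S₁) (K : ℕ) :
    (D.inner k o z K).hbar = avg (D.inner k o z K).h := by
  induction K with
  | zero => rfl
  | succ K ih =>
    have h : (D.inner k o z (K + 1)) = ecStep D.Q D.Q₁ (D.comp o.y) D.η (z K) (D.inner k o z K) :=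
      rfl
    rw [h]
    simp only [ecStep, ih]
    exact (avg_add _ _).symm

/-- The Lyapunov function of the subproblem with prox-center `y`. -/
abbrev lyap (D : Config n m d S S₁) (b : Fin 5 → ℝ) (y : Vec d) (s : State n d) : ℝ :=
  lyapunov (D.comp y) (D.G y) (argmin (D.G y)) b s

/-- Suboptimality for the subproblem with prox-center `y`. -/
abbrev gap (D : Config n m d S S₁) (y x : Vec d) : ℝ := D.G y x - D.G y (argmin (D.G y))

variable [NeZero n] [NeZero m] [MeasurableSpace S] [MeasurableSpace S₁] {ν : Measure S}
  {ν₁ : Measure S₁} {Ω : Type*}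
  [mΩ : MeasurableSpace Ω] {μ : Measure Ω} [IsProbabilityMeasure μ]
  {ζ : ℕ × ℕ → Ω → Noise n m S S₁}

/-- The state at inner time `K` and the prox-center depend only on earlier randomness, so the noise
of the current iteration is integrated out first and the one-step bound applies pointwise. -/
theorem lintegral_lyap_succ_le (hD : D.ObjectiveAssumption) (hκ : 0 ≤ D.κ)
    (hQ : Measurable (Function.uncurry D.Q)) (hQ₁ : Measurable (Function.uncurry D.Q₁))
    (hζ : ∀ j, Measurable (ζ j)) (hlaw : ∀ j, μ.map (ζ j) = noiseLaw n m ν ν₁ D.p)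
    (hind : iIndepFun ζ μ) {b : Fin 5 → ℝ} {r : ℝ} {a : ℝ≥0∞}
    (hstep : ∀ (y : Vec d) (s : State n d), s.hbar = avg s.h →
      ∫⁻ z, ENNReal.ofReal (D.lyap b y (ecStep D.Q D.Q₁ (D.comp y) D.η z s))
        ∂noiseLaw n m ν ν₁ D.p + a * ENNReal.ofReal (D.gap y s.x)
          ≤ ENNReal.ofReal r * ENNReal.ofReal (D.lyap b y s)) (k K : ℕ)
    (o : Ω → Outer n d) (ho : o = fun ω => D.outer (fun j => ζ j ω) k)
    (s : ℕ → Ω → State n d)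
    (hs : s = fun K ω => D.inner (k + 1) (o ω) (fun i => ζ (k + 1, i) ω) K) :
    ∫⁻ ω, ENNReal.ofReal (D.lyap b (o ω).y (s (K + 1) ω)) ∂μ
        + a * ∫⁻ ω, ENNReal.ofReal (D.gap (o ω).y (s K ω).x) ∂μ
      ≤ ENNReal.ofReal r * ∫⁻ ω, ENNReal.ofReal (D.lyap b (o ω).y (s K ω)) ∂μ := by
  -- `J` indexes the past. The measurability theorems are applied below with the σ-algebra generated
  -- by these variables in place of the ambient one.
  let J : Set (ℕ × ℕ) := {j | j.1 ≤ k ∨ (j.1 = k + 1 ∧ j.2 < K)}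
  have hi : ((k + 1, K) : ℕ × ℕ) ∉ J := by simp [J]
  have hJ : ∀ j ∈ J, Measurable[⨆ j ∈ J, MeasurableSpace.comap (ζ j) inferInstance] (ζ j) :=
    fun j hj => (comap_measurable (ζ j)).mono
      (le_iSup₂_of_le (f := fun j (_ : j ∈ J) => MeasurableSpace.comap (ζ j) inferInstance)
        j hj le_rfl) le_rfl
  have hoJ : Measurable[⨆ j ∈ J, MeasurableSpace.comap (ζ j) inferInstance] o := by
    rw [ho]
    exact @measurable_outer n m d Ω (⨆ j ∈ J, MeasurableSpace.comap (ζ j) inferInstance) _ _ S S₁ D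
      _ _ hD hκ hQ hQ₁ k ζ fun j hj => hJ j (Or.inl hj)
  have hsJ : Measurable[⨆ j ∈ J, MeasurableSpace.comap (ζ j) inferInstance] (s K) := by
    rw [hs]
    exact @measurable_inner n m d Ω (⨆ j ∈ J, MeasurableSpace.comap (ζ j) inferInstance) _ S S₁ D
      _ _ hD hQ hQ₁ (k + 1) o hoJ (fun i => ζ (k + 1, i)) K
      fun i hi => hJ _ (Or.inr ⟨rfl, hi⟩)
  have hyJ : Measurable[⨆ j ∈ J, MeasurableSpace.comap (ζ j) inferInstance] fun ω => (o ω).y :=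
    Outer.measurable_y.comp hoJ
  have hle : (⨆ j ∈ J, MeasurableSpace.comap (ζ j) inferInstance) ≤ mΩ :=
    iSup₂_le fun j _ => (hζ j).comap_le
  have hy : Measurable fun ω => (o ω).y := hyJ.mono hle le_rfl
  have hsK : Measurable (s K) := hsJ.mono hle le_rfl
  let f : Noise n m S S₁ × (Vec d × State n d) → ℝ≥0∞ := fun w =>
    ENNReal.ofReal (D.lyap b w.2.1 (ecStep D.Q D.Q₁ (D.comp w.2.1) D.η w.1 w.2.2))
  have hf : Measurable f :=
    (measurable_lyapunov hD hκ b measurable_snd.fst (measurable_ecStep hD hQ hQ₁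
      measurable_snd.fst measurable_fst measurable_snd.snd)).ennreal_ofReal
  have hfresh := lintegral_fresh hζ hind hi (hyJ.prodMk hsJ) hf
  rw [hlaw] at hfresh
  have hlhs : ∀ ω, ENNReal.ofReal (D.lyap b (o ω).y (s (K + 1) ω))
      = f (ζ (k + 1, K) ω, ((o ω).y, s K ω)) := fun ω => by
    rw [hs]
    rfl
  have hgap : Measurable fun ω => ENNReal.ofReal (D.gap (o ω).y (s K ω).x) :=
    (measurable_gap hD hκ hy (State.measurable_x.comp hsK)).ennreal_ofReal
  have hlyap : Measurable fun ω => ENNReal.ofReal (D.lyap b (o ω).y (s K ω)) :=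
    (measurable_lyapunov hD hκ b hy hsK).ennreal_ofReal
  rw [lintegral_congr hlhs, hfresh, ← lintegral_const_mul _ hgap, ← lintegral_const_mul _ hlyap,
    ← lintegral_add_right _ (hgap.const_mul a)]
  refine lintegral_mono fun ω => hstep (o ω).y (s K ω) ?_
  rw [hs]
  exact inner_hbar _ _ _ _

/-- The expected number of inner iterations, in terms of the contraction factor of one iteration
and the size of the Lyapunov function at the start. -/
theorem lintegral_T_succ_le (hD : D.ObjectiveAssumption) (hκ : 0 ≤ D.κ)
    (hQ : Measurable (Function.uncurry D.Q)) (hQ₁ : Measurable (Function.uncurry D.Q₁))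
    (hζ : ∀ j, Measurable (ζ j)) (hlaw : ∀ j, μ.map (ζ j) = noiseLaw n m ν ν₁ D.p)
    (hind : iIndepFun ζ μ) {b : Fin 5 → ℝ} {ρ : ℝ} {r : ℝ} (hρ : 0 < ρ) (hρ' : ρ ≤ 1)
    (hr : 0 < r)
    (hstep : ∀ (y : Vec d) (s : State n d), s.hbar = avg s.h →
      ∫⁻ z, ENNReal.ofReal (D.lyap b y (ecStep D.Q D.Q₁ (D.comp y) D.η z s))
        ∂noiseLaw n m ν ν₁ D.p + ENNReal.ofReal r * ENNReal.ofReal (D.gap y s.x)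
          ≤ ENNReal.ofReal (1 - ρ) * ENNReal.ofReal (D.lyap b y s)) (k : ℕ) {R C N : ℝ}
    (hR : ∀ᵐ ω ∂μ, D.lyap b (D.outer (fun j => ζ j ω) k).y
      (D.warmStart (k + 1) (D.outer (fun j => ζ j ω) k)) ≤ R * D.eps (k + 1)) (hR0 : 0 ≤ R)
    (hε : 0 < D.eps (k + 1)) (hC : 0 ≤ C) (ha : ∀ y s, D.lyap D.a y s ≤ C * D.lyap b y s)
    (hN : 1 ≤ N) (hN' : (C + 1 / r) * R ≤ N) :
    ∫⁻ ω, ((D.T (fun j => ζ j ω) (k + 1) : ℕ∞) : ℝ≥0∞) ∂μ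
      ≤ ENNReal.ofReal (Real.log N / ρ + 1 / ρ + 1) := by
  classical
  set ε := D.eps (k + 1) with hεdef
  obtain ⟨o, ho⟩ : ∃ o : Ω → Outer n d, o = fun ω => D.outer (fun j => ζ j ω) k := ⟨_, rfl⟩
  obtain ⟨s, hs⟩ : ∃ s : ℕ → Ω → State n d,
    s = fun K ω => D.inner (k + 1) (o ω) (fun i => ζ (k + 1, i) ω) K := ⟨_, rfl⟩
  have hom : Measurable o := by
    rw [ho]
    exact measurable_outer hD hκ hQ hQ₁ k fun j _ => hζ j
  have hsm : ∀ K, Measurable (s K) := fun K => by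
    rw [hs]
    exact measurable_inner hD hQ hQ₁ (k + 1) hom K fun i _ => hζ _
  have hy : Measurable fun ω => (o ω).y := Outer.measurable_y.comp hom
  have hmet : ∀ K, MeasurableSet {ω | D.Stop (k + 1) (o ω).y (s K ω)} := fun K =>
    measurableSet_setOfPred.2 (measurable_stop hD hκ (k + 1) hy (hsm K))
  have hlyap : ∀ K, Measurable fun ω => ENNReal.ofReal (D.lyap b (o ω).y (s K ω)) := fun K =>
    (measurable_lyapunov hD hκ b hy (hsm K)).ennreal_ofReal
  have hgap : ∀ K, Measurable fun ω => ENNReal.ofReal (D.gap (o ω).y (s K ω).x) := fun K =>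
    (measurable_gap hD hκ hy (State.measurable_x.comp (hsm K))).ennreal_ofReal
  have hdecay := geometric_decay (u := fun K => ∫⁻ ω, ENNReal.ofReal (D.lyap b (o ω).y (s K ω)) ∂μ)
    (v := fun K => ∫⁻ ω, ENNReal.ofReal (D.gap (o ω).y (s K ω).x) ∂μ) (a := ENNReal.ofReal r)
    (r := ENNReal.ofReal (1 - ρ))
    (fun K => lintegral_lyap_succ_le hD hκ hQ hQ₁ hζ hlaw hind hstep k K o ho s hs)
    (by rw [← ENNReal.ofReal_one]; exact ENNReal.ofReal_le_ofReal (by linarith only [hρ]))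
  have hu0 : ∫⁻ ω, ENNReal.ofReal (D.lyap b (o ω).y (s 0 ω)) ∂μ ≤ ENNReal.ofReal (R * ε) := by
    calc ∫⁻ ω, ENNReal.ofReal (D.lyap b (o ω).y (s 0 ω)) ∂μ
        ≤ ∫⁻ _, ENNReal.ofReal (R * ε) ∂μ := by
          refine lintegral_mono_ae ?_
          filter_upwards [hR] with ω hω
          refine ENNReal.ofReal_le_ofReal ?_
          rw [hs, ho]
          exact hω
      _ = _ := by simp
  have h1ρ : 0 ≤ 1 - ρ := sub_nonneg.2 hρ'
  -- the probability that the criterion fails at iteration `K`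
  have hprob : ∀ K, ∫⁻ ω, (if ¬D.Stop (k + 1) (o ω).y (s K ω) then 1 else 0) ∂μ
      ≤ ENNReal.ofReal (N * (1 - ρ) ^ K) := by
    intro K
    -- Markov's inequality in pointwise form: if the criterion fails, `C * lyap b + gap` exceeds
    -- `ε`.
    have hpt : ∀ ω, (if ¬D.Stop (k + 1) (o ω).y (s K ω) then (1 : ℝ≥0∞) else 0)
        ≤ ENNReal.ofReal (C / ε) * ENNReal.ofReal (D.lyap b (o ω).y (s K ω))
          + ENNReal.ofReal (1 / ε) * ENNReal.ofReal (D.gap (o ω).y (s K ω).x) := by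
      intro ω
      split_ifs with h
      · exact zero_le
      · rw [← ENNReal.ofReal_mul (by positivity), ← ENNReal.ofReal_mul (by positivity)]
        refine le_trans ?_ ENNReal.ofReal_add_le
        rw [← ENNReal.ofReal_one]
        refine ENNReal.ofReal_le_ofReal ?_
        rw [Stop, not_le, Phi4_eq_lyapunov hD hκ, iInf_G hD hκ] at h
        have h2 := ha (o ω).y (s K ω)
        have h3 : C / ε * D.lyap b (o ω).y (s K ω) + 1 / ε * D.gap (o ω).y (s K ω).x
          = (C * D.lyap b (o ω).y (s K ω) + D.gap (o ω).y (s K ω).x) / ε := by ring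
        rw [h3, one_le_div hε]
        linarith only [h, h2]
    obtain ⟨hd1, hd2⟩ := hdecay K
    have hpow : ENNReal.ofReal (1 - ρ) ^ K * ∫⁻ ω, ENNReal.ofReal (D.lyap b (o ω).y (s 0 ω)) ∂μ
        ≤ ENNReal.ofReal ((1 - ρ) ^ K * (R * ε)) := by
      rw [ENNReal.ofReal_mul (by positivity), ENNReal.ofReal_pow h1ρ]
      gcongr
    have hd1' := hd1.trans hpow
    have hd2' := hd2.trans hpow
    have hd3 : ∫⁻ ω, ENNReal.ofReal (D.gap (o ω).y (s K ω).x) ∂μ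
        ≤ ENNReal.ofReal (1 / r * ((1 - ρ) ^ K * (R * ε))) := by
      rw [ENNReal.ofReal_mul (by positivity)]
      refine le_trans (le_of_eq ?_) (mul_le_mul_right hd2' _)
      rw [← mul_assoc, ← ENNReal.ofReal_mul (by positivity), one_div_mul_cancel hr.ne',
        ENNReal.ofReal_one, one_mul]
    calc ∫⁻ ω, (if ¬D.Stop (k + 1) (o ω).y (s K ω) then 1 else 0) ∂μ
        ≤ ∫⁻ ω, (ENNReal.ofReal (C / ε) * ENNReal.ofReal (D.lyap b (o ω).y (s K ω))
          + ENNReal.ofReal (1 / ε) * ENNReal.ofReal (D.gap (o ω).y (s K ω).x)) ∂μ :=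
          lintegral_mono hpt
      _ = ENNReal.ofReal (C / ε) * ∫⁻ ω, ENNReal.ofReal (D.lyap b (o ω).y (s K ω)) ∂μ
          + ENNReal.ofReal (1 / ε) * ∫⁻ ω, ENNReal.ofReal (D.gap (o ω).y (s K ω).x) ∂μ := by
          rw [lintegral_add_right _ ((hgap K).const_mul _), lintegral_const_mul _ (hlyap K),
            lintegral_const_mul _ (hgap K)]
      _ ≤ ENNReal.ofReal (C / ε) * ENNReal.ofReal ((1 - ρ) ^ K * (R * ε))
          + ENNReal.ofReal (1 / ε) * ENNReal.ofReal (1 / r * ((1 - ρ) ^ K * (R * ε))) := by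
          gcongr
      _ = ENNReal.ofReal ((C + 1 / r) * R * (1 - ρ) ^ K) := by
          rw [← ENNReal.ofReal_mul (by positivity), ← ENNReal.ofReal_mul (by positivity),
            ← ENNReal.ofReal_add (by positivity) (by positivity)]
          congr 1
          field_simp
      _ ≤ _ := ENNReal.ofReal_le_ofReal (by gcongr)
  have hT : ∀ ω, ((D.T (fun j => ζ j ω) (k + 1) : ℕ∞) : ℝ≥0∞)
      ≤ ∑' K : ℕ, if 1 ≤ K → ¬D.Stop (k + 1) (o ω).y (s K ω) then 1 else 0 := by
    intro ω
    have h := firstHit_le_tsum fun K => D.Stop (k + 1) (o ω).y (s K ω)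
    rw [hs, ho] at h ⊢
    exact h
  have hmeas : ∀ K : ℕ, Measurable fun ω =>
      if 1 ≤ K → ¬D.Stop (k + 1) (o ω).y (s K ω) then (1 : ℝ≥0∞) else 0 := by
    intro K
    refine Measurable.ite ?_ measurable_const measurable_const
    by_cases hK : 1 ≤ K
    · simp only [hK, true_imp_iff]
      exact (hmet K).compl
    · simp [hK]
  refine (lintegral_mono hT).trans ?_
  rw [lintegral_tsum fun K => (hmeas K).aemeasurable]
  refine tsum_min_geometric_le hN hρ hρ' (fun K => ?_) fun K => ?_
  · calc ∫⁻ ω, (if 1 ≤ K → ¬D.Stop (k + 1) (o ω).y (s K ω) then (1 : ℝ≥0∞) else 0) ∂μ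
        ≤ ∫⁻ _, 1 ∂μ := lintegral_mono fun ω => by split_ifs <;> simp
      _ = 1 := by simp
  · by_cases hK : 1 ≤ K
    · simp only [hK, true_imp_iff]
      exact hprob K
    -- At time `0` the criterion is not tested, the term equals `1`, and `1 ≤ N` suffices.
    · have hK0 : K = 0 := by omega
      subst hK0
      simp only [pow_zero, mul_one]
      calc ∫⁻ ω, (if 1 ≤ 0 → ¬D.Stop (k + 1) (o ω).y (s 0 ω) then (1 : ℝ≥0∞) else 0) ∂μ
          ≤ ∫⁻ _, 1 ∂μ := lintegral_mono fun ω => by split_ifs <;> simp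
        _ = ENNReal.ofReal 1 := by simp
        _ ≤ _ := ENNReal.ofReal_le_ofReal hN

omit [NeZero n] [NeZero m] [MeasurableSpace S] [MeasurableSpace S₁] in
theorem T_eq_top_iff (z : ℕ × ℕ → Noise n m S S₁) (k : ℕ) :
    D.T z k = ⊤ ↔ (D.T z k).toNat = 0 := by
  refine ⟨fun h => by rw [h, ENat.toNat_top], fun h => ?_⟩
  rcases (firstHit_toNat_eq_iff _ 0).1 h with h' | h'
  · exact absurd h'.1 (by norm_num)
  · exact firstHit_eq_top fun ⟨K, h1, h2⟩ => h'.2 K h1 h2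

omit [IsProbabilityMeasure μ] in
/-- If the expected number of inner iterations is finite, the inner loop stops almost surely. -/
theorem ae_T_ne_top (hD : D.ObjectiveAssumption) (hκ : 0 ≤ D.κ)
    (hQ : Measurable (Function.uncurry D.Q)) (hQ₁ : Measurable (Function.uncurry D.Q₁))
    (hζ : ∀ j, Measurable (ζ j)) (k : ℕ)
    (h : ∫⁻ ω, ((D.T (fun j => ζ j ω) (k + 1) : ℕ∞) : ℝ≥0∞) ∂μ ≠ ⊤) :
    ∀ᵐ ω ∂μ, D.T (fun j => ζ j ω) (k + 1) ≠ ⊤ := by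
  have ho := measurable_outer hD hκ hQ hQ₁ k fun j _ => hζ j
  have hN : Measurable fun ω => (D.T (fun j => ζ j ω) (k + 1)).toNat :=
    measurable_firstHit_toNat fun K => measurable_stop hD hκ (k + 1) (Outer.measurable_y.comp ho)
      (measurable_inner hD hQ hQ₁ (k + 1) ho K fun i _ => hζ _)
  have hT : Measurable fun ω => ((D.T (fun j => ζ j ω) (k + 1) : ℕ∞) : ℝ≥0∞) := by
    -- `T` is recovered from its `toNat`, whose value `0` encodes `⊤`, and so inherits
    -- measurability.
    have h1 : ∀ ω, ((D.T (fun j => ζ j ω) (k + 1) : ℕ∞) : ℝ≥0∞)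
        = (fun N : ℕ => if N = 0 then ⊤ else (N : ℝ≥0∞)) (D.T (fun j => ζ j ω) (k + 1)).toNat := by
      intro ω
      by_cases h0 : D.T (fun j => ζ j ω) (k + 1) = ⊤
      · simp [h0]
      · have h2 := (T_eq_top_iff _ _).not.1 h0
        simp only [h2, if_false]
        conv_lhs => rw [← ENat.natCast_toNat h0]
        simp
    rw [funext h1]
    exact (measurable_from_top (f := fun N : ℕ => if N = 0 then ⊤ else (N : ℝ≥0∞))).comp hN
  filter_upwards [ae_lt_top hT h] with ω hω h0
  simp [h0] at hω

end Config

/-! ### The Catalyst coefficients -/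

/-- `√q` is a fixed point of the recursion, so the extrapolation coefficient is constant. -/
theorem alpha_eq_sqrt {q : ℝ} (hq : 0 ≤ q) (k : ℕ) : alpha q k = √q := by
  induction k with
  | zero => rfl
  | succ k ih =>
    rw [alpha, ih, Real.sq_sqrt hq, sub_self, show (0 : ℝ) ^ 2 + 4 * q = 2 ^ 2 * q by ring,
      Real.sqrt_mul (by norm_num), Real.sqrt_sq (by norm_num)]
    ring

theorem betaSucc_eq {q : ℝ} (hq : 0 < q) (k : ℕ) : betaSucc q k = (1 - √q) / (1 + √q) := by
  have h := Real.sqrt_pos.2 hq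
  rw [betaSucc, alpha_eq_sqrt hq.le, alpha_eq_sqrt hq.le]
  rw [show √q ^ 2 + √q = √q * (1 + √q) by ring, mul_div_mul_left _ _ h.ne']

/-! ### One outer iteration -/

theorem LowerModel.le_convexComb {E : Type*} [NormedAddCommGroup E] [InnerProductSpace ℝ E]
    {f : E → ℝ} {g : E → E} {c θ : ℝ} (h : LowerModel c f g) (h0 : 0 ≤ θ) (h1 : θ ≤ 1)
    (a b : E) : f (θ • a + (1 - θ) • b)
      ≤ θ * f a + (1 - θ) * f b - c / 2 * (θ * (1 - θ)) * ‖a - b‖ ^ 2 := by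
  set z := θ • a + (1 - θ) • b with hz
  have e1 : a - z = (1 - θ) • (a - b) := by rw [hz]; module
  have e2 : b - z = (-θ) • (a - b) := by rw [hz]; module
  have h2 := h z a
  have h3 := h z b
  rw [e1, inner_smul_right, norm_smul, mul_pow, Real.norm_eq_abs, sq_abs] at h2
  rw [e2, inner_smul_right, norm_smul, mul_pow, Real.norm_eq_abs, sq_abs] at h3
  have h4 := mul_le_mul_of_nonneg_left h2 h0
  have h5 := mul_le_mul_of_nonneg_left h3 (sub_nonneg.2 h1)
  linear_combination h4 + h5

/-- The two sides differ by `θ * ‖a - b‖ ^ 2`. -/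
theorem norm_add_smul_sq_le {E : Type*} [NormedAddCommGroup E] [InnerProductSpace ℝ E] {θ : ℝ}
    (h0 : 0 ≤ θ) (a b : E) : ‖a + θ • b‖ ^ 2 ≤ (1 + θ) * (‖a‖ ^ 2 + θ * ‖b‖ ^ 2) := by
  have h1 : 0 ≤ θ * ‖a - b‖ ^ 2 := by positivity
  have h2 : ‖a + θ • b‖ ^ 2 = ‖a‖ ^ 2 + 2 * (θ * Inner.inner ℝ a b) + θ ^ 2 * ‖b‖ ^ 2 := by
    rw [norm_add_sq_real, inner_smul_right, norm_smul, mul_pow, Real.norm_eq_abs, sq_abs]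
  rw [norm_sub_sq_real] at h1
  linear_combination h1 + h2

namespace Config

variable {n m d : ℕ} [NeZero n] [NeZero m] {S S₁ : Type*} {D : Config n m d S S₁}

omit [NeZero n] [NeZero m] in
theorem sqrt_q_sq (hD : D.ObjectiveAssumption) (hκ : 0 ≤ D.κ) :
    0 < √D.q ∧ √D.q ≤ 1 ∧ √D.q ^ 2 * (D.lam + D.κ) = D.lam := by
  have hl := hD.lam_pos
  have hμ : 0 < D.lam + D.κ := by linarith only [hl, hκ]
  have hq : 0 < D.q := div_pos hl hμ
  refine ⟨Real.sqrt_pos.2 hq, Real.sqrt_le_one.2 ?_, ?_⟩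
  · exact (div_le_one hμ).2 (by linarith only [hκ])
  · rw [Real.sq_sqrt hq.le, q, div_mul_cancel₀ _ hμ.ne']

/-- The potential of Catalyst: suboptimality of `x` plus the squared distance of `v` to the
minimizer. -/
def potential (D : Config n m d S S₁) (x v : Vec d) : ℝ :=
  D.P x - D.P (argmin D.P) + D.lam / 2 * ‖v - argmin D.P‖ ^ 2

theorem gap_P_nonneg (hD : D.ObjectiveAssumption) (x : Vec d) :
    0 ≤ D.P x - D.P (argmin D.P) := sub_nonneg.2 (argmin_spec (exists_forall_P_le hD) x)

/-- One inexact accelerated proximal step. -/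
theorem potential_step (hD : D.ObjectiveAssumption) (hκ : 0 ≤ D.κ) {ε t : ℝ} {x v y x' v' : Vec d}
    (hy : (1 + √D.q) • y = x + √D.q • v) (hv' : √D.q • v' = x' - (1 - √D.q) • x)
    (hx' : D.gap y x' ≤ ε) (ht : 0 < t) :
    (1 - t) * D.potential x' v' ≤ (1 - √D.q) * D.potential x v + ε + ε / t := by
  obtain ⟨hθ, hθ1, hθμ⟩ := sqrt_q_sq hD hκ
  have hl := hD.lam_pos
  have hμ : 0 < D.lam + D.κ := by linarith only [hl, hκ]
  set θ := √D.q
  set μ := D.lam + D.κ with hμdef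
  set xs := argmin D.P with hxs
  set xh := argmin (D.G y) with hxh
  -- The comparison point. Since `x' = (1 - θ) x + θ v'`, the difference `z - x'` is `θ (xs - v')`,
  -- and `θ² (λ + κ) = λ` turns `(λ + κ) / 2 * ‖z - x'‖²` into the distance term of the new
  -- potential.
  set z := θ • xs + (1 - θ) • x with hz
  have h1 : D.P z ≤ θ * D.P xs + (1 - θ) * D.P x - D.lam / 2 * (θ * (1 - θ)) * ‖xs - x‖ ^ 2 :=
    (lowerModel_P hD).le_convexComb hθ.le hθ1 xs x
  have h2 : μ / 2 * ‖z - xh‖ ^ 2 ≤ D.G y z - D.G y xh := growth_G hD hκ y z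
  have h3 : μ / 2 * ‖x' - xh‖ ^ 2 ≤ ε := (growth_G hD hκ y x').trans hx'
  -- distances from `z`
  have e1 : z - x' = θ • (xs - v') := by
    rw [smul_sub, hv', hz]
    module
  have e2 : (1 + θ) • (z - y) = θ • ((xs - v) + θ • (xs - x)) := by
    rw [smul_sub, hy, hz]
    module
  have e3 : ‖z - x'‖ ^ 2 = θ ^ 2 * ‖v' - xs‖ ^ 2 := by
    rw [e1, norm_smul, mul_pow, Real.norm_eq_abs, sq_abs, norm_sub_rev]
  have e4 : (1 + θ) * ‖z - y‖ ^ 2 ≤ θ ^ 2 * (‖v - xs‖ ^ 2 + θ * ‖xs - x‖ ^ 2) := by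
    have h := congrArg (fun u => ‖u‖ ^ 2) e2
    simp only [norm_smul, mul_pow, Real.norm_eq_abs, sq_abs] at h
    have h' := norm_add_smul_sq_le hθ.le (xs - v) (xs - x)
    rw [norm_sub_rev xs v] at h'
    have h'' := mul_le_mul_of_nonneg_left h' (sq_nonneg θ)
    refine le_of_mul_le_mul_left (a := 1 + θ) ?_ (by linarith only [hθ])
    linear_combination h'' + h
  -- the proximal term at `z`
  have h4 : D.κ / 2 * ‖z - y‖ ^ 2
      ≤ D.lam / 2 * (1 - θ) * (‖v - xs‖ ^ 2 + θ * ‖xs - x‖ ^ 2) := by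
    -- Equivalent to `θ² = λ / (λ + κ)`. With it the proximal cost at `z` is `1 - θ` times the old
    -- distance term, plus a multiple of `‖xs - x‖²` that the strong convexity gain in `h1` cancels
    -- exactly.
    have hk : D.κ * θ ^ 2 = D.lam * (1 - θ) * (1 + θ) := by
      linear_combination hθμ - θ ^ 2 * hμdef
    have h := mul_le_mul_of_nonneg_left e4 (div_nonneg hκ zero_le_two)
    refine le_of_mul_le_mul_left (a := 1 + θ) ?_ (by linarith only [hθ])
    linear_combination h + (‖v - xs‖ ^ 2 + θ * ‖xs - x‖ ^ 2) / 2 * hk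
  -- inexactness
  have h5 : D.lam / 2 * ‖v' - xs‖ ^ 2 * (1 - t) - ε / t
      ≤ μ / 2 * ‖z - xh‖ ^ 2 := by
    -- The exact minimizer `xh` is replaced by the computed point `x'`. Young's inequality with
    -- weight `t` loses the fraction `t` of the new distance and at most `ε / t`.
    have h6 : ‖z - x'‖ ^ 2 * (1 - t) + ‖x' - xh‖ ^ 2 * (1 - 1 / t) ≤ ‖z - xh‖ ^ 2 := by
      have h7 : z - xh = (z - x') + (x' - xh) := by abel
      have h8 : 0 ≤ ‖t • (z - x') + (x' - xh)‖ ^ 2 / t := by positivity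
      rw [norm_add_sq_real, inner_smul_left, norm_smul, mul_pow, Real.norm_eq_abs, sq_abs] at h8
      rw [h7, norm_add_sq_real]
      simp only [conj_trivial] at h8
      have h9 : (t ^ 2 * ‖z - x'‖ ^ 2 + 2 * (t * Inner.inner ℝ (z - x') (x' - xh))
          + ‖x' - xh‖ ^ 2) / t = t * ‖z - x'‖ ^ 2 + 2 * Inner.inner ℝ (z - x') (x' - xh)
            + ‖x' - xh‖ ^ 2 * (1 / t) := by
        field_simp
      rw [h9] at h8
      linear_combination h8
    have h10 := mul_le_mul_of_nonneg_left h6 (half_pos hμ).le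
    have h11 : 0 ≤ (ε - μ / 2 * ‖x' - xh‖ ^ 2) / t := div_nonneg (sub_nonneg.2 h3) ht.le
    have h12 : 0 ≤ μ / 2 * ‖x' - xh‖ ^ 2 := by positivity
    rw [e3] at h10
    linear_combination h10 + h11 + h12 - ‖v' - xs‖ ^ 2 * (1 - t) / 2 * hθμ
  have h6 : D.P x' ≤ D.G y x' := le_add_of_nonneg_right (by positivity)
  have h7 : 0 ≤ t * (D.P x' - D.P xs) := mul_nonneg ht.le (gap_P_nonneg hD x')
  have h8 : D.G y z = D.P z + D.κ / 2 * ‖z - y‖ ^ 2 := rfl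
  have h9 : D.G y x' - D.G y xh ≤ ε := hx'
  rw [norm_sub_rev xs x] at h1 h4
  simp only [potential, ← hxs]
  linear_combination h1 + h2 + h4 + h5 + h6 + h7 + h9 + h8

/-- The auxiliary sequence `v` of Catalyst, for iterates `X`. -/
def auxSeq (D : Config n m d S S₁) (X : ℕ → Vec d) : ℕ → Vec d
  | 0 => X 0
  | k + 1 => (1 / √D.q) • (X (k + 1) - (1 - √D.q) • X k)

omit [NeZero n] [NeZero m] in
-- The momentum step of Catalyst, rewritten as a weighted average of `x` and the auxiliary point
-- `v`, which is the form used by `potential_step`.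
theorem smul_extrapolation (hD : D.ObjectiveAssumption) (hκ : 0 ≤ D.κ) {X Y : ℕ → Vec d}
    (h0 : Y 0 = X 0)
    (hY : ∀ k, Y (k + 1) = X (k + 1) + betaSucc D.q k • (X (k + 1) - X k)) (k : ℕ) :
    (1 + √D.q) • Y k = X k + √D.q • D.auxSeq X k := by
  obtain ⟨hθ, _, _⟩ := sqrt_q_sq hD hκ
  cases k with
  | zero =>
    rw [h0, auxSeq]
    module
  | succ k =>
    have hq : 0 < D.q := Real.sqrt_pos.1 hθ
    have h1 : (1 + √D.q) ≠ 0 := by positivity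
    rw [hY, betaSucc_eq hq, auxSeq, smul_smul, mul_one_div_cancel hθ.ne', smul_add, smul_smul,
      mul_div_cancel₀ _ h1]
    module

/-- The linear convergence of the potential, if the subproblems are solved with accuracy `eps`. -/
theorem potential_le (hD : D.ObjectiveAssumption) (hκ : 0 ≤ D.κ) (hρ0 : 0 ≤ D.ρ₀)
    (hρ : D.ρ₀ < √D.q) {X Y : ℕ → Vec d} (hX0 : X 0 = D.x₀) (h0 : Y 0 = X 0)
    (hY : ∀ k, Y (k + 1) = X (k + 1) + betaSucc D.q k • (X (k + 1) - X k)) (k : ℕ)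
    (hgap : ∀ j < k, D.gap (Y j) (X (j + 1)) ≤ D.eps (j + 1)) :
    D.potential (X k) (D.auxSeq X k)
      ≤ 8 / (√D.q - D.ρ₀) ^ 2 * (D.P D.x₀ - ⨅ x, D.P x) * (1 - D.ρ₀) ^ k := by
  obtain ⟨hθ, hθ1, _⟩ := sqrt_q_sq hD hκ
  rw [iInf_P hD]
  set Δ := D.P D.x₀ - D.P (argmin D.P) with hΔdef
  have hΔ : 0 ≤ Δ := gap_P_nonneg hD _
  -- The slack `√q - ρ₀` is halved. One half, `g`, is the Young weight `t`; the other pays for the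
  -- inexactness terms.
  obtain ⟨g, hg⟩ : ∃ g, g = (√D.q - D.ρ₀) / 2 := ⟨_, rfl⟩
  have hg0 : 0 < g := by rw [hg]; linarith only [hρ]
  have hg1 : g ≤ 1 / 2 := by rw [hg]; linarith only [hρ0, hθ1]
  have hA : 8 / (√D.q - D.ρ₀) ^ 2 = 2 / g ^ 2 := by
    rw [hg]
    have : √D.q - D.ρ₀ ≠ 0 := (sub_pos.2 hρ).ne'
    field_simp
    norm_num
  rw [hA]
  have hA2 : 2 ≤ 2 / g ^ 2 := by
    rw [le_div_iff₀ (by positivity)]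
    nlinarith only [hg0, hg1]
  have hr : 0 < 1 - D.ρ₀ := by linarith only [hρ, hθ1]
  induction k with
  | zero =>
    have h1 : D.lam / 2 * ‖X 0 - argmin D.P‖ ^ 2 ≤ Δ := by
      rw [hX0]
      exact growth_P hD _
    have h2 : D.potential (X 0) (D.auxSeq X 0) ≤ 2 * Δ := by
      rw [potential, auxSeq, hX0] at *
      linarith only [h1, hΔdef]
    rw [pow_zero, mul_one]
    exact h2.trans (mul_le_mul_of_nonneg_right hA2 hΔ)
  | succ k ih =>
    have ih' := ih fun j hj => hgap j (hj.trans k.lt_succ_self)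
    have hv : √D.q • D.auxSeq X (k + 1) = X (k + 1) - (1 - √D.q) • X k := by
      rw [auxSeq, smul_smul, mul_one_div_cancel hθ.ne', one_smul]
    have hstep := potential_step hD hκ (smul_extrapolation hD hκ h0 hY k) hv
      (hgap k k.lt_succ_self) hg0
    set S := D.potential (X k) (D.auxSeq X k)
    set S' := D.potential (X (k + 1)) (D.auxSeq X (k + 1))
    obtain ⟨e, he⟩ : ∃ e, e = Δ * (1 - D.ρ₀) ^ k := ⟨_, rfl⟩
    have he0 : 0 ≤ e := by rw [he]; positivity
    have heps : D.eps (k + 1) = 2 / 9 * (e * (1 - D.ρ₀)) := by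
      rw [eps, iInf_P hD, he, pow_succ]
      ring
    have h1 : S ≤ 2 / g ^ 2 * e := by
      rw [he]
      linarith only [ih']
    have h2 : (1 - √D.q) * S ≤ (1 - √D.q) * (2 / g ^ 2 * e) :=
      mul_le_mul_of_nonneg_left h1 (sub_nonneg.2 hθ1)
    rw [heps] at hstep
    have h3 : 2 / g ^ 2 * Δ * (1 - D.ρ₀) ^ (k + 1) = 2 / g ^ 2 * (e * (1 - D.ρ₀)) := by
      rw [he, pow_succ]
      ring
    rw [h3]
    set r := 1 - D.ρ₀ with hrdef
    have h4 : 1 - √D.q = r - 2 * g := by rw [hg, hrdef]; ring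
    have hr1 : r ≤ 1 := by linarith only [hρ0, hrdef]
    refine le_of_mul_le_mul_left (a := 1 - g) ?_ (by linarith only [hg1])
    -- With `A = 2 / g²`, the old potential contributes at most `(1 - 2 g) A e r`, and `ε + ε / g`
    -- is at most `g A e r` by `h6`. The sum is `(1 - g) A e r`, and the factor `1 - g` cancels.
    have h5 : (r - 2 * g) * (2 / g ^ 2 * e) ≤ (1 - 2 * g) * (2 / g ^ 2 * (e * r)) := by
      have : 0 ≤ 2 * g * (1 - r) * (2 / g ^ 2 * e) := by
        have := sub_nonneg.2 hr1
        positivity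
      linarith only [this]
    have h6 : 2 / 9 * (e * r) + 2 / 9 * (e * r) / g ≤ g * (2 / g ^ 2 * (e * r)) := by
      have e1 : g * (2 / g ^ 2 * (e * r)) = 2 * (e * r) / g := by field_simp
      have e2 : e * r ≤ e * r / g := by
        rw [le_div_iff₀ hg0]
        have : 0 ≤ e * r := by positivity
        nlinarith only [this, hg1]
      have e3 : 0 ≤ e * r / g := by positivity
      rw [e1]
      have e4 : 2 / 9 * (e * r) / g = 2 / 9 * (e * r / g) := by ring
      have e5 : 2 * (e * r) / g = 2 * (e * r / g) := by ring
      rw [e4, e5]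
      linarith only [e2, e3]
    rw [h4] at h2 hstep
    linarith only [hstep, h2, h5, h6]

/-- Bounds on the iterates in terms of the potential. -/
theorem dist_le_potential (hD : D.ObjectiveAssumption) (hκ : 0 ≤ D.κ) {x v y : Vec d}
    (hy : (1 + √D.q) • y = x + √D.q • v) :
    D.P x - D.P (argmin D.P) ≤ D.potential x v
      ∧ D.lam / 2 * ‖x - argmin D.P‖ ^ 2 ≤ D.potential x v
      ∧ D.lam / 2 * ‖y - argmin D.P‖ ^ 2 ≤ D.potential x v := by
  obtain ⟨hθ, _, _⟩ := sqrt_q_sq hD hκ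
  have hl := hD.lam_pos
  have h0 := gap_P_nonneg hD x
  have h1 := growth_P hD x
  set xs := argmin D.P with hxs
  have h2 : 0 ≤ D.lam / 2 * ‖v - xs‖ ^ 2 := by positivity
  have h3 : D.potential x v = D.P x - D.P xs + D.lam / 2 * ‖v - xs‖ ^ 2 := rfl
  set θ := √D.q
  have h4 : (1 + θ) * ‖y - xs‖ ^ 2 ≤ ‖x - xs‖ ^ 2 + θ * ‖v - xs‖ ^ 2 := by
    have e1 : (1 + θ) • (y - xs) = (x - xs) + θ • (v - xs) := by
      rw [smul_sub, hy]
      module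
    have h := congrArg (fun u => ‖u‖ ^ 2) e1
    simp only [norm_smul, mul_pow, Real.norm_eq_abs, sq_abs] at h
    have h' := norm_add_smul_sq_le hθ.le (x - xs) (v - xs)
    refine le_of_mul_le_mul_left (a := 1 + θ) ?_ (by linarith only [hθ])
    linear_combination h' + h
  refine ⟨by linarith only [h2, h3], by linarith only [h1, h2, h3], ?_⟩
  refine le_of_mul_le_mul_left (a := 1 + θ) ?_ (by linarith only [hθ])
  have h5 := mul_le_mul_of_nonneg_left h4 (half_pos hl).le
  have h6 : D.lam / 2 * ‖x - xs‖ ^ 2 ≤ D.potential x v := by linarith only [h1, h2, h3]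
  have h7 : D.lam / 2 * ‖v - xs‖ ^ 2 ≤ D.potential x v := by linarith only [h0, h3]
  have h8 := mul_le_mul_of_nonneg_left h7 hθ.le
  linarith only [h5, h6, h8]

end Config

namespace Config

variable {n m d : ℕ} [NeZero n] [NeZero m] {S S₁ : Type*} {D : Config n m d S S₁}

/-! ### The Lyapunov function at a warm start -/

theorem gap_nonneg (hD : D.ObjectiveAssumption) (hκ : 0 ≤ D.κ) (y x : Vec d) :
    0 ≤ D.gap y x := sub_nonneg.2 (argmin_spec (exists_forall_G_le hD hκ y) x)

/-- At a warm start the checkpoint equals the iterate, so strong convexity bounds both the distance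
and the checkpoint term by one gap. The error of `hbar` is averaged over the nodes by Jensen's
inequality. -/
theorem lyap_le_of_eq (hD : D.ObjectiveAssumption) (hκ : 0 ≤ D.κ) {b : Fin 5 → ℝ}
    (hb : ∀ j, 0 ≤ b j) (y : Vec d) {s : State n d} (hw : s.w = s.x) (hh : s.hbar = avg s.h) :
    D.lyap b y s ≤ (4 / (D.lam + D.κ) + b 4) * D.gap y s.x + (2 + b 0) * ‖avg s.e‖ ^ 2
      + b 1 * ((1 / (n : ℝ) ^ 2) * ∑ τ, ‖s.e τ‖ ^ 2)
      + (b 2 + b 3) * ((1 / (n : ℝ)) * ∑ τ,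
        ‖s.h τ - gradient (nodeAvg (D.comp y) τ) s.x‖ ^ 2) := by
  have hl := hD.lam_pos
  have hμ : 0 < D.lam + D.κ := by linarith only [hl, hκ]
  have hn : (1 : ℝ) ≤ n := by exact_mod_cast NeZero.one_le
  have h1 := growth_G hD hκ y s.x
  have h2 : ‖s.x - avg s.e - argmin (D.G y)‖ ^ 2
      ≤ 2 * ‖s.x - argmin (D.G y)‖ ^ 2 + 2 * ‖avg s.e‖ ^ 2 := by
    rw [show s.x - avg s.e - argmin (D.G y) = (s.x - argmin (D.G y)) - avg s.e by abel]
    exact norm_sub_sq_le_two _ _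
  have h3 : 2 * ‖s.x - argmin (D.G y)‖ ^ 2 ≤ 4 / (D.lam + D.κ) * D.gap y s.x := by
    rw [div_mul_eq_mul_div, le_div_iff₀ hμ]
    linarith only [h1]
  set H := ∑ τ, ‖s.h τ - gradient (nodeAvg (D.comp y) τ) s.x‖ ^ 2 with hH
  have hH0 : 0 ≤ H := Finset.sum_nonneg fun τ _ => by positivity
  have h4 : ‖s.hbar - gradient (D.G y) s.x‖ ^ 2 ≤ 1 / n * H := by
    rw [hh, gradient_G hD, ← avg_sub]
    exact norm_avg_sq_le _
  have h5 : 1 / (n : ℝ) ^ 2 * H ≤ 1 / n * H := by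
    refine mul_le_mul_of_nonneg_right ?_ hH0
    exact one_div_le_one_div_of_le (by positivity) (le_self_pow₀ hn two_ne_zero)
  have h6 := mul_le_mul_of_nonneg_left h4 (hb 2)
  have h7 := mul_le_mul_of_nonneg_left h5 (hb 3)
  rw [lyap, lyapunov, hw, ← hH]
  linear_combination h2 + h3 + h6 + h7

/-- Bounds on the coefficients of the Lyapunov functions with weights `b` and `D.a`, and on the
parameters of the problem, by powers of `W`. -/
structure Bounded (D : Config n m d S S₁) (b : Fin 5 → ℝ) (W : ℝ) : Prop where
  large : 600 ≤ W
  nodes : (n : ℝ) ≤ W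
  inv_lam : 1 / D.lam ≤ W
  κ_le : D.κ ≤ W
  ell_le : D.ell ≤ W
  inv_gap : 1 / (√D.q - D.ρ₀) ≤ W
  initErr_le : D.initErr ≤ W
  nonneg : ∀ j, 0 ≤ b j
  le_weight : ∀ j, b j ≤ W ^ 2 * D.a j
  le_weight_three : b 2 ≤ W ^ 2 * D.a 3
  weight_zero : 1 ≤ W ^ 7 * D.a 0
  weight_three : D.a 3 ≤ W ^ 8
  weight_four : 1 ≤ W ^ 13 * D.a 4
  four_le : b 4 ≤ W ^ 11

omit [NeZero n] [NeZero m] in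
theorem Bounded.weight_nonneg {b : Fin 5 → ℝ} {W : ℝ} (h : D.Bounded b W) (j : Fin 5) :
    0 ≤ D.a j := by
  have h1 := (h.nonneg j).trans (h.le_weight j)
  have hW := h.large
  exact nonneg_of_mul_nonneg_right h1 (by positivity)

set_option maxHeartbeats 1000000 in
/-- The size of the Lyapunov function at a warm start, from the size at the end of the previous
inner loop. -/
theorem lyap_warmStart_le (hD : D.ObjectiveAssumption) (hκ : 0 ≤ D.κ) {b : Fin 5 → ℝ} {W : ℝ}
    (hW : D.Bounded b W) {k : ℕ} {o : Outer n d} {s : State n d} {ε ε' : ℝ} (hx : o.x = s.x)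
    (he : o.e = s.e) (hh : o.h = s.h) (hε : 0 ≤ ε) (hε' : ε' ≤ W * ε)
    (hs : D.lyap D.a o.yPrev s + D.gap o.yPrev s.x ≤ ε') (hgap : D.gap o.y o.x ≤ W ^ 6 * ε)
    (hy : ‖o.yPrev - o.y‖ ^ 2 ≤ W ^ 6 * ε) :
    D.lyap b o.y (D.warmStart k o) ≤ W ^ 31 * ε := by
  have hl := hD.lam_pos
  have hμ : 0 < D.lam + D.κ := by linarith only [hl, hκ]
  have hWl := hW.large
  have hW0 : 0 < W := by linarith only [hWl]
  have hW1 : 1 ≤ W := by linarith only [hWl]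
  have hn : (1 : ℝ) ≤ n := by exact_mod_cast NeZero.one_le
  have hn0 : (0 : ℝ) < n := by linarith only [hn]
  have hell : 0 ≤ D.ell := add_nonneg (add_nonneg hD.L_nonneg hD.Lψ_nonneg) hκ
  have hinvμ : 1 / (D.lam + D.κ) ≤ W :=
    (one_div_le_one_div_of_le hl (by linarith only [hκ])).trans hW.inv_lam
  have ha := hW.weight_nonneg
  -- the parts of the Lyapunov function at the end of the previous inner loop
  obtain ⟨E, hE⟩ : ∃ E, E = ∑ τ, ‖s.e τ‖ ^ 2 := ⟨_, rfl⟩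
  obtain ⟨H', hH'⟩ : ∃ H', H' = ∑ τ, ‖s.h τ - gradient (nodeAvg (D.comp o.yPrev) τ) s.w‖ ^ 2 :=
    ⟨_, rfl⟩
  have hE0 : 0 ≤ E := hE ▸ Finset.sum_nonneg fun τ _ => by positivity
  have hH0' : 0 ≤ H' := hH' ▸ Finset.sum_nonneg fun τ _ => by positivity
  have p0 : 0 ≤ ‖s.x - avg s.e - argmin (D.G o.yPrev)‖ ^ 2 := by positivity
  have p1 : 0 ≤ D.a 0 * ‖avg s.e‖ ^ 2 := mul_nonneg (ha 0) (by positivity)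
  have p2 : 0 ≤ D.a 1 * (1 / (n : ℝ) ^ 2 * E) := mul_nonneg (ha 1) (by positivity)
  have p3 : 0 ≤ D.a 2 * ‖s.hbar - gradient (D.G o.yPrev) s.w‖ ^ 2 :=
    mul_nonneg (ha 2) (by positivity)
  have p4 : 0 ≤ D.a 3 * (1 / (n : ℝ) ^ 2 * H') := mul_nonneg (ha 3) (by positivity)
  have p5 : 0 ≤ D.a 4 * D.gap o.yPrev s.w := mul_nonneg (ha 4) (gap_nonneg hD hκ _ _)
  have p6 := gap_nonneg hD hκ o.yPrev s.x
  have hsum : ‖s.x - avg s.e - argmin (D.G o.yPrev)‖ ^ 2 + D.a 0 * ‖avg s.e‖ ^ 2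
      + D.a 1 * (1 / (n : ℝ) ^ 2 * E) + D.a 2 * ‖s.hbar - gradient (D.G o.yPrev) s.w‖ ^ 2
      + D.a 3 * (1 / (n : ℝ) ^ 2 * H') + D.a 4 * D.gap o.yPrev s.w + D.gap o.yPrev s.x
      ≤ W * ε := by
    rw [hE, hH']
    exact hs.trans hε'
  have q1 : D.a 0 * ‖avg s.e‖ ^ 2 ≤ W * ε := by linarith only [hsum, p0, p2, p3, p4, p5, p6]
  have q2 : D.a 1 * (1 / (n : ℝ) ^ 2 * E) ≤ W * ε := by
    linarith only [hsum, p0, p1, p3, p4, p5, p6]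
  have q4 : D.a 3 * (1 / (n : ℝ) ^ 2 * H') ≤ W * ε := by
    linarith only [hsum, p0, p1, p2, p3, p5, p6]
  have q5 : D.a 4 * D.gap o.yPrev s.w ≤ W * ε := by linarith only [hsum, p0, p1, p2, p3, p4, p6]
  have q6 : D.gap o.yPrev s.x ≤ W * ε := by linarith only [hsum, p0, p1, p2, p3, p4, p5]
  -- consequences
  have r1 : ‖avg s.e‖ ^ 2 ≤ W ^ 8 * ε := by
    have h1 := mul_le_mul_of_nonneg_right hW.weight_zero (sq_nonneg ‖avg s.e‖)
    have h2 := mul_le_mul_of_nonneg_left q1 (pow_nonneg hW0.le 7)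
    linarith only [h1, h2]
  have r5 : D.gap o.yPrev s.w ≤ W ^ 14 * ε := by
    have h1 := mul_le_mul_of_nonneg_right hW.weight_four (gap_nonneg hD hκ o.yPrev s.w)
    have h2 := mul_le_mul_of_nonneg_left q5 (pow_nonneg hW0.le 13)
    linarith only [h1, h2]
  have hdist : ∀ x : Vec d, ‖x - argmin (D.G o.yPrev)‖ ^ 2 ≤ 2 * W * D.gap o.yPrev x := by
    intro x
    have h1 := growth_G hD hκ o.yPrev x
    have h2 := mul_le_mul_of_nonneg_right hinvμ (gap_nonneg hD hκ o.yPrev x)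
    have h3 : ‖x - argmin (D.G o.yPrev)‖ ^ 2 ≤ 2 * (1 / (D.lam + D.κ) * D.gap o.yPrev x) := by
      rw [← mul_assoc, mul_one_div, div_mul_eq_mul_div, le_div_iff₀ hμ]
      linarith only [h1]
    linarith only [h2, h3]
  -- The old Lyapunov function measures the error of `h` at the old checkpoint `w`, while the new
  -- one starts with the checkpoint at `x`. Both points are close to the old minimizer, by their
  -- gaps.
  have r6 : ‖s.x - s.w‖ ^ 2 ≤ W ^ 16 * ε := by
    have h1 := norm_sub_sq_le_two (s.x - argmin (D.G o.yPrev)) (s.w - argmin (D.G o.yPrev))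
    rw [sub_sub_sub_cancel_right] at h1
    have h2 := hdist s.x
    have h3 := hdist s.w
    have h4 := mul_le_mul_of_nonneg_left q6 (mul_nonneg zero_le_two hW0.le)
    have h5 := mul_le_mul_of_nonneg_left r5 (mul_nonneg zero_le_two hW0.le)
    have h6 : W ^ 2 * ε ≤ W ^ 15 * ε :=
      mul_le_mul_of_nonneg_right (pow_le_pow_right₀ hW1 (by norm_num)) hε
    have h7 : 8 * (W ^ 15 * ε) ≤ W * (W ^ 15 * ε) :=
      mul_le_mul_of_nonneg_right (by linarith only [hWl]) (by positivity)
    linarith only [h1, h2, h3, h4, h5, h6, h7]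
  -- the new state
  set t := D.warmStart k o with ht
  have htx : t.x = s.x := hx
  have htw : t.w = s.x := hx
  have hth : ∀ τ, ‖t.h τ - gradient (nodeAvg (D.comp o.y) τ) s.x‖ ^ 2
      ≤ 4 * ‖s.h τ - gradient (nodeAvg (D.comp o.yPrev) τ) s.w‖ ^ 2
        + (4 * D.ell ^ 2 * ‖s.x - s.w‖ ^ 2 + 2 * D.κ ^ 2 * ‖o.yPrev - o.y‖ ^ 2) := by
    intro τ
    set u := s.h τ - gradient (nodeAvg (D.comp o.yPrev) τ) s.x with hu
    -- The choice of warm start is encoded in `r`. The shift by `κ (yPrev - y)` compensates the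
    -- change of prox-center exactly (`r = 0`); without it this vector appears once (`r = 1`).
    have e1 : ∃ r : ℝ, 0 ≤ r ∧ r ≤ 1 ∧ t.h τ - gradient (nodeAvg (D.comp o.y) τ) s.x
        = u - (r * D.κ) • (o.yPrev - o.y) := by
      rw [hu, gradient_nodeAvg_comp_eq hD, gradient_nodeAvg_comp_eq hD]
      by_cases hc : D.shiftH k = true
      · refine ⟨0, le_rfl, zero_le_one, ?_⟩
        simp only [ht, warmStart, if_pos hc, hh]
        module
      · refine ⟨1, zero_le_one, le_rfl, ?_⟩
        simp only [ht, warmStart, if_neg hc, hh]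
        module
    obtain ⟨r, hr0, hr1, e1⟩ := e1
    have h1 := norm_sub_sq_le_two u ((r * D.κ) • (o.yPrev - o.y))
    rw [← e1, norm_smul, mul_pow, Real.norm_eq_abs, sq_abs] at h1
    have h2 : (r * D.κ) ^ 2 ≤ D.κ ^ 2 := by
      have h : r * D.κ ≤ 1 * D.κ := mul_le_mul_of_nonneg_right hr1 hκ
      rw [one_mul] at h
      exact pow_le_pow_left₀ (mul_nonneg hr0 hκ) h 2
    have h3 := mul_le_mul_of_nonneg_right h2 (sq_nonneg ‖o.yPrev - o.y‖)
    have h4 := norm_sub_sq_le_two (s.h τ - gradient (nodeAvg (D.comp o.yPrev) τ) s.w)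
      (gradient (nodeAvg (D.comp o.yPrev) τ) s.x - gradient (nodeAvg (D.comp o.yPrev) τ) s.w)
    rw [sub_sub_sub_cancel_right, ← hu] at h4
    have h5 := pow_le_pow_left₀ (norm_nonneg _)
      (grad_nodeAvg_comp_lipschitz hD hκ o.yPrev τ s.x s.w) 2
    rw [mul_pow] at h5
    linarith only [h1, h3, h4, h5]
  have hHsum : (1 / (n : ℝ)) * ∑ τ, ‖t.h τ - gradient (nodeAvg (D.comp o.y) τ) s.x‖ ^ 2
      ≤ 4 * (1 / (n : ℝ) * H') + 5 * (W ^ 18 * ε) := by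
    have h1 : ∑ τ, ‖t.h τ - gradient (nodeAvg (D.comp o.y) τ) s.x‖ ^ 2
        ≤ 4 * H' + n * (4 * D.ell ^ 2 * ‖s.x - s.w‖ ^ 2 + 2 * D.κ ^ 2 * ‖o.yPrev - o.y‖ ^ 2) := by
      refine (Finset.sum_le_sum fun τ _ => hth τ).trans (le_of_eq ?_)
      rw [Finset.sum_add_distrib, ← Finset.mul_sum, ← hH', Finset.sum_const, Finset.card_univ,
        Fintype.card_fin, nsmul_eq_mul]
    have h2 := mul_le_mul_of_nonneg_left h1 (one_div_nonneg.2 hn0.le)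
    have h3 : D.ell ^ 2 * ‖s.x - s.w‖ ^ 2 ≤ W ^ 2 * (W ^ 16 * ε) :=
      mul_le_mul (pow_le_pow_left₀ hell hW.ell_le 2) r6 (by positivity) (by positivity)
    have h4 : D.κ ^ 2 * ‖o.yPrev - o.y‖ ^ 2 ≤ W ^ 2 * (W ^ 6 * ε) :=
      mul_le_mul (pow_le_pow_left₀ hκ hW.κ_le 2) hy (by positivity) (by positivity)
    have h5 : 2 * (W ^ 8 * ε) ≤ W ^ 18 * ε := by
      have e1 : W ^ 9 * ε ≤ W ^ 18 * ε :=
        mul_le_mul_of_nonneg_right (pow_le_pow_right₀ hW1 (by norm_num)) hε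
      have e2 : 2 * (W ^ 8 * ε) ≤ W * (W ^ 8 * ε) :=
        mul_le_mul_of_nonneg_right (by linarith only [hWl]) (by positivity)
      linarith only [e1, e2]
    have h6 : 1 / (n : ℝ) * (4 * H' + n * (4 * D.ell ^ 2 * ‖s.x - s.w‖ ^ 2
        + 2 * D.κ ^ 2 * ‖o.yPrev - o.y‖ ^ 2)) = 4 * (1 / (n : ℝ) * H')
        + 4 * (D.ell ^ 2 * ‖s.x - s.w‖ ^ 2) + 2 * (D.κ ^ 2 * ‖o.yPrev - o.y‖ ^ 2) := by
      field_simp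
      ring
    rw [h6] at h2
    linarith only [h2, h3, h4, h5]
  have hte : ‖avg t.e‖ ^ 2 ≤ ‖avg s.e‖ ^ 2 ∧ ∑ τ, ‖t.e τ‖ ^ 2 ≤ E := by
    by_cases hc : D.carryE k = true
    · have h : t.e = s.e := by
        funext τ
        simp only [ht, warmStart, hc, if_true, he]
      rw [h, hE]
      exact ⟨le_rfl, le_rfl⟩
    · have h : t.e = fun _ => 0 := by
        funext τ
        simp [ht, warmStart, hc]
      rw [h, avg_const]
      refine ⟨?_, ?_⟩
      · rw [norm_zero, zero_pow two_ne_zero]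
        positivity
      · simpa using hE0
  have hmain := lyap_le_of_eq hD hκ hW.nonneg o.y (s := t) (htw.trans htx.symm) rfl
  rw [htx] at hmain
  rw [hx] at hgap
  have hg0 := gap_nonneg hD hκ o.y s.x
  generalize D.gap o.y s.x = g at hmain hgap hg0
  generalize 1 / (n : ℝ) * ∑ τ, ‖t.h τ - gradient (nodeAvg (D.comp o.y) τ) s.x‖ ^ 2 = H
    at hmain hHsum
  have t1 : (4 / (D.lam + D.κ) + b 4) * g ≤ 2 * (W ^ 17 * ε) := by
    have h1 : 4 / (D.lam + D.κ) + b 4 ≤ 2 * W ^ 11 := by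
      have e1 : 4 / (D.lam + D.κ) ≤ 4 * W := by
        rw [← mul_one_div]
        linarith only [hinvμ]
      have e2 : 4 * W ≤ W ^ 2 := by
        rw [pow_two]
        exact mul_le_mul_of_nonneg_right (by linarith only [hWl]) hW0.le
      have e3 : W ^ 2 ≤ W ^ 11 := pow_le_pow_right₀ hW1 (by norm_num)
      linarith only [e1, e2, e3, hW.four_le]
    have h2 := mul_le_mul h1 hgap hg0 (by positivity)
    linarith only [h2]
  have t2 : (2 + b 0) * ‖avg t.e‖ ^ 2 ≤ 2 * (W ^ 17 * ε) := by
    have e1 := mul_le_mul_of_nonneg_left hte.1 (add_nonneg zero_le_two (hW.nonneg 0))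
    have e2 := mul_le_mul_of_nonneg_right (hW.le_weight 0) (sq_nonneg ‖avg s.e‖)
    have e3 := mul_le_mul_of_nonneg_left q1 (sq_nonneg W)
    have e4 : W ^ 3 * ε ≤ W ^ 17 * ε :=
      mul_le_mul_of_nonneg_right (pow_le_pow_right₀ hW1 (by norm_num)) hε
    have e5 : W ^ 9 * ε ≤ W ^ 17 * ε :=
      mul_le_mul_of_nonneg_right (pow_le_pow_right₀ hW1 (by norm_num)) hε
    have e6 : 2 * (W ^ 8 * ε) ≤ W * (W ^ 8 * ε) :=
      mul_le_mul_of_nonneg_right (by linarith only [hWl]) (by positivity)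
    linarith only [e1, e2, e3, e4, e5, e6, r1]
  have t3 : b 1 * (1 / (n : ℝ) ^ 2 * ∑ τ, ‖t.e τ‖ ^ 2) ≤ W ^ 17 * ε := by
    have e1 : 1 / (n : ℝ) ^ 2 * ∑ τ, ‖t.e τ‖ ^ 2 ≤ 1 / (n : ℝ) ^ 2 * E :=
      mul_le_mul_of_nonneg_left hte.2 (by positivity)
    have e2 := mul_le_mul_of_nonneg_left e1 (hW.nonneg 1)
    have e3 := mul_le_mul_of_nonneg_right (hW.le_weight 1)
      (show 0 ≤ 1 / (n : ℝ) ^ 2 * E by positivity)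
    have e4 := mul_le_mul_of_nonneg_left q2 (sq_nonneg W)
    have e5 : W ^ 3 * ε ≤ W ^ 17 * ε :=
      mul_le_mul_of_nonneg_right (pow_le_pow_right₀ hW1 (by norm_num)) hε
    linarith only [e2, e3, e4, e5]
  have t4 : (b 2 + b 3) * H ≤ 18 * (W ^ 28 * ε) := by
    have e0 : 0 ≤ 1 / (n : ℝ) * H' := by positivity
    have e1 : b 2 + b 3 ≤ 2 * W ^ 2 * D.a 3 := by
      linarith only [hW.le_weight_three, hW.le_weight 3]
    have e2 := mul_le_mul_of_nonneg_left hHsum (add_nonneg (hW.nonneg 2) (hW.nonneg 3))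
    have e3 := mul_le_mul_of_nonneg_right e1
      (show 0 ≤ 4 * (1 / (n : ℝ) * H') + 5 * (W ^ 18 * ε) by positivity)
    have e4 : D.a 3 * (1 / (n : ℝ) * H') ≤ W * (W * ε) := by
      have h1 : D.a 3 * (1 / (n : ℝ) * H') = n * (D.a 3 * (1 / (n : ℝ) ^ 2 * H')) := by
        field_simp
      rw [h1]
      exact mul_le_mul hW.nodes q4 p4 hW0.le
    have e5 := mul_le_mul_of_nonneg_left e4 (show 0 ≤ 8 * W ^ 2 by positivity)
    have e6 := mul_le_mul_of_nonneg_right hW.weight_three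
      (show 0 ≤ 10 * W ^ 2 * (W ^ 18 * ε) by positivity)
    have e7 : W ^ 4 * ε ≤ W ^ 28 * ε :=
      mul_le_mul_of_nonneg_right (pow_le_pow_right₀ hW1 (by norm_num)) hε
    linarith only [e2, e3, e5, e6, e7]
  -- The four parts total at most `23 * W ^ 28 * ε`, and `600 ≤ W` absorbs the numerical factor into
  -- a further power of `W`.
  have f1 : W ^ 17 * ε ≤ W ^ 28 * ε :=
    mul_le_mul_of_nonneg_right (pow_le_pow_right₀ hW1 (by norm_num)) hε
  have f2 : W ^ 29 * ε ≤ W ^ 31 * ε :=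
    mul_le_mul_of_nonneg_right (pow_le_pow_right₀ hW1 (by norm_num)) hε
  have f3 : 600 * (W ^ 28 * ε) ≤ W * (W ^ 28 * ε) :=
    mul_le_mul_of_nonneg_right hWl (by positivity)
  have f4 : 0 ≤ W ^ 28 * ε := by positivity
  linarith only [hmain, t1, t2, t3, t4, f1, f2, f3, f4]

end Config

namespace Config

variable {n m d : ℕ} [NeZero n] [NeZero m] {S S₁ : Type*} {D : Config n m d S S₁}

/-! ### Every warm start is good -/

omit [NeZero n] [NeZero m] in
-- Consecutive target accuracies differ by the factor `1 - ρ₀`, which is at least `√q - ρ₀ ≥ 1 / W`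
-- because `√q ≤ 1`.
theorem eps_pos_le_succ {W : ℝ} (hq : √D.q ≤ 1) (hρ : D.ρ₀ < √D.q)
    (hW : 1 / (√D.q - D.ρ₀) ≤ W) (hP : (⨅ x, D.P x) < D.P D.x₀) (k : ℕ) :
    0 < D.eps k ∧ D.eps k ≤ W * D.eps (k + 1) := by
  have hg : 0 < √D.q - D.ρ₀ := sub_pos.2 hρ
  have hr : 0 < 1 - D.ρ₀ := by linarith only [hρ, hq]
  have hΔ : 0 < D.P D.x₀ - ⨅ x, D.P x := sub_pos.2 hP
  have h0 : 0 < D.eps k := by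
    unfold eps
    positivity
  have h1 : 1 ≤ W * (1 - D.ρ₀) := by
    rw [div_le_iff₀ hg] at hW
    have hW0 : 0 ≤ W := by
      by_contra! h
      linarith only [hW, mul_neg_of_neg_of_pos h hg]
    exact hW.trans (mul_le_mul_of_nonneg_left (by linarith only [hq]) hW0)
  refine ⟨h0, ?_⟩
  have h2 : D.eps (k + 1) = (1 - D.ρ₀) * D.eps k := by
    simp only [eps, pow_succ]
    ring
  rw [h2, ← mul_assoc]
  exact le_mul_of_one_le_left h0.le h1

/-- The optimal value of the subproblem is at least the minimum of `P`. So its gap at `x` exceeds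
the gap of `P` by at most the proximal term, and `x` and `y` are both near the minimizer of `P`. -/
theorem gap_le_potential (hD : D.ObjectiveAssumption) (hκ : 0 ≤ D.κ) {W s : ℝ} (hW : 1 ≤ W)
    (hlam : 1 / D.lam ≤ W) (hκW : D.κ ≤ W) {x y : Vec d} (h1 : D.P x - D.P (argmin D.P) ≤ s)
    (h2 : D.lam / 2 * ‖x - argmin D.P‖ ^ 2 ≤ s) (h3 : D.lam / 2 * ‖y - argmin D.P‖ ^ 2 ≤ s) :
    D.gap y x ≤ 5 * W ^ 2 * s := by
  have hl := hD.lam_pos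
  have hs : 0 ≤ s := (gap_P_nonneg hD x).trans h1
  have e1 : D.P (argmin D.P) ≤ D.G y (argmin (D.G y)) :=
    (argmin_spec (exists_forall_P_le hD) _).trans (le_add_of_nonneg_right (by positivity))
  have e2 : D.gap y x = D.P x + D.κ / 2 * ‖x - y‖ ^ 2 - D.G y (argmin (D.G y)) := rfl
  have e3 := norm_sub_sq_le_two (x - argmin D.P) (y - argmin D.P)
  rw [sub_sub_sub_cancel_right] at e3
  have e4 : D.lam * ‖x - y‖ ^ 2 ≤ 8 * s := by
    have := mul_le_mul_of_nonneg_left e3 hl.le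
    linarith only [this, h2, h3]
  have e5 : ‖x - y‖ ^ 2 ≤ W * (8 * s) := by
    have := mul_le_mul hlam e4 (by positivity) (by positivity)
    rwa [← mul_assoc, one_div_mul_cancel hl.ne', one_mul] at this
  have e6 : D.κ * ‖x - y‖ ^ 2 ≤ W * (W * (8 * s)) :=
    mul_le_mul hκW e5 (by positivity) (by positivity)
  have e7 : 1 * s ≤ W ^ 2 * s := mul_le_mul_of_nonneg_right (one_le_pow₀ hW) hs
  linarith only [e1, e2, e6, e7, h1]

/-- Here the prox-center is `x₀` itself, so the proximal term and its gradient vanish: the gap is at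
most `P(x₀) - P^*`, and the error of `h` is exactly what `initErr` measures. All `e τ` are zero. -/
theorem lyap_initial_le (hD : D.ObjectiveAssumption) (hκ : 0 ≤ D.κ) (hρ : D.ρ₀ < √D.q)
    (hP : (⨅ x, D.P x) < D.P D.x₀) {b : Fin 5 → ℝ} {W : ℝ} (hW : D.Bounded b W) (ζ : ℕ × ℕ → Noise n m S S₁) :
    D.lyap b (D.outer ζ 0).y (D.warmStart 1 (D.outer ζ 0)) ≤ W ^ 31 * D.eps 1 := by
  obtain ⟨hθ, hθ1, _⟩ := sqrt_q_sq hD hκ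
  have hl := hD.lam_pos
  have hμ : 0 < D.lam + D.κ := by linarith only [hl, hκ]
  have hWl := hW.large
  have hW0 : 0 < W := by linarith only [hWl]
  have hW1 : 1 ≤ W := by linarith only [hWl]
  have hn0 : (0 : ℝ) < n := by exact_mod_cast NeZero.pos n
  have hinvμ : 1 / (D.lam + D.κ) ≤ W :=
    (one_div_le_one_div_of_le hl (by linarith only [hκ])).trans hW.inv_lam
  obtain ⟨_, hε⟩ := eps_pos_le_succ hθ1 hρ hW.inv_gap hP 0
  obtain ⟨hε1, _⟩ := eps_pos_le_succ hθ1 hρ hW.inv_gap hP 1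
  have hΔ : 0 < D.P D.x₀ - ⨅ x, D.P x := sub_pos.2 hP
  have hΔε : D.P D.x₀ - ⨅ x, D.P x ≤ 9 / 2 * (W * D.eps 1) := by
    have : D.eps 0 = 2 / 9 * (D.P D.x₀ - ⨅ x, D.P x) := by rw [eps, pow_zero, mul_one]
    linarith only [this, hε]
  set t := D.warmStart 1 (D.outer ζ 0) with ht
  have hgap : D.gap D.x₀ D.x₀ ≤ D.P D.x₀ - ⨅ x, D.P x := by
    have e1 : D.P (argmin D.P) ≤ D.G D.x₀ (argmin (D.G D.x₀)) :=
      (argmin_spec (exists_forall_P_le hD) _).trans (le_add_of_nonneg_right (by positivity))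
    have e2 : D.G D.x₀ D.x₀ = D.P D.x₀ := by simp [G]
    rw [iInf_P hD, gap, e2]
    linarith only [e1]
  have hte : t.e = fun _ => 0 := by
    funext τ
    simp [ht, warmStart, outer]
  have hth : t.h = D.h₀ := by
    funext τ
    simp [ht, warmStart, outer]
  have hH : (1 / (n : ℝ)) * ∑ τ, ‖t.h τ - gradient (nodeAvg (D.comp D.x₀) τ) D.x₀‖ ^ 2
      ≤ W * (D.P D.x₀ - ⨅ x, D.P x) := by
    have h := hW.initErr_le
    rw [initErr, div_le_iff₀ hΔ] at h
    refine le_trans (le_of_eq ?_) h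
    rw [hth]
    congr 1
    refine Finset.sum_congr rfl fun τ _ => ?_
    rw [gradient_nodeAvg_comp_eq hD, sub_self, smul_zero, add_zero]
  have hmain := lyap_le_of_eq hD hκ hW.nonneg D.x₀ (s := t) rfl rfl
  rw [hte, avg_const, norm_zero, show t.x = D.x₀ from rfl] at hmain
  simp only [norm_zero, ne_eq, OfNat.ofNat_ne_zero, not_false_eq_true, zero_pow,
    Finset.sum_const_zero, mul_zero, add_zero] at hmain
  have hg0 := gap_nonneg hD hκ D.x₀ D.x₀
  have hHn : 0 ≤ (1 / (n : ℝ)) * ∑ τ, ‖t.h τ - gradient (nodeAvg (D.comp D.x₀) τ) D.x₀‖ ^ 2 :=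
    mul_nonneg (by positivity) (Finset.sum_nonneg fun τ _ => by positivity)
  have hmain' : D.lyap b (D.outer ζ 0).y t ≤ _ := hmain
  refine hmain'.trans ?_
  generalize (1 / (n : ℝ)) * ∑ τ, ‖t.h τ - gradient (nodeAvg (D.comp D.x₀) τ) D.x₀‖ ^ 2 = H
    at hH hHn ⊢
  generalize D.gap D.x₀ D.x₀ = g at hgap hg0 ⊢
  generalize D.P D.x₀ - ⨅ x, D.P x = Δ at hgap hH hΔ hΔε
  generalize D.eps 1 = ε at hΔε hε1 ⊢
  have h1 : 4 / (D.lam + D.κ) + b 4 ≤ 2 * W ^ 11 := by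
    have e1 : 4 / (D.lam + D.κ) ≤ 4 * W := by
      rw [← mul_one_div]
      linarith only [hinvμ]
    have e2 : 4 * W ≤ W ^ 2 := by
      rw [pow_two]
      exact mul_le_mul_of_nonneg_right (by linarith only [hWl]) hW0.le
    have e3 : W ^ 2 ≤ W ^ 11 := pow_le_pow_right₀ hW1 (by norm_num)
    linarith only [e1, e2, e3, hW.four_le]
  have h2 := mul_le_mul h1 (hgap.trans hΔε) hg0 (by positivity)
  have h3 : b 2 + b 3 ≤ 2 * W ^ 2 * W ^ 8 := by
    have := mul_le_mul_of_nonneg_left hW.weight_three (show 0 ≤ 2 * W ^ 2 by positivity)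
    linarith only [hW.le_weight_three, hW.le_weight 3, this]
  have h4 := mul_le_mul h3 hH hHn (by positivity)
  have h5 := mul_le_mul_of_nonneg_left hΔε (show 0 ≤ 2 * W ^ 11 by positivity)
  have f1 : W ^ 13 * ε ≤ W ^ 31 * ε :=
    mul_le_mul_of_nonneg_right (pow_le_pow_right₀ hW1 (by norm_num)) hε1.le
  have f2 : 600 * (W ^ 12 * ε) ≤ W * (W ^ 12 * ε) :=
    mul_le_mul_of_nonneg_right hWl (by positivity)
  have f3 : 0 ≤ W ^ 12 * ε := by positivity
  linarith only [h2, h4, h5, f1, f2, f3]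

/-- If all previous inner loops stop, the Lyapunov function starts at a polynomial multiple of the
target accuracy. -/
theorem lyap_start_le (hD : D.ObjectiveAssumption) (hκ : 0 ≤ D.κ) (hM : 0 < D.ellf)
    (hL : 0 < D.ell) (hρ0 : 0 ≤ D.ρ₀) (hρ : D.ρ₀ < √D.q) (hP : (⨅ x, D.P x) < D.P D.x₀)
    {b : Fin 5 → ℝ} {W : ℝ} (hW : D.Bounded b W) (ζ : ℕ × ℕ → Noise n m S S₁) (k : ℕ)
    (hT : ∀ j < k, D.T ζ (j + 1) ≠ ⊤) :
    D.lyap b (D.outer ζ k).y (D.warmStart (k + 1) (D.outer ζ k)) ≤ W ^ 31 * D.eps (k + 1) := by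
  cases k with
  | zero => exact lyap_initial_le hD hκ hρ hP hW ζ
  | succ k =>
    obtain ⟨hθ, hθ1, _⟩ := sqrt_q_sq hD hκ
    have hl := hD.lam_pos
    have hWl := hW.large
    have hW0 : 0 < W := by linarith only [hWl]
    have hW1 : 1 ≤ W := by linarith only [hWl]
    have hμ : 0 < D.lam + D.κ := by linarith only [hl, hκ]
    obtain ⟨s, hs⟩ : ∃ s : ℕ → State n d, ∀ j, s j = D.inner (j + 1) (D.outer ζ j)
      (fun K => ζ (j + 1, K)) (D.T ζ (j + 1)).toNat := ⟨_, fun _ => rfl⟩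
    -- An earlier loop that stops satisfies its criterion at the final state, for every outcome and
    -- not only in expectation.
    have hmet : ∀ j < k + 1, D.lyap D.a (D.outer ζ j).y (s j) + D.gap (D.outer ζ j).y (s j).x
        ≤ D.eps (j + 1) := by
      intro j hj
      have h := firstHit_toNat_spec (hT j hj)
      rw [hs, lyap, ← Phi4_eq_lyapunov hD hκ, gap, ← iInf_G hD hκ]
      exact h
    have hX : ∀ j, (D.outer ζ (j + 1)).x = (s j).x := fun j => by
      rw [hs]
      rfl
    have hgap : ∀ j < k + 1, D.gap (D.outer ζ j).y (D.outer ζ (j + 1)).x ≤ D.eps (j + 1) := by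
      intro j hj
      have h1 := hmet j hj
      have h2 := lyapunov_nonneg (finiteSumProblem hD hκ hM hL (D.outer ζ j).y) hμ.le
        hW.weight_nonneg (s j)
      rw [hX]
      linarith only [h1, h2]
    have hY : ∀ j, (D.outer ζ (j + 1)).y = (D.outer ζ (j + 1)).x
        + betaSucc D.q j • ((D.outer ζ (j + 1)).x - (D.outer ζ j).x) := fun j => rfl
    have hpot : ∀ j ≤ k + 1, D.potential (D.outer ζ j).x (D.auxSeq (fun j => (D.outer ζ j).x) j)
        ≤ 36 * W ^ 2 * D.eps j := by
      intro j hj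
      have h := potential_le hD hκ hρ0 hρ (X := fun j => (D.outer ζ j).x)
        (Y := fun j => (D.outer ζ j).y) rfl rfl hY j fun i hi => hgap i (hi.trans_le hj)
      refine h.trans ?_
      -- The factor `36` is `8` divided by the `2 / 9` in the definition of `eps`.
      have e1 : 8 / (√D.q - D.ρ₀) ^ 2 * (D.P D.x₀ - ⨅ x, D.P x) * (1 - D.ρ₀) ^ j
          = 36 * (1 / (√D.q - D.ρ₀)) ^ 2 * D.eps j := by
        rw [eps, one_div, inv_pow, div_eq_mul_inv]
        ring
      rw [e1]
      have e2 := pow_le_pow_left₀ (one_div_nonneg.2 (sub_pos.2 hρ).le) hW.inv_gap 2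
      have e3 := (eps_pos_le_succ hθ1 hρ hW.inv_gap hP j).1
      gcongr
    have hdist := fun j => dist_le_potential hD hκ
      (smul_extrapolation hD hκ (X := fun j => (D.outer ζ j).x) (Y := fun j => (D.outer ζ j).y)
        rfl hY j)
    obtain ⟨hk1, hk2, hk3⟩ := hdist (k + 1)
    obtain ⟨-, -, hk6⟩ := hdist k
    have hp1 := hpot (k + 1) le_rfl
    have hp0 := hpot k k.le_succ
    obtain ⟨_, hε0⟩ := eps_pos_le_succ hθ1 hρ hW.inv_gap hP k
    obtain ⟨_, hε1⟩ := eps_pos_le_succ hθ1 hρ hW.inv_gap hP (k + 1)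
    obtain ⟨hε, _⟩ := eps_pos_le_succ hθ1 hρ hW.inv_gap hP (k + 2)
    have hb1 : 36 * W ^ 2 * D.eps (k + 1) ≤ 36 * W ^ 3 * D.eps (k + 2) := by
      have := mul_le_mul_of_nonneg_left hε1 (show 0 ≤ 36 * W ^ 2 by positivity)
      linarith only [this]
    have hb0 : 36 * W ^ 2 * D.eps k ≤ 36 * W ^ 4 * D.eps (k + 2) := by
      have h1 := mul_le_mul_of_nonneg_left hε0 (show 0 ≤ 36 * W ^ 2 by positivity)
      have h2 := mul_le_mul_of_nonneg_left hb1 hW0.le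
      linarith only [h1, h2]
    have f2 : 600 * (W ^ 5 * D.eps (k + 2)) ≤ W * (W ^ 5 * D.eps (k + 2)) :=
      mul_le_mul_of_nonneg_right hWl (by positivity)
    have f3 : 0 ≤ W ^ 5 * D.eps (k + 2) := by positivity
    have f4 : W ^ 4 * D.eps (k + 2) ≤ W ^ 5 * D.eps (k + 2) :=
      mul_le_mul_of_nonneg_right (pow_le_pow_right₀ hW1 (by norm_num)) hε.le
    refine lyap_warmStart_le hD hκ hW (s := s k) (ε' := D.eps (k + 1)) (hX k) ?_ ?_ hε.le hε1
      (hmet k k.lt_succ_self) ?_ ?_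
    · rw [hs]
      rfl
    · rw [hs]
      rfl
    · have h := gap_le_potential hD hκ hW1 hW.inv_lam hW.κ_le hk1 hk2 hk3
      have h' := mul_le_mul_of_nonneg_left (hp1.trans hb1) (show 0 ≤ 5 * W ^ 2 by positivity)
      linarith only [h, h', f2, f3]
    · have h1 := norm_sub_sq_le_two ((D.outer ζ k).y - argmin D.P)
        ((D.outer ζ (k + 1)).y - argmin D.P)
      rw [sub_sub_sub_cancel_right] at h1
      have h2 := mul_le_mul_of_nonneg_left h1 hl.le
      have h3 := hk3.trans (hp1.trans hb1)
      have h4 := hk6.trans (hp0.trans hb0)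
      have h5 : D.lam * ‖(D.outer ζ k).y - (D.outer ζ (k + 1)).y‖ ^ 2
          ≤ 144 * W ^ 3 * D.eps (k + 2) + 144 * W ^ 4 * D.eps (k + 2) := by
        linarith only [h2, h3, h4]
      have h6 := mul_le_mul hW.inv_lam h5 (by positivity) hW0.le
      rw [← mul_assoc, one_div_mul_cancel hl.ne', one_mul] at h6
      show ‖(D.outer ζ k).y - (D.outer ζ (k + 1)).y‖ ^ 2 ≤ W ^ 6 * D.eps (k + 2)
      linarith only [h6, f2, f3, f4]

end Config

namespace Config

variable {n m d : ℕ} [NeZero n] [NeZero m] {S S₁ : Type*} {D : Config n m d S S₁}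

/-! ### Comparison of the coefficients -/

/-- Needed because the contraction holds for the weights `D.weight K`, while the stopping rule uses
the given coefficients `D.a`. The distance term has weight `1` in both, whence `1 ≤ C`. -/
theorem lyapunov_le_of_le (hD : D.ObjectiveAssumption) (hκ : 0 ≤ D.κ) {C : ℝ} (hC : 1 ≤ C)
    {a b : Fin 5 → ℝ} (hab : ∀ j, a j ≤ C * b j) (y : Vec d) (s : State n d) :
    D.lyap a y s ≤ C * D.lyap b y s := by
  have h0 : 0 ≤ ‖s.x - avg s.e - argmin (D.G y)‖ ^ 2 := by positivity
  have h1 := mul_le_mul_of_nonneg_right (hab 0) (sq_nonneg ‖avg s.e‖)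
  have hsum : ∀ v : Fin n → Vec d, 0 ≤ 1 / (n : ℝ) ^ 2 * ∑ τ, ‖v τ‖ ^ 2 := fun v =>
    mul_nonneg (by positivity) (Finset.sum_nonneg fun τ _ => sq_nonneg _)
  have h2 := mul_le_mul_of_nonneg_right (hab 1) (hsum s.e)
  have h3 := mul_le_mul_of_nonneg_right (hab 2) (sq_nonneg ‖s.hbar - gradient (D.G y) s.w‖)
  have h4 := mul_le_mul_of_nonneg_right (hab 3)
    (hsum fun τ => s.h τ - gradient (nodeAvg (D.comp y) τ) s.w)
  have h5 := mul_le_mul_of_nonneg_right (hab 4) (gap_nonneg hD hκ y s.w)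
  have h6 := mul_le_mul_of_nonneg_right hC h0
  simp only [lyap, lyapunov]
  linear_combination h1 + h2 + h3 + h4 + h5 + h6

/-- The weights for which one iteration contracts the Lyapunov function. -/
def weight (D : Config n m d S S₁) (K : ℝ) : Fin 5 → ℝ :=
  coeff D.δ D.δ₁ D.η D.ellf (D.ell / n) K D.p

omit [NeZero n] [NeZero m] in
theorem refWeight_nonneg (hM : 0 ≤ D.ellf) (hL : 0 ≤ D.ell) (hδ : 0 < D.δ) (hδ' : D.δ ≤ 1)
    (hδ₁ : 0 < D.δ₁) (hη : 0 ≤ D.η) (hp : 0 < D.p) (j : Fin 5) : 0 ≤ D.refWeight j := by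
  have := sub_nonneg.2 hδ'
  fin_cases j <;> simp [refWeight] <;> positivity

omit [NeZero n] [NeZero m] in
-- The numerical factors are `10`, `80`, `80`, `2400`, and `2 * K` and `8` for the two summands of
-- the last weight; all lie between `1` and `4 * K` once `600 ≤ K`.
theorem weight_compare (hM : 0 ≤ D.ellf) (hL : 0 ≤ D.ell) (hδ : 0 < D.δ) (hδ' : D.δ ≤ 1)
    (hδ₁ : 0 < D.δ₁) (hη : 0 ≤ D.η) (hp : 0 < D.p) {K : ℝ} (hK : 600 ≤ K) (j : Fin 5) :
    D.refWeight j ≤ D.weight K j ∧ D.weight K j ≤ 4 * K * D.refWeight j := by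
  have h := refWeight_nonneg hM hL hδ hδ' hδ₁ hη hp
  have hmul : ∀ c x : ℝ, 0 ≤ x → 1 ≤ c → c ≤ 4 * K → x ≤ c * x ∧ c * x ≤ 4 * K * x :=
    fun c x hx h1 h2 => ⟨le_mul_of_one_le_left hx h1, mul_le_mul_of_nonneg_right h2 hx⟩
  fin_cases j
  · exact hmul 10 _ (h 0) (by norm_num) (by linarith only [hK])
  · exact hmul 80 _ (h 1) (by norm_num) (by linarith only [hK])
  · exact hmul 80 _ (h 2) (by norm_num) (by linarith only [hK])
  · exact hmul 2400 _ (h 3) (by norm_num) (by linarith only [hK])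
  · have h1 := sub_nonneg.2 hδ'
    have hA : 0 ≤ 1 / D.p * ((1 - D.δ) * D.ellf * D.η ^ 3 / D.δ ^ 2
      * (D.ellf + D.δ * D.ell / n)) := by positivity
    have hB : 0 ≤ 1 / D.p * (D.ell * D.η ^ 2 / n) := by positivity
    have e1 : D.refWeight 4 = 1 / D.p * ((1 - D.δ) * D.ellf * D.η ^ 3 / D.δ ^ 2
      * (D.ellf + D.δ * D.ell / n)) + 1 / D.p * (D.ell * D.η ^ 2 / n) := by
      simp only [refWeight, Matrix.cons_val]
      ring
    have e2 : D.weight K 4 = 2 * K * (1 / D.p * ((1 - D.δ) * D.ellf * D.η ^ 3 / D.δ ^ 2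
      * (D.ellf + D.δ * D.ell / n))) + 8 * (1 / D.p * (D.ell * D.η ^ 2 / n)) := by
      simp only [weight, coeff, Matrix.cons_val]
      ring
    show D.refWeight 4 ≤ D.weight K 4 ∧ D.weight K 4 ≤ 4 * K * D.refWeight 4
    rw [e1, e2]
    generalize 1 / D.p * ((1 - D.δ) * D.ellf * D.η ^ 3 / D.δ ^ 2
      * (D.ellf + D.δ * D.ell / n)) = A at hA ⊢
    generalize 1 / D.p * (D.ell * D.η ^ 2 / n) = B at hB ⊢
    have hKA := mul_le_mul_of_nonneg_right hK hA
    have hKB := mul_le_mul_of_nonneg_right hK hB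
    constructor
    · linarith only [hKA, hB, hA]
    · linarith only [hKA, hKB, hA, hB]

omit [NeZero m] in
/-- All quantities that enter the analysis are bounded by powers of `W`. -/
theorem bounded_of_le (hM : D.lam ≤ D.ellf) (hL : D.lam ≤ D.ell) (hlam : 0 < D.lam)
    (hδ : 0 < D.δ) (hδ' : D.δ ≤ 1) (hδ₁ : 0 < D.δ₁) {B K W : ℝ} (hB : 1 ≤ B) (hK : 600 ≤ K)
    (hp : 0 < D.p) (hp1 : D.p ≤ 1) (hpB : D.δ₁ / B ≤ D.p)
    (ha : ∀ j, D.refWeight j / B ≤ D.a j ∧ D.a j ≤ B * D.refWeight j)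
    (hKW : 4 * K ≤ W) (hBW : B ≤ W) (hn : (n : ℝ) ≤ W) (hδW : 1 / D.δ ≤ W)
    (hδ₁W : 1 / D.δ₁ ≤ W) (hlamW : 1 / D.lam ≤ W) (hκW : D.κ ≤ W)
    (hMW : D.ellf ≤ W) (hLW : D.ell ≤ W) (hgap : 1 / (√D.q - D.ρ₀) ≤ W) (hinit : D.initErr ≤ W) (hη0 : 0 < D.η)
    (hηW : D.η ≤ W) (hη : 1 ≤ W ^ 5 * D.η) : D.Bounded (D.weight K) W := by
  have hW600 : 600 ≤ W := by linarith only [hK, hKW]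
  have hW0 : 0 < W := by linarith only [hW600]
  have hW1 : 1 ≤ W := by linarith only [hW600]
  have hB0 : 0 < B := one_pos.trans_le hB
  have hM0 : 0 < D.ellf := hlam.trans_le hM
  have hL0 : 0 < D.ell := hlam.trans_le hL
  have hn0 : (0 : ℝ) < n := by exact_mod_cast NeZero.pos n
  have hn1 : (1 : ℝ) ≤ n := by exact_mod_cast NeZero.one_le
  have h1δ := sub_nonneg.2 hδ'
  have href := refWeight_nonneg hM0.le hL0.le hδ hδ' hδ₁ hη0.le hp
  have hcmp := weight_compare hM0.le hL0.le hδ hδ' hδ₁ hη0.le hp hK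
  have hWM : 1 ≤ W * D.ellf := by
    rw [div_le_iff₀ hlam] at hlamW
    exact hlamW.trans (mul_le_mul_of_nonneg_left hM hW0.le)
  have hWL : 1 ≤ W * D.ell := by
    rw [div_le_iff₀ hlam] at hlamW
    exact hlamW.trans (mul_le_mul_of_nonneg_left hL hW0.le)
  have hrefa : ∀ j, D.refWeight j ≤ W * D.a j := by
    intro j
    have h := (ha j).1
    rw [div_le_iff₀ hB0] at h
    have h0 : 0 ≤ D.a j := (div_nonneg (href j) hB0.le).trans (ha j).1
    linarith only [h, mul_le_mul_of_nonneg_left hBW h0]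
  have hle : ∀ j, D.weight K j ≤ W * D.refWeight j := fun j =>
    (hcmp j).2.trans (mul_le_mul_of_nonneg_right hKW (href j))
  have hη3 : D.η ^ 3 ≤ W ^ 3 := pow_le_pow_left₀ hη0.le hηW 3
  have hη2 : D.η ^ 2 ≤ W ^ 2 := pow_le_pow_left₀ hη0.le hηW 2
  have hinvδ2 : 1 / D.δ ^ 2 ≤ W ^ 2 := by
    rw [← one_div_pow]
    exact pow_le_pow_left₀ (one_div_nonneg.2 hδ.le) hδW 2
  have hMη : (1 - D.δ) * D.ellf * D.η ^ 3 ≤ W ^ 4 := by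
    have e1 : (1 - D.δ) * D.ellf ≤ W :=
      (mul_le_of_le_one_left hM0.le (by linarith only [hδ])).trans hMW
    calc (1 - D.δ) * D.ellf * D.η ^ 3 ≤ W * W ^ 3 := by gcongr
      _ = W ^ 4 := by ring
  have hMη0 : 0 ≤ (1 - D.δ) * D.ellf * D.η ^ 3 := by positivity
  refine ⟨hW600, hn, hlamW, hκW, hLW, hgap, hinit, fun j => (href j).trans (hcmp j).1,
    fun j => ?_, ?_, ?_, ?_, ?_, ?_⟩
  · have := mul_le_mul_of_nonneg_left (hrefa j) hW0.le
    linarith only [hle j, this]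
  · have h1 : D.refWeight 2 = D.refWeight 3 := rfl
    have h2 := hle 2
    rw [h1] at h2
    have := mul_le_mul_of_nonneg_left (hrefa 3) hW0.le
    linarith only [h2, this]
  · have h1 : D.refWeight 0 = D.ellf * D.η / D.δ := rfl
    have h2 : D.ellf * D.η ≤ D.refWeight 0 := by
      rw [h1, le_div_iff₀ hδ]
      exact mul_le_of_le_one_right (by positivity) hδ'
    have h3 := mul_le_mul_of_nonneg_left (h2.trans (hrefa 0)) (pow_nonneg hW0.le 6)
    have h4 := one_le_mul_of_one_le_of_one_le hWM hη
    linarith only [h3, h4]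
  · have h1 : D.refWeight 3 = (1 - D.δ) * D.ellf * D.η ^ 3 * (1 / D.δ ^ 2) * (1 / D.δ₁) := by
      simp only [refWeight, Matrix.cons_val]
      field_simp
    have h2 : D.refWeight 3 ≤ W ^ 4 * W ^ 2 * W := by
      rw [h1]
      gcongr
    have h3 := (ha 3).2
    have h4 : B * D.refWeight 3 ≤ W * (W ^ 4 * W ^ 2 * W) := mul_le_mul hBW h2 (href 3) hW0.le
    linarith only [h3, h4]
  · have h1 : D.ell * D.η ^ 2 ≤ n * D.refWeight 4 := by
      have e1 : n * D.refWeight 4 = 1 / D.p * (n * ((1 - D.δ) * D.ellf * D.η ^ 3 / D.δ ^ 2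
          * (D.ellf + D.δ * D.ell / n)) + D.ell * D.η ^ 2) := by
        simp only [refWeight, Matrix.cons_val]
        field_simp
      have e2 : 0 ≤ n * ((1 - D.δ) * D.ellf * D.η ^ 3 / D.δ ^ 2
          * (D.ellf + D.δ * D.ell / n)) := by positivity
      rw [e1, one_div_mul_eq_div, le_div_iff₀ hp]
      have e3 : D.ell * D.η ^ 2 * D.p ≤ D.ell * D.η ^ 2 :=
        mul_le_of_le_one_right (by positivity) hp1
      linarith only [e2, e3]
    have h2 : D.ell * D.η ^ 2 ≤ W * (W * D.a 4) :=
      h1.trans (mul_le_mul hn (hrefa 4) (href 4) hW0.le)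
    have h3 := mul_le_mul_of_nonneg_left h2 (pow_nonneg hW0.le 11)
    have h4 := one_le_mul_of_one_le_of_one_le hWL (one_le_pow₀ (n := 2) hη)
    linarith only [h3, h4]
  · have hinvp : 1 / D.p ≤ W ^ 2 := by
      rw [div_le_iff₀ hB0] at hpB
      rw [div_le_iff₀ hδ₁] at hδ₁W
      rw [div_le_iff₀ hp]
      have e1 := mul_le_mul_of_nonneg_left (hpB.trans (mul_le_mul_of_nonneg_left hBW hp.le)) hW0.le
      linarith only [e1, hδ₁W]
    have h1 : D.refWeight 4 = 1 / D.p * ((1 - D.δ) * D.ellf * D.η ^ 3 * (1 / D.δ ^ 2)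
        * (D.ellf + D.δ * D.ell / n) + D.ell * D.η ^ 2 / n) := by
      simp only [refWeight, Matrix.cons_val]
      ring
    have h2 : D.δ * D.ell / n ≤ W := by
      rw [div_le_iff₀ hn0]
      calc D.δ * D.ell ≤ 1 * W := by gcongr
        _ = W * 1 := by ring
        _ ≤ W * n := by gcongr
    have h3 : D.ell * D.η ^ 2 / n ≤ W * W ^ 2 :=
      (div_le_self (by positivity) hn1).trans (by gcongr)
    have h4 : D.refWeight 4 ≤ W ^ 2 * (W ^ 4 * W ^ 2 * (W + W) + W * W ^ 2) := by
      rw [h1]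
      gcongr
    have h5 := mul_le_mul_of_nonneg_left h4 hW0.le
    have f1 : W ^ 6 ≤ W ^ 10 := pow_le_pow_right₀ hW1 (by norm_num)
    have f2 : 600 * W ^ 10 ≤ W * W ^ 10 := mul_le_mul_of_nonneg_right hW600 (by positivity)
    have f3 : 0 ≤ W ^ 10 := by positivity
    linarith only [hle 4, h5, f1, f2, f3]

end Config

namespace Config

variable {n m d : ℕ} [NeZero n] [NeZero m] {S S₁ : Type*} {D : Config n m d S S₁}

/-! ### The stepsize -/

omit [NeZero n] [NeZero m] in
-- With `t = √(1 - δ) * ellf / δ` and `l = ell / n`, the compression feedback divided by `η` is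
-- quadratic in `η * t` and `η * l`, both at most `c₀`. Since `K * c₀ = 1 / 32`, one factor `c₀`
-- cancels `K`, and the total is at most `3 / 16 * c₀ + 8 * c₀ ≤ 1 / 2`.
theorem stepsize_conditions (hM : 0 ≤ D.ellf) (hL : 0 ≤ D.ell) (hδ : 0 < D.δ) (hδ' : D.δ ≤ 1)
    {K c₀ : ℝ} (hK : 1 ≤ K) (hc₀ : c₀ = 1 / (32 * K)) (hη : 0 ≤ D.η)
    (hη' : D.η * D.invStep ≤ c₀) :
    D.η * (2 * D.ellf + 4 * (D.ell / n)) ≤ 1 / 2 ∧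
      3 * (K * ((1 - D.δ) * D.ellf * D.η ^ 3 / D.δ ^ 2) * (D.ellf + D.δ * (D.ell / n)))
        + 8 * D.η ^ 2 * (D.ell / n) ≤ D.η / 2 := by
  have hK0 : 0 < K := by linarith only [hK]
  have h1δ := sub_nonneg.2 hδ'
  have hc : 0 < c₀ := by rw [hc₀]; positivity
  have hcK : K * c₀ = 1 / 32 := by rw [hc₀]; field_simp
  have hc32 : c₀ ≤ 1 / 32 := by
    rw [← hcK]
    exact le_mul_of_one_le_left hc.le hK
  obtain ⟨l, hl⟩ : ∃ l, l = D.ell / n := ⟨_, rfl⟩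
  have hl0 : 0 ≤ l := by rw [hl]; positivity
  obtain ⟨r, hr⟩ : ∃ r, r = √(1 - D.δ) := ⟨_, rfl⟩
  have hr0 : 0 ≤ r := by rw [hr]; positivity
  have hr2 : r ^ 2 = 1 - D.δ := by rw [hr, Real.sq_sqrt h1δ]
  have hr1 : r ≤ 1 := by
    rw [hr]
    exact Real.sqrt_le_one.2 (by linarith only [hδ])
  obtain ⟨t, ht⟩ : ∃ t, t = r * D.ellf / D.δ := ⟨_, rfl⟩
  have ht0 : 0 ≤ t := by rw [ht]; positivity
  rw [invStep, ← hl, ← hr, ← ht] at hη'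
  have p1 : 0 ≤ D.η * D.ellf := mul_nonneg hη hM
  have p2 : 0 ≤ D.η * l := mul_nonneg hη hl0
  have p3 : 0 ≤ D.η * t := mul_nonneg hη ht0
  have q1 : D.η * l ≤ c₀ := by linarith only [hη', p1, p2, p3]
  have q2 : D.η * t ≤ c₀ := by linarith only [hη', p1, p2, p3]
  rw [← hl]
  constructor
  · linarith only [hη', p1, p2, p3, hc32]
  · have e1 : 3 * (K * ((1 - D.δ) * D.ellf * D.η ^ 3 / D.δ ^ 2) * (D.ellf + D.δ * l))
        + 8 * D.η ^ 2 * l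
        = D.η * (3 * K * ((D.η * t) ^ 2 + r * (D.η * t) * (D.η * l)) + 8 * (D.η * l)) := by
      rw [ht, ← hr2]
      field_simp
    have h1 : (D.η * t) ^ 2 ≤ c₀ * c₀ := by
      rw [pow_two]
      exact mul_le_mul q2 q2 p3 hc.le
    have h2 : r * (D.η * t) * (D.η * l) ≤ c₀ * c₀ :=
      mul_le_mul ((mul_le_of_le_one_left p3 hr1).trans q2) q1 p2 hc.le
    have h3 : 3 * K * ((D.η * t) ^ 2 + r * (D.η * t) * (D.η * l)) ≤ 3 * K * (2 * (c₀ * c₀)) :=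
      mul_le_mul_of_nonneg_left (by linarith only [h1, h2]) (by positivity)
    have h4 : 3 * K * (2 * (c₀ * c₀)) = 3 / 16 * c₀ := by linear_combination 6 * c₀ * hcK
    rw [e1, div_eq_mul_one_div]
    exact mul_le_mul_of_nonneg_left (by linarith only [h3, h4, q1, hc32]) hη

section Iterations

variable [MeasurableSpace S] [MeasurableSpace S₁] {ν : Measure S} [IsProbabilityMeasure ν]
  {ν₁ : Measure S₁} [IsProbabilityMeasure ν₁]

/-- One inner iteration contracts the expected Lyapunov function. -/
theorem lintegral_lyap_ecStep_le (hD : D.ObjectiveAssumption) (hκ : 0 ≤ D.κ)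
    (hlM : D.lam ≤ D.Lψ) (hQ : IsContractionCompressor ν D.Q D.δ)
    (hQ₁ : IsContractionCompressor ν₁ D.Q₁ D.δ₁) (hmean : ∀ x, ∫ s, D.Q s x ∂ν = D.δ • x)
    (hmean₁ : ∀ x, ∫ s, D.Q₁ s x ∂ν₁ = D.δ₁ • x) (hp : 0 < D.p) (hp1 : D.p ≤ 1) {B K ρ c₀ : ℝ}
    (hB : 1 ≤ B) (hpB : D.p ≤ B * D.δ₁) (hK : K = 31920 * B ^ 2) (hc₀ : c₀ = 1 / (32 * K))
    (hη : 0 ≤ D.η) (hη' : D.η * D.invStep ≤ c₀) (hρ1 : ρ ≤ 1)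
    (hρμ : ρ ≤ D.η * (D.lam + D.κ) / 2) (hρδ : ρ ≤ D.δ / 4) (hρδ₁ : ρ ≤ D.δ₁ / 4)
    (hρp : ρ ≤ D.p / 2) (y : Vec d) (s : State n d) (hs : s.hbar = avg s.h) :
    ∫⁻ z, ENNReal.ofReal (D.lyap (D.weight K) y (ecStep D.Q D.Q₁ (D.comp y) D.η z s))
        ∂noiseLaw n m ν ν₁ D.p + ENNReal.ofReal (D.η / 2) * ENNReal.ofReal (D.gap y s.x)
      ≤ ENNReal.ofReal (1 - ρ) * ENNReal.ofReal (D.lyap (D.weight K) y s) := by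
  have hl := hD.lam_pos
  have hLf := hD.Lf_nonneg
  have hL' := hD.L_nonneg
  have hμ : 0 ≤ D.lam + D.κ := by linarith only [hl, hκ]
  have hM : 0 < D.ellf := by rw [ellf]; linarith only [hl, hκ, hlM, hLf]
  have hL : 0 < D.ell := by rw [ell]; linarith only [hl, hκ, hlM, hL']
  have hμM : D.lam + D.κ ≤ D.ellf := by rw [ellf]; linarith only [hlM, hLf]
  have hK1 : 600 ≤ K := by
    have := one_le_pow₀ (n := 2) hB
    linarith only [hK, this]
  obtain ⟨h1, h2⟩ := stepsize_conditions hM.le hL.le hQ.pos hQ.le_one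
    (by linarith only [hK1]) hc₀ hη hη'
  have hF := finiteSumProblem hD hκ hM hL y
  have hw : ∀ j, 0 ≤ D.weight K j := fun j =>
    (refWeight_nonneg hM.le hL.le hQ.pos hQ.le_one hQ₁.pos hη hp j).trans
      (weight_compare hM.le hL.le hQ.pos hQ.le_one hQ₁.pos hη hp hK1 j).1
  obtain ⟨h3, h4⟩ := lintegral_lyapunov_step_le hF hμ hQ hmean hQ₁ hmean₁ hw D.η hs hp.le hp1
  have h5 := hF.step_le hμ hμM hM hL.le hQ.pos hQ.le_one hQ₁.pos hQ₁.le_one hη h1 hB hp hpB hK h2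
    hρμ hρδ hρδ₁ hρp s
  have hg := gap_nonneg hD hκ y s.x
  rw [← ENNReal.ofReal_mul (by positivity), ← ENNReal.ofReal_mul (by linarith only [hρ1])]
  refine (add_le_add_left h4 _).trans ?_
  rw [← ENNReal.ofReal_add h3 (by positivity)]
  refine ENNReal.ofReal_le_ofReal ?_
  have h6 : D.gap y s.x = D.G y s.x - D.G y (argmin (D.G y)) := rfl
  rw [h6]
  exact (add_le_add_left h5 _).trans (le_of_eq (sub_add_cancel _ _))

variable {Ω : Type*} [MeasurableSpace Ω] {μ : Measure Ω} [IsProbabilityMeasure μ]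
  {ζ : ℕ × ℕ → Ω → Noise n m S S₁}

/-- Strong induction, since the start of loop `k + 1` is controlled only where all earlier loops
have stopped. The induction hypothesis gives them finite expectation, hence they stop almost surely.
-/
theorem lintegral_T_le_log (hD : D.ObjectiveAssumption) (hκ : 0 ≤ D.κ)
    (hlM : D.lam ≤ D.Lψ) (hQ : IsContractionCompressor ν D.Q D.δ)
    (hQ₁ : IsContractionCompressor ν₁ D.Q₁ D.δ₁) (hmean : ∀ x, ∫ s, D.Q s x ∂ν = D.δ • x)
    (hmean₁ : ∀ x, ∫ s, D.Q₁ s x ∂ν₁ = D.δ₁ • x) (hρ0 : 0 ≤ D.ρ₀) (hρq : D.ρ₀ < √D.q)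
    (hP : (⨅ x, D.P x) < D.P D.x₀) (hp : 0 < D.p) (hp1 : D.p ≤ 1) {B K ρ c₀ W : ℝ}
    (hB : 1 ≤ B) (hpB : D.p ≤ B * D.δ₁) (hK : K = 31920 * B ^ 2) (hc₀ : c₀ = 1 / (32 * K))
    (hη : 0 < D.η) (hη' : D.η * D.invStep ≤ c₀) (hρ : 0 < ρ) (hρ1 : ρ ≤ 1)
    (hρμ : ρ ≤ D.η * (D.lam + D.κ) / 2) (hρδ : ρ ≤ D.δ / 4) (hρδ₁ : ρ ≤ D.δ₁ / 4)
    (hρp : ρ ≤ D.p / 2) (ha : ∀ j, D.a j ≤ B * D.refWeight j) (hW : D.Bounded (D.weight K) W)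
    (hBW : B ≤ W) (hηW : 1 ≤ W ^ 5 * D.η) (hζ : ∀ j, Measurable (ζ j))
    (hlaw : ∀ j, μ.map (ζ j) = noiseLaw n m ν ν₁ D.p) (hind : iIndepFun ζ μ) (k : ℕ) :
    ∫⁻ ω, ((D.T (fun j => ζ j ω) (k + 1) : ℕ∞) : ℝ≥0∞) ∂μ
      ≤ ENNReal.ofReal (37 * Real.log W / ρ + 1 / ρ + 1) := by
  induction k using Nat.strong_induction_on with
  | _ k ih =>
  have hl := hD.lam_pos
  have hLf := hD.Lf_nonneg
  have hL' := hD.L_nonneg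
  have hM : 0 < D.ellf := by rw [ellf]; linarith only [hl, hκ, hlM, hLf]
  have hL : 0 < D.ell := by rw [ell]; linarith only [hl, hκ, hlM, hL']
  have hK1 : 600 ≤ K := by
    have := one_le_pow₀ (n := 2) hB
    linarith only [hK, this]
  have hWl := hW.large
  have hW0 : 0 < W := by linarith only [hWl]
  have hW1 : 1 ≤ W := by linarith only [hWl]
  have hQm := hQ.measurable
  have hQm₁ := hQ₁.measurable
  have hstart : ∀ᵐ ω ∂μ, D.lyap (D.weight K) (D.outer (fun j => ζ j ω) k).y
      (D.warmStart (k + 1) (D.outer (fun j => ζ j ω) k)) ≤ W ^ 31 * D.eps (k + 1) := by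
    have h1 : ∀ᵐ ω ∂μ, ∀ j, j < k → D.T (fun j => ζ j ω) (j + 1) ≠ ⊤ := by
      refine ae_all_iff.2 fun j => ?_
      by_cases hj : j < k
      · filter_upwards [ae_T_ne_top hD hκ hQm hQm₁ hζ j
          ((ih j hj).trans_lt ENNReal.ofReal_lt_top).ne] with ω hω _
        exact hω
      · exact Filter.Eventually.of_forall fun ω h => absurd h hj
    filter_upwards [h1] with ω hω
    exact lyap_start_le hD hκ hM hL hρ0 hρq hP hW _ k hω
  have hε : 0 < D.eps (k + 1) :=
    (eps_pos_le_succ (sqrt_q_sq hD hκ).2.1 hρq hW.inv_gap hP (k + 1)).1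
  -- The exponent is `31` from the starting value plus `6` from the factor `B + 2 / η` lost in
  -- Markov's inequality.
  have hlog : Real.log (W ^ 37) = 37 * Real.log W := by
    rw [Real.log_pow]
    norm_num
  rw [← hlog]
  refine lintegral_T_succ_le hD hκ hQm hQm₁ hζ hlaw hind hρ hρ1 (half_pos hη)
    (fun y s hs => lintegral_lyap_ecStep_le hD hκ hlM hQ hQ₁ hmean hmean₁ hp hp1 hB hpB hK hc₀
      hη.le hη' hρ1 hρμ hρδ hρδ₁ hρp y s hs) k hstart (by positivity) hε (by linarith only [hB])
    (lyapunov_le_of_le hD hκ hB fun j => (ha j).trans (mul_le_mul_of_nonneg_left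
      (weight_compare hM.le hL.le hQ.pos hQ.le_one hQ₁.pos hη.le hp hK1 j).1
      (by linarith only [hB]))) (one_le_pow₀ hW1) ?_
  have h1 : 1 / (D.η / 2) ≤ 2 * W ^ 5 := by
    rw [one_div_div, div_le_iff₀ hη]
    linarith only [hηW]
  have h2 : W ≤ W ^ 5 := le_self_pow₀ hW1 (by norm_num)
  have h3 : B + 1 / (D.η / 2) ≤ W ^ 6 := by
    have e1 : 600 * W ^ 5 ≤ W * W ^ 5 := mul_le_mul_of_nonneg_right hWl (by positivity)
    have e2 : 0 ≤ W ^ 5 := by positivity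
    linarith only [h1, h2, hBW, e1, e2]
  calc (B + 1 / (D.η / 2)) * W ^ 31 ≤ W ^ 6 * W ^ 31 := by gcongr
    _ = W ^ 37 := by ring

end Iterations

/-! ### The rate -/

omit [NeZero m] in
/-- The inverse of the contraction factor is of the order of the rate. -/
theorem inv_contraction_le (hD : D.ObjectiveAssumption) (hκ : 0 ≤ D.κ) (hδ : 0 < D.δ)
    (hδ' : D.δ ≤ 1) (hδ₁ : 0 < D.δ₁) (hp : 0 < D.p) {B c : ℝ} (hB : 1 ≤ B)
    (hpB : D.δ₁ / B ≤ D.p) (hc : 0 < c) (hη : 0 < D.η) (hcη : c ≤ D.η * D.invStep) :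
    1 ≤ D.rate ∧ 2 / (D.η * (D.lam + D.κ)) + 4 / D.δ + 4 / D.δ₁ + 2 / D.p
      ≤ (8 / c + 8 + 2 * B) * D.rate := by
  have hl := hD.lam_pos
  have hμ : 0 < D.lam + D.κ := by linarith only [hl, hκ]
  have hn0 : (0 : ℝ) < n := by exact_mod_cast NeZero.pos n
  have hn1 : (1 : ℝ) ≤ n := by exact_mod_cast NeZero.one_le
  have hB0 : 0 < B := one_pos.trans_le hB
  have hLf := hD.Lf_nonneg
  have hL := hD.L_nonneg
  have hLψ := hD.Lψ_nonneg
  obtain ⟨u, hu⟩ : ∃ u, u = (D.Lf + D.Lψ) / (D.lam + D.κ) := ⟨_, rfl⟩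
  obtain ⟨v, hv⟩ : ∃ v, v = D.L / (n * (D.lam + D.κ)) := ⟨_, rfl⟩
  obtain ⟨w, hw⟩ : ∃ w, w = √(1 - D.δ) * (D.Lf + D.Lψ + D.lam + D.κ) / (D.δ * (D.lam + D.κ)) :=
    ⟨_, rfl⟩
  have hu0 : 0 ≤ u := by rw [hu]; positivity
  have hv0 : 0 ≤ v := by rw [hv]; positivity
  have hw0 : 0 ≤ w := by rw [hw]; positivity
  have hδi : 1 ≤ 1 / D.δ := by rwa [one_le_div hδ]
  have hδ₁i : 0 ≤ 1 / D.δ₁ := by positivity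
  have hrate : D.rate = 1 / D.δ + 1 / D.δ₁ + u + v + w := by rw [rate, hu, hv, hw]
  have hstep : D.invStep ≤ (2 * u + v + w + 2) * (D.lam + D.κ) := by
    have e1 : D.ellf ≤ (u + 1) * (D.lam + D.κ) := by
      rw [ellf, hu, add_mul, div_mul_cancel₀ _ hμ.ne']
      linarith only [hl]
    have e2 : D.ell / n ≤ (v + u + 1) * (D.lam + D.κ) := by
      have f1 : D.ell / n = v * (D.lam + D.κ) + (D.Lψ + D.κ) / n := by
        rw [ell, hv]
        field_simp
        ring
      have f2 : (D.Lψ + D.κ) / n ≤ D.Lψ + D.κ := div_le_self (by positivity) hn1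
      have f3 : D.Lψ + D.κ ≤ (u + 1) * (D.lam + D.κ) := by
        rw [hu, add_mul, div_mul_cancel₀ _ hμ.ne']
        linarith only [hl, hLf]
      linarith only [f1, f2, f3]
    have e3 : √(1 - D.δ) * D.ellf / D.δ ≤ w * (D.lam + D.κ) := by
      have f1 : w * (D.lam + D.κ) = √(1 - D.δ) * (D.Lf + D.Lψ + D.lam + D.κ) / D.δ := by
        rw [hw]
        field_simp
      rw [f1, ellf]
      exact div_le_div_of_nonneg_right (mul_le_mul_of_nonneg_left (by linarith only [hl])
        (Real.sqrt_nonneg _)) hδ.le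
    rw [invStep]
    linarith only [e1, e2, e3]
  have hη1 : 2 / (D.η * (D.lam + D.κ)) ≤ 8 / c * D.rate := by
    have e1 : 2 * u + v + w + 2 ≤ 4 * D.rate := by
      rw [hrate]
      linarith only [hu0, hv0, hw0, hδi, hδ₁i]
    have e2 : c ≤ D.η * (4 * D.rate * (D.lam + D.κ)) := hcη.trans
      (mul_le_mul_of_nonneg_left (hstep.trans (mul_le_mul_of_nonneg_right e1 hμ.le)) hη.le)
    rw [div_mul_eq_mul_div, div_le_div_iff₀ (by positivity) hc]
    linarith only [e2]
  have hpi : 2 / D.p ≤ 2 * B * (1 / D.δ₁) := by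
    rw [div_le_iff₀ hB0] at hpB
    rw [mul_one_div, div_le_div_iff₀ hp hδ₁]
    linarith only [hpB]
  have h4 : 4 / D.δ = 4 * (1 / D.δ) := by ring
  have h5 : 4 / D.δ₁ = 4 * (1 / D.δ₁) := by ring
  have hr1 : 1 / D.δ ≤ D.rate := by rw [hrate]; linarith only [hu0, hv0, hw0, hδ₁i]
  have hr2 : 1 / D.δ₁ ≤ D.rate := by rw [hrate]; linarith only [hu0, hv0, hw0, hδi]
  have hr3 := mul_le_mul_of_nonneg_left hr2 (show 0 ≤ 2 * B by positivity)
  refine ⟨hδi.trans hr1, ?_⟩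
  rw [h4, h5]
  linarith only [hη1, hpi, hr1, hr2, hr3]

/-- The argument of the logarithmic factor. -/
def logArg (D : Config n m d S S₁) : ℝ :=
  2 + n * m + 1 / D.δ + 1 / D.δ₁ + D.lam + 1 / D.lam + D.κ + D.Lf + D.Lψ + D.L
    + 1 / (√D.q - D.ρ₀) + D.initErr

omit [NeZero n] in
theorem logArg_bounds (hD : D.ObjectiveAssumption) (hκ : 0 ≤ D.κ) (hδ : 0 < D.δ)
    (hδ₁ : 0 < D.δ₁) (hρ : D.ρ₀ < √D.q) (hP : (⨅ x, D.P x) < D.P D.x₀) :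
    2 ≤ D.logArg ∧ (n : ℝ) ≤ D.logArg ∧ 1 / D.δ ≤ D.logArg ∧ 1 / D.δ₁ ≤ D.logArg ∧
      1 / D.lam ≤ D.logArg ∧ D.κ ≤ D.logArg ∧ D.ellf ≤ D.logArg ∧ D.ell ≤ D.logArg ∧
      1 / (√D.q - D.ρ₀) ≤ D.logArg ∧ D.initErr ≤ D.logArg := by
  have hl := hD.lam_pos
  have hLf := hD.Lf_nonneg
  have hL := hD.L_nonneg
  have hLψ := hD.Lψ_nonneg
  have h1 : 0 < 1 / D.δ := by positivity
  have h2 : 0 < 1 / D.δ₁ := by positivity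
  have h3 : 0 < 1 / D.lam := by positivity
  have h4 : 0 < 1 / (√D.q - D.ρ₀) := one_div_pos.2 (sub_pos.2 hρ)
  have h5 : 0 ≤ D.initErr := div_nonneg (mul_nonneg (by positivity)
    (Finset.sum_nonneg fun τ _ => sq_nonneg _)) (sub_pos.2 hP).le
  have hn : (0 : ℝ) ≤ n := n.cast_nonneg
  have hm1 : (1 : ℝ) ≤ m := by exact_mod_cast NeZero.one_le
  have h6 : (n : ℝ) ≤ n * m := le_mul_of_one_le_right hn hm1
  rw [logArg, ellf, ell]
  generalize 1 / D.δ = x1 at *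
  generalize 1 / D.δ₁ = x2 at *
  generalize 1 / D.lam = x3 at *
  generalize 1 / (√D.q - D.ρ₀) = x4 at *
  generalize D.initErr = x5 at *
  generalize (n : ℝ) * m = x6 at *
  refine ⟨?_, ?_, ?_, ?_, ?_, ?_, ?_, ?_, ?_, ?_⟩ <;>
    linarith only [h1, h2, h3, h4, h5, h6, hn, hl, hLf, hL, hLψ, hκ]

/-- The size of the stepsize, in terms of the argument of the logarithmic factor. -/
theorem stepsize_bounds (hD : D.ObjectiveAssumption) (hκ : 0 ≤ D.κ) (hlM : D.lam ≤ D.Lψ)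
    (hδ : 0 < D.δ) (hδ₁ : 0 < D.δ₁) (hρ : D.ρ₀ < √D.q)
    (hP : (⨅ x, D.P x) < D.P D.x₀) {c c₀ : ℝ} (hc₀ : c₀ ≤ 1) (hη : 0 < D.η)
    (hcη : c ≤ D.η * D.invStep) (hη' : D.η * D.invStep ≤ c₀) :
    D.η ≤ D.logArg ∧ c ≤ D.η * D.logArg ^ 3 := by
  have hl := hD.lam_pos
  obtain ⟨h2, -, hδi, -, hli, -, hM, hL, -, -⟩ := logArg_bounds hD hκ hδ hδ₁ hρ hP
  have hn1 : (1 : ℝ) ≤ n := by exact_mod_cast NeZero.one_le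
  have hLf := hD.Lf_nonneg
  have hLn := hD.L_nonneg
  have hlM' : D.lam ≤ D.ellf := by rw [ellf]; linarith only [hlM, hLf, hκ]
  have hell0 : 0 ≤ D.ell := by rw [ell]; linarith only [hl, hlM, hLn, hκ]
  have hM0 : 0 ≤ D.ellf := hl.le.trans hlM'
  generalize D.logArg = Λ at *
  have hΛ0 : 0 < Λ := by linarith only [h2]
  have p1 : 0 ≤ D.ell / n := by positivity
  have p2 : 0 ≤ √(1 - D.δ) * D.ellf / D.δ := by positivity
  constructor
  · have e1 : D.η * D.lam ≤ 1 := by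
      have : D.η * D.lam ≤ D.η * D.invStep :=
        mul_le_mul_of_nonneg_left (by rw [invStep]; linarith only [p1, p2, hlM']) hη.le
      linarith only [this, hη', hc₀]
    rw [div_le_iff₀ hl] at hli
    have e2 := mul_le_mul_of_nonneg_left e1 hΛ0.le
    have e3 := mul_le_mul_of_nonneg_left hli hη.le
    linarith only [e2, e3]
  · refine hcη.trans (mul_le_mul_of_nonneg_left ?_ hη.le)
    have e1 : D.ell / n ≤ Λ := (div_le_self hell0 hn1).trans hL
    have e2 : √(1 - D.δ) * D.ellf / D.δ ≤ Λ * Λ := by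
      have f1 : √(1 - D.δ) * D.ellf ≤ Λ := (mul_le_of_le_one_left hM0
        (Real.sqrt_le_one.2 (by linarith only [hδ]))).trans hM
      rw [div_eq_mul_one_div]
      exact mul_le_mul f1 hδi (by positivity) hΛ0.le
    have e3 : 2 * Λ ≤ Λ * Λ := mul_le_mul_of_nonneg_right h2 hΛ0.le
    have e4 : 2 * (Λ * Λ) ≤ Λ * (Λ * Λ) := mul_le_mul_of_nonneg_right h2 (by positivity)
    rw [invStep]
    linarith only [hM, e1, e2, e3, e4]

end Config

end ECCatalyst

end

/-! ### Choice of the constants and conclusion -/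

theorem mainTheorem6 (B : ℝ) (hB : 1 ≤ B) :
    ∃ c₀ : ℝ, 0 < c₀ ∧ ∀ c : ℝ, 0 < c → c ≤ c₀ → ∃ C : ℝ, 0 < C ∧
      ∀ (n m d : ℕ) [NeZero n] [NeZero m]
        (S : Type*) [MeasurableSpace S] (ν : Measure S) [IsProbabilityMeasure ν]
        (S₁ : Type*) [MeasurableSpace S₁] (ν₁ : Measure S₁) [IsProbabilityMeasure ν₁]
        (Ω : Type*) [MeasurableSpace Ω] (μ : Measure Ω) [IsProbabilityMeasure μ]
        (D : ECCatalyst.Config n m d S S₁)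
        (ζ : ℕ × ℕ → Ω → ECCatalyst.Noise n m S S₁),
        -- the problem and the compressors
        D.ObjectiveAssumption →
        ECCatalyst.IsContractionCompressor ν D.Q D.δ →
        ECCatalyst.IsContractionCompressor ν₁ D.Q₁ D.δ₁ →
        (∀ x, ∫ s, D.Q s x ∂ν = D.δ • x) →
        (∀ x, ∫ s, D.Q₁ s x ∂ν₁ = D.δ₁ • x) →
        -- the parameters of Catalyst
        0 ≤ D.κ → 0 ≤ D.ρ₀ → D.ρ₀ < √D.q →
        (⨅ x, D.P x) < D.P D.x₀ →
        -- the parameters of EC-LSVRG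
        0 < D.p → D.p ≤ 1 → D.δ₁ / B ≤ D.p → D.p ≤ B * D.δ₁ →
        c / D.invStep ≤ D.η → D.η ≤ c₀ / D.invStep →
        (∀ j, D.refWeight j / B ≤ D.a j ∧ D.a j ≤ B * D.refWeight j) →
        -- the randomness is fresh in every iteration of every inner loop
        (∀ j, Measurable (ζ j)) →
        (∀ j, μ.map (ζ j) = ECCatalyst.noiseLaw n m ν ν₁ D.p) →
        iIndepFun ζ μ →
        ∀ k : ℕ, 1 ≤ k →
          ∫⁻ ω, ((D.T (fun j => ζ j ω) k : ℕ∞) : ℝ≥0∞) ∂μ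
            ≤ ENNReal.ofReal (C * D.rate * D.logFactor) := by
  have hB0 : 0 < B := one_pos.trans_le hB
  obtain ⟨K, hK⟩ : ∃ K, K = 31920 * B ^ 2 := ⟨_, rfl⟩
  have hBB : B ≤ B ^ 2 := le_self_pow₀ hB two_ne_zero
  have hK600 : 600 ≤ K := by linarith only [hK, hBB, hB]
  have hBK : B ≤ K := by linarith only [hK, hBB, hB]
  have hK0 : 0 < K := by linarith only [hK600]
  have hc₀1 : 1 / (32 * K) ≤ 1 := by
    rw [div_le_one (by positivity)]
    linarith only [hK600]
  refine ⟨1 / (32 * K), by positivity, fun c hc hcc₀ => ?_⟩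
  have hlog2 : 0 < Real.log 2 := Real.log_pos one_lt_two
  have hA1 : 4 * K ≤ 4 * K / c := by
    rw [le_div_iff₀ hc]
    exact mul_le_of_le_one_right (by positivity) (hcc₀.trans hc₀1)
  have hA2 : 1 ≤ 4 * K / c := by linarith only [hA1, hK600]
  have hlogA : 0 ≤ Real.log (4 * K / c) := Real.log_nonneg hA2
  refine ⟨37 * (1 + Real.log (4 * K / c) / Real.log 2) * (8 / c + 8 + 2 * B)
    + (8 / c + 8 + 2 * B + 1) / Real.log 2, by positivity, ?_⟩
  intro n m d _ _ S _ ν _ S₁ _ ν₁ _ Ω _ μ _ D ζ hD hQ hQ₁ hmean hmean₁ hκ hρ0 hρq hP hp hp1 hpB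
    hpB' hcη hη' ha hζ hlaw hind k hk
  obtain ⟨k, rfl⟩ : ∃ j, k = j + 1 := ⟨k - 1, by omega⟩
  have hl := hD.lam_pos
  have hLf := hD.Lf_nonneg
  have hL := hD.L_nonneg
  have hn0 : (0 : ℝ) < n := by exact_mod_cast NeZero.pos n
  have hδ := hQ.pos
  have hδ₁ := hQ₁.pos
  -- A nonoptimal `x₀` excludes the degenerate one-point situation, in which `Lψ < lam` would be
  -- possible.
  have hlM := ECCatalyst.Config.lam_le_of_ne hD (ECCatalyst.Config.nontrivial_of_iInf_lt hD hP)
  have hlM' : D.lam ≤ D.ellf := by rw [ECCatalyst.Config.ellf]; linarith only [hlM, hLf, hκ]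
  have hlL' : D.lam ≤ D.ell := by rw [ECCatalyst.Config.ell]; linarith only [hlM, hL, hκ]
  have hM0 := hl.trans_le hlM'
  have hL0 := hl.trans_le hlL'
  have hinv : 0 < D.invStep := by
    rw [ECCatalyst.Config.invStep]
    positivity
  have hη : 0 < D.η := (div_pos hc hinv).trans_le hcη
  rw [div_le_iff₀ hinv] at hcη
  rw [le_div_iff₀ hinv] at hη'
  obtain ⟨h2, hnΛ, hδΛ, hδ₁Λ, hlΛ, hκΛ, hMΛ, hLΛ, hqΛ, hiΛ⟩ :=
    ECCatalyst.Config.logArg_bounds hD hκ hδ hδ₁ hρq hP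
  obtain ⟨hηΛ, hcΛ⟩ := ECCatalyst.Config.stepsize_bounds hD hκ hlM hδ hδ₁ hρq hP hc₀1 hη hcη
    hη'
  have hfac : D.logFactor = Real.log D.logArg := rfl
  rw [hfac]
  generalize D.logArg = Λ at *
  have hΛ0 : 0 < Λ := by linarith only [h2]
  -- `W` is `Λ` enlarged by a factor depending only on `B` and `c`, so that it also dominates `4 *
  -- K` and, through `c ≤ η * Λ ^ 3`, powers of it dominate `1 / η`.
  obtain ⟨W, hWdef⟩ : ∃ W, W = 4 * K / c * Λ := ⟨_, rfl⟩
  have hΛW : Λ ≤ W := by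
    rw [hWdef]
    exact le_mul_of_one_le_left hΛ0.le hA2
  have hKW : 4 * K ≤ W := by
    rw [hWdef]
    exact hA1.trans (le_mul_of_one_le_right (by positivity) (by linarith only [h2]))
  have hW0 : 0 < W := hΛ0.trans_le hΛW
  have hW1 : 1 ≤ W := by linarith only [hΛW, h2]
  have hcW : 1 ≤ W * c := by
    have e1 : W * c = 4 * K * Λ := by
      rw [hWdef]
      field_simp
    have e2 : 4 * K * 1 ≤ 4 * K * Λ :=
      mul_le_mul_of_nonneg_left (by linarith only [h2]) (by positivity)
    linarith only [e1, e2, hK600]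
  have hηW : 1 ≤ W ^ 5 * D.η := by
    have e1 : W * c ≤ W * (D.η * W ^ 3) := by gcongr; exact hcΛ.trans (by gcongr)
    have e2 : W ^ 4 * D.η ≤ W ^ 5 * D.η :=
      mul_le_mul_of_nonneg_right (pow_le_pow_right₀ hW1 (by norm_num)) hη.le
    linarith only [hcW, e1, e2]
  have hbd := ECCatalyst.Config.bounded_of_le hlM' hlL' hl hδ hQ.le_one hδ₁ hB hK600 hp hp1 hpB ha
    hKW (by linarith only [hBK, hKW, hK0]) (hnΛ.trans hΛW) (hδΛ.trans hΛW) (hδ₁Λ.trans hΛW)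
    (hlΛ.trans hΛW) (hκΛ.trans hΛW) (hMΛ.trans hΛW) (hLΛ.trans hΛW) (hqΛ.trans hΛW)
    (hiΛ.trans hΛW) hη (hηΛ.trans hΛW) hηW
  obtain ⟨hrate1, hrate⟩ := ECCatalyst.Config.inv_contraction_le hD hκ hδ hQ.le_one hδ₁ hp hB hpB
    hc hη hcη
  have hμ : 0 < D.lam + D.κ := by linarith only [hl, hκ]
  -- The contraction parameter is taken as `ρ = 1 / x`. The sum `x` dominates each of its four
  -- terms, so `ρ` meets the four upper bounds required of it, and `x` is at most a constant times
  -- the rate.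
  obtain ⟨x, hx⟩ : ∃ x, x = 2 / (D.η * (D.lam + D.κ)) + 4 / D.δ + 4 / D.δ₁ + 2 / D.p := ⟨_, rfl⟩
  have x1 : 0 < 2 / (D.η * (D.lam + D.κ)) := by positivity
  have x2 : 0 < 4 / D.δ := by positivity
  have x3 : 0 < 4 / D.δ₁ := by positivity
  have x4 : 0 < 2 / D.p := by positivity
  have hx0 : 0 < x := by linarith only [hx, x1, x2, x3, x4]
  have hinvx : ∀ u v : ℝ, 0 < u → 0 < v → u / v ≤ x → 1 / x ≤ v / u := by
    intro u v hu hv h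
    rw [div_le_div_iff₀ hx0 hu]
    rw [div_le_iff₀ hv] at h
    linarith only [h]
  have y1 := hinvx 2 (D.η * (D.lam + D.κ)) two_pos (by positivity)
    (by linarith only [hx, x1, x2, x3, x4])
  have y2 := hinvx 4 D.δ four_pos hδ (by linarith only [hx, x1, x2, x3, x4])
  have y3 := hinvx 4 D.δ₁ four_pos hδ₁ (by linarith only [hx, x1, x2, x3, x4])
  have y4 := hinvx 2 D.p two_pos hp (by linarith only [hx, x1, x2, x3, x4])
  have hmain := ECCatalyst.Config.lintegral_T_le_log hD hκ hlM hQ hQ₁ hmean hmean₁ hρ0 hρq hP hp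
    hp1 hB hpB' hK rfl hη hη' (one_div_pos.2 hx0) (by linarith only [y4, hp1]) y1 y2 y3 y4
    (fun j => (ha j).2) hbd (by linarith only [hBK, hKW, hK0]) hηW hζ hlaw hind k
  refine hmain.trans (ENNReal.ofReal_le_ofReal ?_)
  rw [← hx] at hrate
  -- Since `2 ≤ Λ`, additive constants in the logarithm are at most constants times `log Λ`.
  have hlogW : Real.log W ≤ (1 + Real.log (4 * K / c) / Real.log 2) * Real.log Λ := by
    rw [hWdef, Real.log_mul (by positivity) hΛ0.ne', add_mul, one_mul, add_comm, div_mul_eq_mul_div]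
    refine add_le_add_right ?_ _
    rw [le_div_iff₀ hlog2]
    exact mul_le_mul_of_nonneg_left (Real.log_le_log two_pos h2) hlogA
  have hlogΛ : 1 ≤ Real.log Λ / Real.log 2 := by
    rw [one_le_div hlog2]
    exact Real.log_le_log two_pos h2
  have hlogW0 : 0 ≤ Real.log W := Real.log_nonneg hW1
  have e1 : Real.log W * x ≤ (1 + Real.log (4 * K / c) / Real.log 2) * Real.log Λ
      * ((8 / c + 8 + 2 * B) * D.rate) :=
    mul_le_mul hlogW hrate hx0.le (hlogW0.trans hlogW)
  have e2 : x + 1 ≤ (8 / c + 8 + 2 * B + 1) * D.rate := by linarith only [hrate, hrate1]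
  have e3 : x + 1 ≤ (8 / c + 8 + 2 * B + 1) * D.rate * (Real.log Λ / Real.log 2) :=
    e2.trans (le_mul_of_one_le_right (by positivity) hlogΛ)
  rw [div_div_eq_mul_div, div_one, one_div_one_div]
  have e4 : (37 * (1 + Real.log (4 * K / c) / Real.log 2) * (8 / c + 8 + 2 * B)
      + (8 / c + 8 + 2 * B + 1) / Real.log 2) * D.rate * Real.log Λ
      = 37 * ((1 + Real.log (4 * K / c) / Real.log 2) * Real.log Λ
        * ((8 / c + 8 + 2 * B) * D.rate))
        + (8 / c + 8 + 2 * B + 1) * D.rate * (Real.log Λ / Real.log 2) := by ring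
  rw [e4]
  linarith only [e1, e3]
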